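/- **Setting.** Let $\mathcal X\subseteq\mathbb R^d$ with a probability distribution $\mathcal P_{\mathcal X}$, $N\ge 1$, and let $\Delta\subset\mathbb R^K$ be the probability simplex. Let $\boldsymbol f^\natural:\mathcal X\to\Delta$ be the true membership function and $\boldsymbol A\in\mathbb R^{K\times K}$ a confusion matrix (nonnegative entries, columns summing to $1$). For data $\boldsymbol x=(x_1,\dots,x_N)\in\mathcal X^N$ and $\boldsymbol f:\mathcal X\to\Delta$ write $\boldsymbol M_{\boldsymbol f}=[\boldsymbol f(x_1),\dots,\boldsymbol f(x_N)]$ and $\boldsymbol M^\natural=\boldsymbol M_{\boldsymbol f^\natural}$. Given the data, the annotations $(i_m,j_m,y_m)$, $m\ge1$, are independent, $(i_m,j_m)$ is uniform on $[N]\times[N]$, and $y_m\mid(i_m,j_m)\sim\mathrm{Bernoulli}\big(\langle \boldsymbol A\boldsymbol f^\natural(x_{i_m}),\boldsymbol A\boldsymbol f^\natural(x_{j_m})\rangle\big)$. For $\boldsymbol B\in[0,1]^{K\times K}$ the loss on the first $M$ annotations is $$\mathsf{Loss}'_M(\boldsymbol f,\boldsymbol B)=\frac1M\sum_{m=1}^M\Big(y_m\log\frac1{\boldsymbol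 f(x_{i_m})^{\top}\boldsymbol B\boldsymbol f(x_{j_m})}+(1-y_m)\log\frac1{1-\boldsymbol f(x_{i_m})^{\top}\boldsymbol B\boldsymbol f(x_{j_m})}\Big)\in[0,\infty].$$ A function class $\mathcal F$ consists of all $\boldsymbol\phi\circ\mathrm{net}(\cdot;\theta)$ on $\mathcal X$, where $\boldsymbol\phi:\mathbb R^K\to\Delta$ is a fixed $1$-Lipschitz output layer (such as softmax or the Euclidean projection onto $\Delta$) and $\mathrm{net}(x;\theta)=\sigma_L(W_L\sigma_{L-1}(\cdots\sigma_1(W_1x)))\in\mathbb R^K$, with fixed $\rho_i$-Lipschitz $\sigma_i$, $\sigma_i(0)=0$, and weights satisfying $\|W_i\|_2\le s_i$ and $\|W_i^{\top}-W_{0,i}^{\top}\|_{2,1}\le b_i$ for fixed reference matrices $W_{0,i}$ ($s_i>0$, $b_i\ge0$). With $D$ the largest layer dimension (input and output included), set $R_{\mathrm{NET}}=\log(2D^2)\big(\prod_i s_i^2\rho_i^2\big)\big(\sum_i(b_i/s_i)^{2/3}\big)^3$. The class is closed under relabelling if $\boldsymbol\Pi\boldsymbol f\in\mathcal F$ for all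 $\boldsymbol f\in\mathcal F$ and all permutation matrices $\boldsymbol\Pi$. A matrix $\boldsymbol M\in\mathbb R^{K\times N}$ satisfies the sufficiently scattered condition (SSC) if for some $\mathcal S\subseteq[N]$ one has $\{v\in\mathbb R^K:\sqrt{K-1}\,\|v\|\le\boldsymbol 1^{\top}v\}\subseteq\mathrm{cone}(\boldsymbol M[:,\mathcal S])$, and $\mathrm{cone}(\boldsymbol M[:,\mathcal S])\subseteq\mathrm{cone}(\boldsymbol Q)$ holds for no orthogonal $\boldsymbol Q$ other than permutation matrices. **Limit regime.** Let $t=1,2,\dots$ index a sequence of function classes $\mathcal F_t$ (possibly all equal) with complexities $R_t$, sample sizes $M_t\ge 1$ and constants $\alpha_t\in(0,1)$ such that, for all $t$, $\boldsymbol f^\natural\in\mathcal F_t$ and $\alpha_t<\boldsymbol f(u)^{\top}\boldsymbol f(v)<1-\alpha_t$ for all $\boldsymbol f\in\mathcal F_t$ and $u,v\in\mathcal X$; and suppose $\max\big(\log(1/\alpha_t),\log(M_t)\sqrt{R_t}/\alpha_t\big)/\sqrt{M_t}\to0$. A sequence $(\boldsymbol f_t,\boldsymbol B_t)\in\mathcal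 F_t\times[0,1]^{K\times K}$ minimizes the loss in the limit if $\mathsf{Loss}'_{M_t}(\boldsymbol f_t,\boldsymbol B_t)$ exceeds the minimal value over $\mathcal F_t\times[0,1]^{K\times K}$ by at most $\eta$ for all large $t$, for each $\eta>0$ (exact minimizers are a special case). It is a maximum-volume solution if moreover, for every sequence $(\boldsymbol g_t,\boldsymbol C_t)$ that minimizes the loss in the limit and every $\eta>0$, $\log\det(\boldsymbol M_{\boldsymbol g_t}\boldsymbol M_{\boldsymbol g_t}^{\top})\le\log\det(\boldsymbol M_{\boldsymbol f_t}\boldsymbol M_{\boldsymbol f_t}^{\top})+\eta$ for all large $t$ (with $\log0=-\infty$). **Theorem (identifiability of the noisy case).** There are sets $G_{\mathcal F,\boldsymbol\Pi,\delta}\subseteq\mathcal X^N$, for function classes $\mathcal F$, permutation matrices $\boldsymbol\Pi$ and real $\delta$, such that if $\boldsymbol f^\natural\in\mathcal F$ and $\delta\in(0,1)$, then i.i.d. data $x_1,\dots,x_N\sim\mathcal P_{\mathcal X}$ lie in $G_{\mathcal F,\boldsymbol\Pi,\delta}$ with probability at least $1-\delta$; these sets do not depend on $\boldsymbol\Pi$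 when $\mathcal F$ is closed under relabelling; and the following holds in the limit regime above. For all data $\boldsymbol x$ such that $\boldsymbol M^\natural$ satisfies the SSC and $\mathrm{rank}(\boldsymbol A^{\top}\boldsymbol A\boldsymbol M^\natural)=K$, almost surely over the annotations, every maximum-volume solution $(\boldsymbol f_t,\boldsymbol B_t)$ satisfies: (i) there are permutation matrices $\boldsymbol\Pi_t$ with $\boldsymbol\Pi_t\boldsymbol M_{\boldsymbol f_t}\to\boldsymbol M^\natural$; and every limit point $\boldsymbol M^\star$ of $(\boldsymbol M_{\boldsymbol f_t})$ satisfies $\boldsymbol\Pi^\star\boldsymbol M^\star=\boldsymbol M^\natural$ for some permutation matrix $\boldsymbol\Pi^\star$; (ii) with the same $\boldsymbol\Pi_t$, for all $\delta\in(0,1)$, $\eta>0$ and all large $t$: if $\boldsymbol x\in G_{\mathcal F_t,\boldsymbol\Pi_t,\delta}$, then, with $\|\boldsymbol X\|_{\mathrm F}^2=\sum_n\|x_n\|^2$, $$\mathbb E_{x\sim\mathcal P_{\mathcal X}}\Big[\frac1K\|\boldsymbol\Pi_t\boldsymbol f_t(x)-\boldsymbol f^\natural(x)\|^2\Big]\le\frac{8}{NK}+\frac{12\sqrt{2R_t}\,\|\boldsymbol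 X\|_{\mathrm F}\log N}{NK\log2}+8\sqrt{\frac{2\log(4/\delta)}{NK^2}}+\eta.$$ -/

import Mathlib

open MeasureTheory ProbabilityTheory Filter Topology
open scoped ENNReal NNReal Matrix

namespace DCC

noncomputable section

/-! ### Membership vectors and annotation confusion -/

/-- Probability vectors on `K` clusters (membership vectors). -/
abbrev Simplex (K : ℕ) : Type := stdSimplex ℝ (Fin K)

/-- The inner product of two membership vectors is a probability. -/
def sim {K : ℕ} (u v : Simplex K) : unitInterval :=
  ⟨(u : Fin K → ℝ) ⬝ᵥ (v : Fin K → ℝ), by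
    constructor
    · exact Finset.sum_nonneg fun k _ => mul_nonneg (u.2.1 k) (v.2.1 k)
    · calc (u : Fin K → ℝ) ⬝ᵥ (v : Fin K → ℝ) ≤ ∑ k, u k * 1 := by
            refine Finset.sum_le_sum fun k _ => mul_le_mul_of_nonneg_left ?_ (u.2.1 k)
            calc v k ≤ ∑ l, v l :=
                  Finset.single_le_sum (f := fun l => v l) (fun l _ => v.2.1 l) (Finset.mem_univ k)
              _ = 1 := v.2.2
        _ = 1 := by simp⟩

/-- The confused membership vector `A m`, where `A i j = Pr(i | j)` is column stochastic. -/
def confuse {K : ℕ} (A : Matrix (Fin K) (Fin K) ℝ) (hA : A ∈ Matrix.colStochastic ℝ (Fin K))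
    (u : Simplex K) : Simplex K :=
  ⟨A *ᵥ (u : Fin K → ℝ), Matrix.nonneg_mulVec_of_mem_colStochastic hA u.2.1, by
    have h1 : ∑ k, (A *ᵥ (u : Fin K → ℝ)) k = (1 ᵥ* A) ⬝ᵥ (u : Fin K → ℝ) := by
      rw [← Matrix.dotProduct_mulVec]; simp [dotProduct]
    rw [h1, hA.2]
    simp [dotProduct]⟩

/-! ### The random annotations -/

/-- An annotation `(i, j, y)`; `y = true` means "similar". -/
abbrev Annotation (N : ℕ) : Type := Fin N × Fin N × Bool

/-- The law of one annotation: `(i, j)` is uniform on `[N] × [N]`, and given `(i, j)` the label is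
Bernoulli with success probability `P i j`. -/
def annotationLaw {N : ℕ} (P : Fin N → Fin N → unitInterval) : Measure (Annotation N) :=
  ∑ i, ∑ j, ((N : ℝ≥0∞) ^ 2)⁻¹ • (bernoulliMeasure true false (P i j)).map (fun y => (i, j, y))

instance {N : ℕ} [NeZero N] (P : Fin N → Fin N → unitInterval) :
    IsProbabilityMeasure (annotationLaw P) := by
  constructor
  have h : ∀ i j, ((bernoulliMeasure true false (P i j)).map
      (fun y => ((i, j, y) : Annotation N))) Set.univ = 1 := by
    intro i j
    rw [Measure.map_apply (measurable_of_countable _) MeasurableSet.univ]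
    simp
  have hN : (N : ℝ≥0∞) ≠ 0 := by exact_mod_cast NeZero.ne N
  simp only [annotationLaw, Measure.finsetSum_apply, Measure.smul_apply, h, smul_eq_mul, mul_one,
    Finset.sum_const, Finset.card_univ, Fintype.card_fin, nsmul_eq_mul]
  rw [← mul_assoc, ← sq]
  exact ENNReal.mul_inv_cancel (pow_ne_zero 2 hN) (ENNReal.pow_ne_top (ENNReal.natCast_ne_top N))

/-- The law of an infinite stream of independent annotations; the annotations of a sample of
size `M` are its first `M` entries. -/
def annotationStream {N : ℕ} (P : Fin N → Fin N → unitInterval) : Measure (ℕ → Annotation N) :=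
  Measure.infinitePi fun _ : ℕ => annotationLaw P

/-! ### Neural network classes and their complexity -/

/-- The data of one network layer `z ↦ act (W z)`, `W ∈ ℝ^{n × m}`: a fixed `lip`-Lipschitz
nonlinearity that vanishes at `0`, a bound `s` on the spectral norm of `W`, a reference matrix, and
a bound `b` on the `(2,1)`-norm of `Wᵀ - refᵀ`. -/
structure LayerSpec (m n : ℕ) where
  act : EuclideanSpace ℝ (Fin n) → EuclideanSpace ℝ (Fin n)
  lip : ℝ≥0
  act_lipschitz : LipschitzWith lip act
  act_zero : act 0 = 0
  s : ℝ
  s_pos : 0 < s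
  ref : Matrix (Fin n) (Fin m) ℝ
  b : ℝ
  b_nonneg : 0 ≤ b

/-- A feed-forward architecture from `ℝ^d` to `ℝ^n`: a finite list of composable layers. -/
inductive Arch (d : ℕ) : ℕ → Type
  | input : Arch d d
  | snoc {m : ℕ} (a : Arch d m) {n : ℕ} (ℓ : LayerSpec m n) : Arch d n

/-- The `(2,1)`-norm: the sum of the Euclidean norms of the columns. -/
def norm21 {m n : ℕ} (X : Matrix (Fin m) (Fin n) ℝ) : ℝ := ∑ j, √(∑ i, X i j ^ 2)

open scoped Matrix.Norms.L2Operator in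
/-- The weight matrices allowed in a layer; `‖W‖` is the spectral norm. -/
def LayerSpec.weights {m n : ℕ} (ℓ : LayerSpec m n) : Set (Matrix (Fin n) (Fin m) ℝ) :=
  {W | ‖W‖ ≤ ℓ.s ∧ norm21 (Wᵀ - ℓ.refᵀ) ≤ ℓ.b}

/-- The functions `net(·; θ)`, with `θ` ranging over all allowed weights. -/
def Arch.nets {d : ℕ} : {n : ℕ} → Arch d n →
    Set (EuclideanSpace ℝ (Fin d) → EuclideanSpace ℝ (Fin n))
  | _, .input => {id}
  | _, .snoc a ℓ => {h | ∃ g ∈ a.nets, ∃ W ∈ ℓ.weights,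
      h = fun x => ℓ.act (Matrix.toEuclideanLin W (g x))}

/-- The largest layer dimension `D` (input and output included). -/
def Arch.maxDim {d : ℕ} : {n : ℕ} → Arch d n → ℕ
  | _, .input => d
  | n, .snoc a _ => max a.maxDim n

/-- `∏ s_j² ρ_j²`. -/
def Arch.lipProd {d : ℕ} : {n : ℕ} → Arch d n → ℝ
  | _, .input => 1
  | _, .snoc a ℓ => a.lipProd * (ℓ.s ^ 2 * (ℓ.lip : ℝ) ^ 2)

/-- `∑ (b_i / s_i)^{2/3}`. -/
def Arch.ratioSum {d : ℕ} : {n : ℕ} → Arch d n → ℝ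
  | _, .input => 0
  | _, .snoc a ℓ => a.ratioSum + (ℓ.b / ℓ.s) ^ (2 / 3 : ℝ)

/-- The spectral complexity
`R_NET = log (2 D²) (∏ s_j² ρ_j²) (∑ (b_i / s_i)^{2/3})³`. -/
def Arch.complexity {d n : ℕ} (a : Arch d n) : ℝ :=
  Real.log (2 * (a.maxDim : ℝ) ^ 2) * a.lipProd * a.ratioSum ^ 3

/-- An output layer `ℝ^K → simplex` that is `1`-Lipschitz for the Euclidean norms, for example
softmax, or the Euclidean projection onto the simplex (sparsemax). -/
structure OutputLayer (K : ℕ) where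
  out : EuclideanSpace ℝ (Fin K) → Simplex K
  out_lipschitz : ∀ z w, √(∑ k, (out z k - out w k) ^ 2) ≤ ‖z - w‖

/-- A network architecture followed by an output layer. -/
structure NetClass (d K : ℕ) where
  arch : Arch d K
  output : OutputLayer K

/-- The function class `F`, as a set of functions on the data domain `𝒳 ⊆ ℝ^d`. -/
def NetClass.funs {d K : ℕ} (c : NetClass d K) (𝒳 : Set (EuclideanSpace ℝ (Fin d))) :
    Set (𝒳 → Simplex K) :=
  {f | ∃ h ∈ c.arch.nets, f = fun u : 𝒳 => c.output.out (h (u : EuclideanSpace ℝ (Fin d)))}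

/-- Relabelling the clusters does not lead out of `F`. -/
def ClosedUnderRelabelling {X : Type*} {K : ℕ} (F : Set (X → Simplex K)) : Prop :=
  ∀ f ∈ F, ∀ π : Equiv.Perm (Fin K), ∃ g ∈ F, ∀ u k, g u k = f u (π k)

/-! ### Membership matrices and the sufficiently scattered condition -/

/-- The matrix `[f x₁, …, f x_N]`. -/
def membership {X : Type*} {K N : ℕ} (f : X → Simplex K) (x : Fin N → X) :
    Matrix (Fin K) (Fin N) ℝ :=
  Matrix.of fun k n => f (x n) k

/-- The conic hull of the columns. -/
def colCone {ι κ : Type*} [Fintype κ] (X : Matrix ι κ ℝ) : Set (ι → ℝ) :=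
  {y | ∃ θ : κ → ℝ, (∀ n, 0 ≤ θ n) ∧ y = X *ᵥ θ}

/-- The second-order cone `{x | √(K - 1) ‖x‖ ≤ 1ᵀ x}`. -/
def socCone (K : ℕ) : Set (Fin K → ℝ) :=
  {x | √((K : ℝ) - 1) * √(∑ k, x k ^ 2) ≤ ∑ k, x k}

/-- The sufficiently scattered condition. -/
def SSC {K N : ℕ} (X : Matrix (Fin K) (Fin N) ℝ) : Prop :=
  ∃ S : Finset (Fin N),
    socCone K ⊆ colCone (X.submatrix id (fun n : S => (n : Fin N))) ∧
    ∀ Q ∈ Matrix.orthogonalGroup (Fin K) ℝ,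
      colCone (X.submatrix id (fun n : S => (n : Fin N))) ⊆ colCone Q →
        ∃ π : Equiv.Perm (Fin K), Q = π.permMatrix ℝ

/-- `log det (X Xᵀ)`, with value `-∞` for a singular Gram matrix. -/
def logVol {K N : ℕ} (X : Matrix (Fin K) (Fin N) ℝ) : EReal :=
  ENNReal.log (ENNReal.ofReal (X * Xᵀ).det)

/-! ### The modified logistic loss -/

/-- `log (1 / q)` for `q ∈ [0, 1]`, with value `+∞` at `q = 0`. -/
def logInv (q : ℝ) : ℝ≥0∞ := if q ≤ 0 then ⊤ else ENNReal.ofReal (Real.log (1 / q))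

/-- The modified logistic loss over the first `M` annotations of the stream `S`. -/
def loss {X : Type*} {K N : ℕ} (x : Fin N → X) (S : ℕ → Annotation N) (M : ℕ)
    (f : X → Simplex K) (B : Matrix (Fin K) (Fin K) ℝ) : ℝ≥0∞ :=
  (M : ℝ≥0∞)⁻¹ * ∑ m ∈ Finset.range M,
    (let p : ℝ := (f (x (S m).1) : Fin K → ℝ) ⬝ᵥ (B *ᵥ (f (x (S m).2.1) : Fin K → ℝ))
     if (S m).2.2 = true then logInv p else logInv (1 - p))

/-- The constraint `0 ≤ B ≤ 1` (entrywise). -/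
def box (K : ℕ) : Set (Matrix (Fin K) (Fin K) ℝ) := {B | ∀ k l, 0 ≤ B k l ∧ B k l ≤ 1}

/-- `(f t, B t)` are feasible and minimize the modified loss in the limit: the gap to the optimal
value tends to `0`. Exact minimizers for every `t` are a special case. -/
def IsLimitMinimizer {X : Type*} {K N : ℕ} (F : ℕ → Set (X → Simplex K)) (M : ℕ → ℕ)
    (x : Fin N → X) (S : ℕ → Annotation N)
    (f : ℕ → X → Simplex K) (B : ℕ → Matrix (Fin K) (Fin K) ℝ) : Prop :=
  (∀ t, f t ∈ F t ∧ B t ∈ box K) ∧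
  ∀ η : ℝ, 0 < η → ∀ᶠ t in atTop, ∀ g ∈ F t, ∀ C ∈ box K,
    loss x S (M t) (f t) (B t) ≤ loss x S (M t) g C + ENNReal.ofReal η

/-- `(f t, B t)` minimize the modified loss in the limit and, among all such solutions, have the
largest `log det (X Xᵀ)` in the limit, where `X = [f t x₁, …, f t x_N]`. -/
def IsMaxVolumeSolution {X : Type*} {K N : ℕ} (F : ℕ → Set (X → Simplex K)) (M : ℕ → ℕ)
    (x : Fin N → X) (S : ℕ → Annotation N)
    (f : ℕ → X → Simplex K) (B : ℕ → Matrix (Fin K) (Fin K) ℝ) : Prop :=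
  IsLimitMinimizer F M x S f B ∧
  ∀ g C, IsLimitMinimizer F M x S g C → ∀ η : ℝ, 0 < η → ∀ᶠ t in atTop,
    logVol (membership (g t) x) ≤ logVol (membership (f t) x) + (η : EReal)

/-! ### Generalization -/

/-- The expected error `E_{u ∼ P} [ (1/K) ‖Π f u - f₀ u‖² ]`. -/
def risk {X : Type*} [MeasurableSpace X] {K : ℕ} (P : Measure X) (π : Equiv.Perm (Fin K))
    (f f₀ : X → Simplex K) : ℝ :=
  ∫ u, (1 / (K : ℝ)) * ∑ k, ((π.permMatrix ℝ *ᵥ (f u : Fin K → ℝ)) k - f₀ u k) ^ 2 ∂P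

/-- The generalization bound, with `‖X‖_F` the Frobenius norm of the data matrix. -/
def genBound {d K N : ℕ} {𝒳 : Set (EuclideanSpace ℝ (Fin d))} (R : ℝ) (x : Fin N → 𝒳) (δ : ℝ) :
    ℝ :=
  8 / (N * K)
    + 12 * √(2 * R) * √(∑ n, ‖(x n : EuclideanSpace ℝ (Fin d))‖ ^ 2) * Real.log N
        / (N * K * Real.log 2)
    + 8 * √(2 * Real.log (4 / δ) / (N * K ^ 2))

end

end DCC

/-! For fixed data an annotation takes only finitely many values, so by the strong law all empirical
frequencies converge almost surely. The excess loss of any prediction over the truth dominates its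
squared Hellinger distance to the truth, up to an error that does not depend on the prediction
(`logLoss_add_hellinger_le`). Hence the truth, with `B = Aᵀ A`, minimizes the loss in the limit, and
along every limit minimizer the predicted similarities converge to the true ones. No entropy of the
network class enters here; the limit regime enters through `M t → ∞`.

A cluster point `Y` of the membership matrices therefore satisfies `Yᵀ B Y = Xᵀ (Aᵀ A) X` for some
`B`, where `X` is the true matrix. The rank hypothesis turns this into `Y = U X`. Unit column sums
pass to `U`, and comparing volumes with the truth, itself a competitor, gives `(det U)² ≥ 1`. As `Y
≥ 0`, the cone inclusion in the SSC bounds the norm of each row of `U` by its sum, while all entries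
of `U` add up to `K`. By AM-GM the row norms have product at most one, so Hadamard's inequality is
an equality and `U` is orthogonal (`mul_transpose_eq_one_of_det`); the second half of the SSC makes
`Uᵀ` a permutation (`SSC.exists_perm`). Compactness turns this statement on cluster points into
convergence after relabelling (`exists_perm_tendsto`).

The risk bound is uniform over the class and does not involve the annotations. Maurey's empirical
method covers the images of one layer, and the covers are composed along the network, with radius
and entropy shared in proportion to the quantities `(b/s)^(2/3)` (`Arch.exists_cover`). The squared
error is Lipschitz in the network output, so error vectors have entropy of order `ε⁻²`, and chaining
over at most `log₃ N` scales bounds their Rademacher average (`two_div_mul_rad_le`). Symmetrization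
and bounded differences give the bound for finite families, and a countable dense family extends it
to the class (`measure_compl_goodData_le`). On the good data the risk is at most the empirical error
plus the bound, and the empirical error tends to zero by the first part. -/

namespace DCC

/-! ### The geometry of sufficiently scattered matrices -/

/-- The dual of the cone `√(K - 1) ‖x‖ ≤ 1ᵀ x` is contained in the cone `‖u‖ ≤ 1ᵀ u`. -/
theorem norm_le_sum_of_dual_socCone {K : ℕ} (u : Fin K → ℝ)
    (h : ∀ v ∈ socCone K, 0 ≤ u ⬝ᵥ v) : √(∑ k, u k ^ 2) ≤ ∑ k, u k := by
  rcases Nat.eq_zero_or_pos K with rfl | hK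
  · simp
  have hK1 : (1 : ℝ) ≤ K := by exact_mod_cast hK
  set s := ∑ k, u k with hs
  have hs0 : 0 ≤ s := by
    have := h (fun _ => 1) (by
      simp only [socCone, Set.mem_ofPred_eq, one_pow, Finset.sum_const, Finset.card_univ,
        Fintype.card_fin, nsmul_eq_mul, mul_one]
      rw [← Real.sqrt_mul (by linarith)]
      apply Real.sqrt_le_iff.2
      constructor <;> nlinarith)
    simpa [dotProduct] using this
  set w : Fin K → ℝ := fun k => u k - s / K with hw
  set W := ∑ k, w k ^ 2 with hW
  have hw1 : ∑ k, w k = 0 := by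
    simp only [hw, Finset.sum_sub_distrib, Finset.sum_const, Finset.card_univ, Fintype.card_fin,
      nsmul_eq_mul]
    rw [← hs]; field_simp; ring
  have hu : ∀ k, u k = w k + s / K := fun k => by simp [hw]
  have hn : ∑ k, u k ^ 2 = W + s ^ 2 / K := by
    have : ∀ k, u k ^ 2 = w k ^ 2 + 2 * (s / K) * w k + (s / K) ^ 2 := fun k => by rw [hu k]; ring
    simp only [this, Finset.sum_add_distrib, ← Finset.mul_sum, hw1, Finset.sum_const,
      Finset.card_univ, Fintype.card_fin, nsmul_eq_mul]
    rw [← hW]; field_simp; ring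
  have hW0 : 0 ≤ W := Finset.sum_nonneg fun k _ => sq_nonneg _
  have huw : ∑ k, u k * w k = W := by
    have : ∀ k, u k * w k = w k ^ 2 + (s / K) * w k := fun k => by rw [hu k]; ring
    simp only [this, Finset.sum_add_distrib, ← Finset.mul_sum, hw1]
    rw [← hW]; ring
  set a := √((K - 1) * W) with ha
  have ha2 : a ^ 2 = (K - 1) * W := Real.sq_sqrt (mul_nonneg (by linarith) hW0)
  have ha0 : 0 ≤ a := Real.sqrt_nonneg _
  have hk2 : √(K : ℝ) ^ 2 = K := Real.sq_sqrt (by linarith)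
  -- The extremal test vector: the boundary ray of the cone that points against the centred part `w`
  -- of `u`. The value of `a` is the one giving equality in the cone condition.
  have key := h (fun k => a - √(K : ℝ) * w k) (by
    simp only [socCone, Set.mem_ofPred_eq]
    have e1 : ∑ k, (a - √(K : ℝ) * w k) = K * a := by
      rw [Finset.sum_sub_distrib, ← Finset.mul_sum, hw1]; simp
    have e2 : ∑ k, (a - √(K : ℝ) * w k) ^ 2 = K * a ^ 2 + K * W := by
      have : ∀ k, (a - √(K : ℝ) * w k) ^ 2 = a ^ 2 - 2 * a * √(K : ℝ) * w k + K * w k ^ 2 :=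
        fun k => by linear_combination w k ^ 2 * hk2
      simp only [this, Finset.sum_add_distrib, Finset.sum_sub_distrib, ← Finset.mul_sum, hw1]
      simp [hW]
    rw [e1, e2, ← Real.sqrt_mul (by linarith)]
    apply Real.sqrt_le_iff.2
    refine ⟨by positivity, ?_⟩
    rw [mul_pow, ha2]
    apply le_of_eq; ring)
  have key2 : √(K : ℝ) * W ≤ a * s := by
    have : u ⬝ᵥ (fun k => a - √(K : ℝ) * w k) = a * s - √(K : ℝ) * W := by
      simp only [dotProduct, mul_sub, Finset.sum_sub_distrib]
      rw [← huw, hs, Finset.mul_sum, Finset.mul_sum]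
      congr 1 <;> exact Finset.sum_congr rfl fun k _ => by ring
    linarith
  have key3 : K * W ≤ (K - 1) * s ^ 2 := by
    rcases hW0.eq_or_lt with h0 | h0
    · rw [← h0]; nlinarith [mul_nonneg (sub_nonneg.2 hK1) (sq_nonneg s)]
    · have : (√(K : ℝ) * W) ^ 2 ≤ (a * s) ^ 2 := by gcongr
      rw [mul_pow, mul_pow, hk2, ha2] at this
      have : W * (K * W) ≤ W * ((K - 1) * s ^ 2) := by linarith
      exact le_of_mul_le_mul_left this h0
  apply Real.sqrt_le_iff.2
  refine ⟨hs0, ?_⟩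
  rw [hn]
  have : W ≤ s ^ 2 - s ^ 2 / K := by
    rw [show s ^ 2 - s ^ 2 / K = (K - 1) * s ^ 2 / K by field_simp]
    rw [le_div_iff₀ (by linarith)]; linarith
  linarith

/-- Every summand is nonnegative and vanishes only at `1`. This is the equality case of AM-GM in
additive form, applied below both to row norms and to eigenvalues. -/
theorem eq_one_of_sum_sub_log_le {ι : Type*} [Fintype ι] {x : ι → ℝ} (hx : ∀ i, 0 < x i)
    (h : ∑ i, (x i - 1 - Real.log (x i)) ≤ 0) (i : ι) : x i = 1 := by
  have h0 : ∀ i, 0 ≤ x i - 1 - Real.log (x i) := fun i => by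
    linarith [Real.log_le_sub_one_of_pos (hx i)]
  have h1 := (Finset.sum_eq_zero_iff_of_nonneg (fun i _ => h0 i)).1
    (le_antisymm h (Finset.sum_nonneg fun i _ => h0 i)) i (Finset.mem_univ i)
  by_contra hne
  linarith [Real.log_lt_sub_one_of_pos (hx i) hne]

/-- The equality case of Hadamard's inequality combined with that of the AM-GM inequality. -/
theorem mul_transpose_eq_one_of_det {K : ℕ} (U : Matrix (Fin K) (Fin K) ℝ)
    (hdet : 1 ≤ U.det ^ 2) (hsum : ∑ k, ∑ l, U k l = K)
    (hrow : ∀ k, √(∑ l, U k l ^ 2) ≤ ∑ l, U k l) : U * Uᵀ = 1 := by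
  have hdet0 : U.det ≠ 0 := fun h => by rw [h] at hdet; norm_num at hdet
  set r : Fin K → ℝ := fun k => √(∑ l, U k l ^ 2) with hr
  have hr0 : ∀ k, 0 < r k := by
    intro k
    apply Real.sqrt_pos.2
    by_contra hcon
    have hz := (Finset.sum_eq_zero_iff_of_nonneg (fun l _ => sq_nonneg (U k l))).1
      (le_antisymm (not_lt.1 hcon) (Finset.sum_nonneg fun l _ => sq_nonneg _))
    exact hdet0 (Matrix.det_eq_zero_of_row_eq_zero k fun l => by
      simpa using hz l (Finset.mem_univ l))
  have hr2 : ∀ k, r k ^ 2 = ∑ l, U k l ^ 2 := fun k =>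
    Real.sq_sqrt (Finset.sum_nonneg fun l _ => sq_nonneg _)
  -- Normalizing the rows gives a Gram matrix with unit diagonal, hence with trace `K`; Hadamard's
  -- inequality for `U` is then AM-GM for the eigenvalues of `G`.
  set V : Matrix (Fin K) (Fin K) ℝ := Matrix.diagonal (fun k => (r k)⁻¹) * U with hV
  set G := V * Vᵀ with hG
  have hGpsd : G.PosSemidef := by
    have := Matrix.posSemidef_self_mul_conjTranspose V
    simpa [Matrix.conjTranspose_eq_transpose_of_trivial] using this
  have hVk : ∀ k l, V k l = (r k)⁻¹ * U k l := fun k l => by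
    simp [hV, Matrix.diagonal_mul]
  have hdiag : ∀ k, G k k = 1 := by
    intro k
    simp only [hG, Matrix.mul_apply, Matrix.transpose_apply, hVk]
    have : ∀ l, (r k)⁻¹ * U k l * ((r k)⁻¹ * U k l) = (r k ^ 2)⁻¹ * U k l ^ 2 := fun l => by
      field_simp
    simp only [this, ← Finset.mul_sum]
    rw [← hr2]
    exact inv_mul_cancel₀ (pow_ne_zero 2 (hr0 k).ne')
  have hdetV : V.det = (∏ k, r k)⁻¹ * U.det := by
    simp [hV, Matrix.det_mul, Matrix.det_diagonal]
  have hdetG : G.det = ((∏ k, r k)⁻¹) ^ 2 * U.det ^ 2 := by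
    simp only [hG, Matrix.det_mul, Matrix.det_transpose, hdetV]; ring
  have hP0 : 0 < ∏ k, r k := Finset.prod_pos fun k _ => hr0 k
  have hGH := hGpsd.isHermitian
  have hprod : ∏ i, hGH.eigenvalues i = G.det := by
    rw [hGH.det_eq_prod_eigenvalues]; simp
  have hGdet0 : 0 < G.det := by rw [hdetG]; positivity
  have hlam : ∀ i, 0 < hGH.eigenvalues i := by
    intro i
    refine lt_of_le_of_ne (hGpsd.eigenvalues_nonneg i) fun h0 => ?_
    rw [← hprod, Finset.prod_eq_zero (Finset.mem_univ i) h0.symm] at hGdet0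
    exact lt_irrefl _ hGdet0
  have htr : ∑ i, hGH.eigenvalues i = K := by
    have := hGH.trace_eq_sum_eigenvalues
    simp only [Matrix.trace, Matrix.diag, hdiag] at this
    simpa using this.symm
  have hsumr : ∑ k, r k ≤ K := by
    rw [← hsum]; exact Finset.sum_le_sum fun k _ => hrow k
  have hloglam : ∑ i, Real.log (hGH.eigenvalues i) = Real.log G.det := by
    rw [← hprod, Real.log_prod fun i _ => (hlam i).ne']
  have hlogr : ∑ k, Real.log (r k) = Real.log (∏ k, r k) := by
    rw [Real.log_prod fun i _ => (hr0 i).ne']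
  have hlogG : Real.log G.det = -2 * Real.log (∏ k, r k) + Real.log (U.det ^ 2) := by
    rw [hdetG, Real.log_mul (by positivity) (by positivity), Real.log_pow, Real.log_inv]
    push_cast; ring
  have hlogU : 0 ≤ Real.log (U.det ^ 2) := Real.log_nonneg hdet
  have s1 : ∑ i, (hGH.eigenvalues i - 1 - Real.log (hGH.eigenvalues i)) = - Real.log G.det := by
    simp only [Finset.sum_sub_distrib, htr, hloglam]; simp
  have s2 : ∑ k, (r k - 1 - Real.log (r k)) ≤ - Real.log (∏ k, r k) := by
    simp only [Finset.sum_sub_distrib, hlogr]; simpa using hsumr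
  have n1 : 0 ≤ ∑ i, (hGH.eigenvalues i - 1 - Real.log (hGH.eigenvalues i)) :=
    Finset.sum_nonneg fun i _ => by linarith [Real.log_le_sub_one_of_pos (hlam i)]
  have n2 : 0 ≤ ∑ k, (r k - 1 - Real.log (r k)) :=
    Finset.sum_nonneg fun i _ => by linarith [Real.log_le_sub_one_of_pos (hr0 i)]
  -- The eigenvalue sum plus twice the row-norm sum is at most `-log ((det U)²) ≤ 0`. Both are
  -- nonnegative, so both vanish.
  have hl1 := eq_one_of_sum_sub_log_le hlam (by linarith)
  have hr1 := eq_one_of_sum_sub_log_le hr0 (by linarith)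
  have hG1 : G = 1 := by
    have := hGH.spectral_theorem
    have hd : (RCLike.ofReal ∘ hGH.eigenvalues : Fin K → ℝ) = 1 := by
      funext i; simp [hl1 i]
    rw [hd] at this
    rw [this]
    simp
  have hVU : V = U := by ext k l; rw [hVk, hr1]; simp
  rw [← hG1, hG, hVU]

/-- A mixing matrix of volume at least one which keeps a sufficiently scattered matrix inside the
simplex is a permutation. -/
theorem SSC.exists_perm {K N : ℕ} {X Y : Matrix (Fin K) (Fin N) ℝ} (hX : SSC X)
    (U : Matrix (Fin K) (Fin K) ℝ) (hY : ∀ k n, 0 ≤ Y k n) (hYX : Y = U * X)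
    (hU : ∀ l, ∑ k, U k l = 1) (hdet : 1 ≤ U.det ^ 2) :
    ∃ π : Equiv.Perm (Fin K), π.permMatrix ℝ * Y = X := by
  obtain ⟨S, hS, hperm⟩ := hX
  have horth : U * Uᵀ = 1 := by
    apply mul_transpose_eq_one_of_det U hdet
    · calc ∑ k, ∑ l, U k l = ∑ l, ∑ k, U k l := Finset.sum_comm
        _ = K := by simp only [hU]; simp
    · intro k
      -- Since `Y = U X` is nonnegative, each row of `U` pairs nonnegatively with the columns of
      -- `X`, hence with the second-order cone inside their conic hull.
      apply norm_le_sum_of_dual_socCone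
      intro v hv
      obtain ⟨θ, hθ, rfl⟩ := hS hv
      rw [Matrix.dotProduct_mulVec]
      refine Finset.sum_nonneg fun n _ => mul_nonneg ?_ (hθ n)
      have := hY k n
      rw [hYX, Matrix.mul_apply] at this
      simpa [Matrix.vecMul, dotProduct] using this
  have hback : Uᵀ * Y = X := by
    rw [hYX, ← Matrix.mul_assoc, mul_eq_one_comm.1 horth, Matrix.one_mul]
  obtain ⟨π, hπ⟩ := hperm Uᵀ (by
    rw [Matrix.mem_orthogonalGroup_iff, Matrix.transpose_transpose]
    exact mul_eq_one_comm.1 horth) (by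
    -- As `X = Uᵀ Y`, a conic combination of columns of `X` has coefficients `Y θ ≥ 0` over the
    -- columns of `Uᵀ`.
    rintro y ⟨θ, hθ, rfl⟩
    refine ⟨Y.submatrix id (fun n : S => (n : Fin N)) *ᵥ θ, fun k => ?_, ?_⟩
    · exact Finset.sum_nonneg fun n _ => mul_nonneg (hY _ _) (hθ n)
    · rw [Matrix.mulVec_mulVec, ← hback]
      rfl)
  exact ⟨π, by rw [← hπ, hback]⟩

/-- Two rank-`K` factorizations of the same matrix differ by a mixing matrix. -/
theorem exists_mixing {K N : ℕ} {X Y : Matrix (Fin K) (Fin N) ℝ}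
    {B C : Matrix (Fin K) (Fin K) ℝ} (hC : IsUnit C.det) (hX : IsUnit (X * Xᵀ).det)
    (h : Yᵀ * B * Y = Xᵀ * C * X) :
    ∃ U : Matrix (Fin K) (Fin K) ℝ, Y = U * X := by
  -- Multiply the identity by `X` on the left, then cancel `X Xᵀ` and `C`: this expresses `X`
  -- through `Y`. Nonsingularity of `X Xᵀ` forces `T` to be invertible.
  set T := C⁻¹ * ((X * Xᵀ)⁻¹ * (X * (Yᵀ * B))) with hT
  have hXT : X = T * Y := by
    have : X * (Yᵀ * B) * Y = (X * Xᵀ) * (C * X) := by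
      calc X * (Yᵀ * B) * Y = X * (Yᵀ * B * Y) := by simp only [Matrix.mul_assoc]
        _ = _ := by rw [h]; simp only [Matrix.mul_assoc]
    calc X = C⁻¹ * ((X * Xᵀ)⁻¹ * ((X * Xᵀ) * (C * X))) := by
            rw [← Matrix.mul_assoc (X * Xᵀ)⁻¹, Matrix.nonsing_inv_mul _ hX, Matrix.one_mul,
              ← Matrix.mul_assoc, Matrix.nonsing_inv_mul _ hC, Matrix.one_mul]
      _ = T * Y := by rw [← this, hT]; simp only [Matrix.mul_assoc]
  have hTu : IsUnit T.det := by
    have : (X * Xᵀ).det = T.det * ((Y * Yᵀ).det * T.det) := by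
      rw [hXT, Matrix.transpose_mul]
      rw [show T * Y * (Yᵀ * Tᵀ) = T * (Y * Yᵀ * Tᵀ) by simp only [Matrix.mul_assoc]]
      simp [Matrix.det_mul]
    rw [this] at hX
    exact isUnit_of_mul_isUnit_left hX
  refine ⟨T⁻¹, ?_⟩
  calc Y = T⁻¹ * (T * Y) := by
        rw [← Matrix.mul_assoc, Matrix.nonsing_inv_mul _ hTu, Matrix.one_mul]
    _ = T⁻¹ * X := by rw [← hXT]

/-- Identifiability of the noiseless limit problem. -/
theorem exists_perm_of_factorization {K N : ℕ} {X Y : Matrix (Fin K) (Fin N) ℝ}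
    {B C : Matrix (Fin K) (Fin K) ℝ} (hSSC : SSC X) (hC : IsUnit C.det)
    (hX : 0 < (X * Xᵀ).det) (hvol : (X * Xᵀ).det ≤ (Y * Yᵀ).det)
    (hX1 : ∀ n, ∑ k, X k n = 1) (hY1 : ∀ n, ∑ k, Y k n = 1) (hY0 : ∀ k n, 0 ≤ Y k n)
    (h : Yᵀ * B * Y = Xᵀ * C * X) :
    ∃ π : Equiv.Perm (Fin K), π.permMatrix ℝ * Y = X := by
  obtain ⟨U, hU⟩ := exists_mixing hC hX.ne'.isUnit h
  refine hSSC.exists_perm U hY0 hU ?_ ?_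
  · have h1 : (1 : Fin K → ℝ) ᵥ* X = 1 := by
      ext n; simpa [Matrix.vecMul, dotProduct] using hX1 n
    have h2 : (1 : Fin K → ℝ) ᵥ* Y = 1 := by
      ext n; simpa [Matrix.vecMul, dotProduct] using hY1 n
    -- Both factors have unit column sums, so `1ᵀ U X = 1ᵀ X`; the Gram matrix of `X` can then be
    -- cancelled.
    have h3 : ((1 : Fin K → ℝ) ᵥ* U) ᵥ* (X * Xᵀ) = (1 : Fin K → ℝ) ᵥ* (X * Xᵀ) := by
      rw [← Matrix.vecMul_vecMul, ← Matrix.vecMul_vecMul, Matrix.vecMul_vecMul _ U, ← hU, h1, h2]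
    have h4 : (1 : Fin K → ℝ) ᵥ* U = 1 := by
      have := congrArg (fun v => v ᵥ* (X * Xᵀ)⁻¹) h3
      simpa [Matrix.vecMul_vecMul, Matrix.mul_nonsing_inv _ hX.ne'.isUnit, Matrix.mul_assoc]
        using this
    intro l
    simpa [Matrix.vecMul, dotProduct] using congrFun h4 l
  · have : (Y * Yᵀ).det = U.det ^ 2 * (X * Xᵀ).det := by
      rw [hU, Matrix.transpose_mul, show U * X * (Xᵀ * Uᵀ) = U * (X * Xᵀ * Uᵀ) by
        simp only [Matrix.mul_assoc], Matrix.det_mul, Matrix.det_mul, Matrix.det_transpose]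
      ring
    rw [this] at hvol
    nlinarith

/-! ### Consistency of the empirical logistic loss -/

/-- The relative frequency of `a` among the first `M` entries of `S`. -/
noncomputable def freq {α : Type*} [DecidableEq α] (S : ℕ → α) (M : ℕ) (a : α) : ℝ :=
  (∑ m ∈ Finset.range M, if S m = a then (1 : ℝ) else 0) / M

theorem freq_nonneg {α : Type*} [DecidableEq α] (S : ℕ → α) (M : ℕ) (a : α) : 0 ≤ freq S M a :=
  div_nonneg (Finset.sum_nonneg fun _ _ => by split_ifs <;> norm_num) (Nat.cast_nonneg _)

theorem freq_eq_zero {α : Type*} [DecidableEq α] {S : ℕ → α} {a : α} {M : ℕ}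
    (h : ∀ m < M, S m ≠ a) : freq S M a = 0 := by
  unfold freq
  rw [Finset.sum_eq_zero, zero_div]
  intro m hm
  rw [if_neg (h m (Finset.mem_range.1 hm))]

theorem sum_freq_mul {α : Type*} [DecidableEq α] [Fintype α] (S : ℕ → α) (M : ℕ) (g : α → ℝ) :
    ∑ a, freq S M a * g a = (∑ m ∈ Finset.range M, g (S m)) / M := by
  simp only [freq, div_mul_eq_mul_div, ← Finset.sum_div]
  congr 1
  simp only [Finset.sum_mul]
  rw [Finset.sum_comm]
  refine Finset.sum_congr rfl fun m _ => ?_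
  simp

/-- The empirical logarithmic loss of the prediction `q`. -/
noncomputable def logLoss {α : Type*} (S : ℕ → α) (M : ℕ) (q : α → ℝ) : ℝ≥0∞ :=
  (M : ℝ≥0∞)⁻¹ * ∑ m ∈ Finset.range M, logInv (q (S m))

theorem logLoss_eq_ofReal {α : Type*} [DecidableEq α] [Fintype α] {S : ℕ → α} {M : ℕ}
    (hM : 0 < M) {q : α → ℝ} (hq : ∀ m < M, 0 < q (S m)) (hq1 : ∀ a, q a ≤ 1) :
    logLoss S M q = ENNReal.ofReal (∑ a, freq S M a * Real.log (1 / q a)) := by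
  have hpos : (0 : ℝ) < M := by exact_mod_cast hM
  rw [sum_freq_mul, div_eq_inv_mul, ENNReal.ofReal_mul (by positivity),
    ENNReal.ofReal_inv_of_pos hpos, ENNReal.ofReal_natCast, logLoss, ENNReal.ofReal_sum_of_nonneg]
  · congr 1
    refine Finset.sum_congr rfl fun m hm => ?_
    rw [logInv, if_neg (not_le.2 (hq m (Finset.mem_range.1 hm)))]
  · intro m hm
    apply Real.log_nonneg
    rw [le_div_iff₀ (hq m (Finset.mem_range.1 hm))]
    linarith [hq1 (S m)]

theorem logLoss_eq_top {α : Type*} {S : ℕ → α} {M : ℕ} {q : α → ℝ} {m : ℕ} (hm : m < M)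
    (hq : q (S m) ≤ 0) : logLoss S M q = ⊤ := by
  rw [logLoss, ENNReal.mul_eq_top]
  left
  refine ⟨ENNReal.inv_ne_zero.2 (ENNReal.natCast_ne_top M), ?_⟩
  rw [ENNReal.sum_eq_top]
  exact ⟨m, Finset.mem_range.2 hm, by rw [logInv, if_pos hq]⟩

/-- `log (p / q) ≥ 2 (1 - √q / √p)`. -/
theorem two_mul_one_sub_le_log {p q : ℝ} (hp : 0 < p) (hq : 0 < q) :
    2 * (1 - √q / √p) ≤ Real.log (1 / q) - Real.log (1 / p) := by
  have h := Real.log_le_sub_one_of_pos (div_pos (Real.sqrt_pos.2 hq) (Real.sqrt_pos.2 hp))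
  rw [Real.log_div (Real.sqrt_pos.2 hq).ne' (Real.sqrt_pos.2 hp).ne', Real.log_sqrt hq.le,
    Real.log_sqrt hp.le] at h
  rw [one_div, one_div, Real.log_inv, Real.log_inv]
  linarith

/-- The excess loss of any prediction dominates the squared Hellinger distance to the truth, up to
an error which is uniform in the prediction. -/
theorem logLoss_add_hellinger_le {α : Type*} [DecidableEq α] [Fintype α] {S : ℕ → α}
    {p : α → ℝ} (hp0 : ∀ a, 0 ≤ p a) (hp1 : ∀ a, p a ≤ 1) {c : ℝ} (hc : 0 ≤ c)
    (hS : ∀ a, Tendsto (fun M => freq S M a) atTop (𝓝 (c * p a)))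
    (hS0 : ∀ m, p (S m) ≠ 0) {η : ℝ} (hη : 0 < η) :
    ∀ᶠ M in atTop, logLoss S M p ≠ ⊤ ∧
      ∀ q : α → ℝ, (∀ a, 0 ≤ q a) → (∀ a, q a ≤ 1) → ∑ a, q a = ∑ a, p a →
        logLoss S M p + ENNReal.ofReal (c * ∑ a, (√(p a) - √(q a)) ^ 2)
          ≤ logLoss S M q + ENNReal.ofReal η := by
  -- This error majorant does not depend on `q`, which makes the bound uniform. Where `p a = 0` the
  -- convention `1 / 0 = 0` leaves the harmless weight `2`.
  have herr : Tendsto (fun M => ∑ a, |freq S M a - c * p a| * (2 * (1 + 1 / √(p a)))) atTop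
      (𝓝 0) := by
    have : Tendsto (fun M => ∑ a, |freq S M a - c * p a| * (2 * (1 + 1 / √(p a)))) atTop
        (𝓝 (∑ a : α, |c * p a - c * p a| * (2 * (1 + 1 / √(p a))))) :=
      tendsto_finsetSum _ fun a _ => (((hS a).sub_const _).abs).mul_const _
    simpa using this
  have hpS : ∀ m, 0 < p (S m) := fun m => lt_of_le_of_ne (hp0 _) (hS0 m).symm
  filter_upwards [herr.eventually (gt_mem_nhds hη), eventually_gt_atTop 0] with M hM hM0
  have hLp := logLoss_eq_ofReal hM0 (fun m _ => hpS m) hp1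
  refine ⟨by rw [hLp]; exact ENNReal.ofReal_ne_top, fun q hq0 hq1 hqs => ?_⟩
  -- A prediction that excludes an observed value has infinite loss, so nothing is left to prove.
  by_cases hbad : ∃ m < M, q (S m) ≤ 0
  · obtain ⟨m, hm, hqm⟩ := hbad
    rw [logLoss_eq_top hm hqm]; simp
  push Not at hbad
  rw [hLp, logLoss_eq_ofReal hM0 hbad hq1, ← ENNReal.ofReal_add]
  rotate_left
  · rw [sum_freq_mul]
    refine div_nonneg (Finset.sum_nonneg fun m _ => Real.log_nonneg ?_) (Nat.cast_nonneg _)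
    rw [le_div_iff₀ (hpS m)]; linarith [hp1 (S m)]
  · exact mul_nonneg hc (Finset.sum_nonneg fun _ _ => sq_nonneg _)
  refine le_trans (ENNReal.ofReal_le_ofReal ?_) ENNReal.ofReal_add_le
  have hterm : ∀ a, freq S M a * Real.log (1 / p a) + 2 * (c * p a) * (1 - √(q a) / √(p a))
      ≤ freq S M a * Real.log (1 / q a) + |freq S M a - c * p a| * (2 * (1 + 1 / √(p a))) := by
    intro a
    have h1 : 2 * freq S M a * (1 - √(q a) / √(p a))
        ≤ freq S M a * (Real.log (1 / q a) - Real.log (1 / p a)) := by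
      -- An unobserved value may have `p a = 0` or `q a = 0`, where the logarithmic inequality is
      -- not available; its frequency is then zero.
      by_cases hex : ∃ m < M, S m = a
      · obtain ⟨m, hm, rfl⟩ := hex
        have := mul_le_mul_of_nonneg_left (two_mul_one_sub_le_log (hpS m) (hbad m hm))
          (freq_nonneg S M (S m))
        linarith
      · push Not at hex
        rw [freq_eq_zero hex]; simp
    have h2 : |1 - √(q a) / √(p a)| ≤ 1 + 1 / √(p a) := by
      have : √(q a) / √(p a) ≤ 1 / √(p a) := by
        gcongr
        exact Real.sqrt_le_one.2 (hq1 a)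
      have h0 : 0 ≤ √(q a) / √(p a) := by positivity
      rw [abs_le]; constructor <;> linarith
    have h3 : 2 * (c * p a - freq S M a) * (1 - √(q a) / √(p a))
        ≤ |freq S M a - c * p a| * (2 * (1 + 1 / √(p a))) := by
      calc 2 * (c * p a - freq S M a) * (1 - √(q a) / √(p a))
          ≤ |2 * (c * p a - freq S M a) * (1 - √(q a) / √(p a))| := le_abs_self _
        _ = |freq S M a - c * p a| * (2 * |1 - √(q a) / √(p a)|) := by
            rw [abs_mul, abs_mul, abs_sub_comm]; norm_num; ring
        _ ≤ _ := by gcongr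
    linarith
  have hsum := Finset.sum_le_sum fun a (_ : a ∈ Finset.univ) => hterm a
  rw [Finset.sum_add_distrib, Finset.sum_add_distrib] at hsum
  -- Termwise `2 (p - √(p q)) = (√p - √q)² + (p - q)`, and the last differences cancel because `p`
  -- and `q` have equal total mass.
  have hHell : ∑ a, 2 * (c * p a) * (1 - √(q a) / √(p a))
      = c * ∑ a, (√(p a) - √(q a)) ^ 2 := by
    have e1 : ∀ a, 2 * (c * p a) * (1 - √(q a) / √(p a))
        = c * (√(p a) - √(q a)) ^ 2 + c * (p a - q a) := by
      intro a
      have hp2 := Real.sq_sqrt (hp0 a)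
      have hq2 := Real.sq_sqrt (hq0 a)
      rcases (hp0 a).eq_or_lt with h0 | h0
      · rw [← h0]; simp [hq2]
      · have : p a * (√(q a) / √(p a)) = √(p a) * √(q a) := by
          nth_rw 1 [← hp2]
          field_simp [(Real.sqrt_pos.2 h0).ne']
        linear_combination (-2 * c) * this - c * hp2 - c * hq2
    simp only [e1, Finset.sum_add_distrib, ← Finset.mul_sum, Finset.sum_sub_distrib, hqs]
    ring
  rw [hHell] at hsum
  linarith

/-! ### The law of large numbers for the annotations -/

/-- The probability of the label `b` under success probability `p`. -/
def labelProb (p : ℝ) (b : Bool) : ℝ := if b = true then p else 1 - p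

theorem annotationLaw_real_singleton {N : ℕ} [NeZero N] (P : Fin N → Fin N → unitInterval)
    (a : Annotation N) :
    (annotationLaw P).real {a} = ((N : ℝ) ^ 2)⁻¹ * labelProb (P a.1 a.2.1) a.2.2 := by
  obtain ⟨i, j, b⟩ := a
  have hmap : ∀ i' j', ((bernoulliMeasure true false (P i' j')).map
      (fun y => ((i', j', y) : Annotation N))) {(i, j, b)}
      = if i' = i ∧ j' = j then bernoulliMeasure true false (P i j) {b} else 0 := by
    intro i' j'
    rw [Measure.map_apply (measurable_of_countable _) (measurableSet_singleton _)]
    split_ifs with h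
    · obtain ⟨rfl, rfl⟩ := h
      congr 1; ext y; simp
    · have : (fun y => ((i', j', y) : Annotation N)) ⁻¹' {(i, j, b)} = ∅ := by
        ext y; simp; tauto
      rw [this]; simp
  have hb : (bernoulliMeasure true false (P i j)).real {b} = labelProb (P i j) b := by
    rw [bernoulliMeasure_real_apply _ (measurableSet_singleton _)]
    cases b <;> simp [labelProb]
  have : annotationLaw P {(i, j, b)}
      = ((N : ℝ≥0∞) ^ 2)⁻¹ * bernoulliMeasure true false (P i j) {b} := by
    simp only [annotationLaw, Measure.finsetSum_apply, Measure.smul_apply, hmap, smul_eq_mul]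
    rw [Finset.sum_eq_single i, Finset.sum_eq_single j]
    · simp
    · intro j' _ h; simp [h]
    · simp
    · intro i' _ h; simp [h]
    · simp
  rw [measureReal_def, this, ENNReal.toReal_mul, ← measureReal_def, hb]
  simp

/-- The strong law for the indicator of each of the finitely many annotations; the exceptional null
sets are united. -/
theorem ae_tendsto_freq {N : ℕ} [NeZero N] (P : Fin N → Fin N → unitInterval) :
    ∀ᵐ S ∂annotationStream P, ∀ a, Tendsto (fun M => freq S M a) atTop
      (𝓝 ((annotationLaw P).real {a})) := by
  rw [ae_all_iff]
  intro a
  set g : Annotation N → ℝ := fun b => if b = a then 1 else 0 with hg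
  have hgm : Measurable g := measurable_of_countable _
  have hmp : ∀ m, MeasurePreserving (Function.eval m) (annotationStream P) (annotationLaw P) :=
    fun m => measurePreserving_eval_infinitePi (fun _ : ℕ => annotationLaw P) m
  have hind : iIndepFun (fun (m : ℕ) (S : ℕ → Annotation N) => g (S m)) (annotationStream P) :=
    iIndepFun_infinitePi (P := fun _ : ℕ => annotationLaw P) (X := fun _ => g) fun _ => hgm
  have hint0 : Integrable g (annotationLaw P) := Integrable.of_finite
  have hslln := strong_law_ae_real (μ := annotationStream P)
    (fun (m : ℕ) (S : ℕ → Annotation N) => g (S m))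
    ((hmp 0).integrable_comp_of_integrable hint0)
    (fun m n hmn => hind.indepFun hmn)
    (fun m => by
      refine ⟨(hgm.comp (measurable_pi_apply m)).aemeasurable,
        (hgm.comp (measurable_pi_apply 0)).aemeasurable, ?_⟩
      have h1 : ∀ m, (annotationStream P).map (fun S => g (S m)) = (annotationLaw P).map g := by
        intro m
        rw [← (hmp m).map_eq, Measure.map_map hgm (measurable_pi_apply m)]
        rfl
      rw [h1 m, h1 0])
  have hexp : ∫ S, g (S 0) ∂annotationStream P = (annotationLaw P).real {a} := by
    have : ∫ S, g (S 0) ∂annotationStream P = ∫ b, g b ∂annotationLaw P := by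
      rw [← (hmp 0).map_eq, integral_map (measurable_pi_apply 0).aemeasurable
        hgm.aestronglyMeasurable]
    rw [this, ← integral_indicator_one (measurableSet_singleton a)]
    refine integral_congr_ae (Eventually.of_forall fun b => ?_)
    simp [hg, Set.indicator_apply]
  filter_upwards [hslln] with S hS
  rw [hexp] at hS
  exact hS

/-- Ensures that the truth never predicts probability zero for an observed label, so that its loss
stays finite for every sample size. -/
theorem ae_stream_ne_zero {N : ℕ} [NeZero N] (P : Fin N → Fin N → unitInterval) :
    ∀ᵐ S ∂annotationStream P, ∀ m, (annotationLaw P).real {S m} ≠ 0 := by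
  rw [ae_all_iff]
  intro m
  have hmp : MeasurePreserving (Function.eval m) (annotationStream P) (annotationLaw P) :=
    measurePreserving_eval_infinitePi (fun _ : ℕ => annotationLaw P) m
  have h0 : ∀ᵐ b ∂annotationLaw P, (annotationLaw P).real {b} ≠ 0 := by
    rw [ae_iff_of_countable]
    intro b hb
    simpa [measureReal_def, ENNReal.toReal_eq_zero_iff] using hb
  exact hmp.quasiMeasurePreserving.ae h0

/-! ### Limits of approximate minimizers -/

/-- The predicted probability of an annotation, given its pair. -/
noncomputable def pred {X : Type*} {K N : ℕ} (x : Fin N → X) (f : X → Simplex K)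
    (B : Matrix (Fin K) (Fin K) ℝ) (a : Annotation N) : ℝ :=
  labelProb ((f (x a.1) : Fin K → ℝ) ⬝ᵥ (B *ᵥ (f (x a.2.1) : Fin K → ℝ))) a.2.2

theorem loss_eq_logLoss {X : Type*} {K N : ℕ} (x : Fin N → X) (S : ℕ → Annotation N) (M : ℕ)
    (f : X → Simplex K) (B : Matrix (Fin K) (Fin K) ℝ) :
    loss x S M f B = logLoss S M (pred x f B) := by
  unfold loss logLoss
  congr 1
  refine Finset.sum_congr rfl fun m _ => ?_
  simp only [pred, labelProb]
  split_ifs <;> rfl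

theorem dotProduct_mem_Icc {K : ℕ} (u : Simplex K) {v : Fin K → ℝ} (hv : ∀ k, 0 ≤ v k ∧ v k ≤ 1) :
    0 ≤ (u : Fin K → ℝ) ⬝ᵥ v ∧ (u : Fin K → ℝ) ⬝ᵥ v ≤ 1 := by
  refine ⟨Finset.sum_nonneg fun k _ => mul_nonneg (u.2.1 k) (hv k).1, ?_⟩
  calc (u : Fin K → ℝ) ⬝ᵥ v ≤ ∑ k, (u : Fin K → ℝ) k * 1 :=
        Finset.sum_le_sum fun k _ => mul_le_mul_of_nonneg_left (hv k).2 (u.2.1 k)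
    _ = 1 := by simp

theorem bilin_mem_Icc {K : ℕ} (u v : Simplex K) {B : Matrix (Fin K) (Fin K) ℝ} (hB : B ∈ box K) :
    0 ≤ (u : Fin K → ℝ) ⬝ᵥ (B *ᵥ (v : Fin K → ℝ)) ∧
      (u : Fin K → ℝ) ⬝ᵥ (B *ᵥ (v : Fin K → ℝ)) ≤ 1 := by
  refine dotProduct_mem_Icc u fun k => ?_
  have := dotProduct_mem_Icc v (v := fun l => B k l) fun l => hB k l
  rwa [dotProduct_comm] at this

theorem labelProb_mem_Icc {p : ℝ} (hp : 0 ≤ p ∧ p ≤ 1) (b : Bool) :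
    0 ≤ labelProb p b ∧ labelProb p b ≤ 1 := by
  unfold labelProb
  split_ifs
  · exact hp
  · constructor <;> linarith [hp.1, hp.2]

theorem sum_labelProb {N : ℕ} (q : Fin N → Fin N → ℝ) :
    ∑ a : Annotation N, labelProb (q a.1 a.2.1) a.2.2 = (N : ℝ) * N := by
  simp [Fintype.sum_prod_type, labelProb]

theorem transpose_mul_self_mem_box {K : ℕ} {A : Matrix (Fin K) (Fin K) ℝ}
    (hA : A ∈ Matrix.colStochastic ℝ (Fin K)) : Aᵀ * A ∈ box K := by
  intro k l
  have h0 : ∀ i j, 0 ≤ A i j := fun i j => Matrix.nonneg_of_mem_colStochastic hA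
  rw [Matrix.mul_apply]
  refine ⟨Finset.sum_nonneg fun i _ => mul_nonneg (h0 _ _) (h0 _ _), ?_⟩
  calc ∑ i, Aᵀ k i * A i l ≤ ∑ i, A i k * 1 :=
        Finset.sum_le_sum fun i _ => mul_le_mul_of_nonneg_left
          (Matrix.le_one_of_mem_colStochastic hA) (h0 _ _)
    _ = 1 := by simpa using Matrix.sum_col_of_mem_colStochastic hA k

theorem sim_confuse {K : ℕ} {A : Matrix (Fin K) (Fin K) ℝ}
    (hA : A ∈ Matrix.colStochastic ℝ (Fin K)) (u v : Simplex K) :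
    ((sim (confuse A hA u) (confuse A hA v) : unitInterval) : ℝ)
      = (u : Fin K → ℝ) ⬝ᵥ ((Aᵀ * A) *ᵥ (v : Fin K → ℝ)) := by
  rw [← Matrix.mulVec_mulVec, Matrix.dotProduct_mulVec, Matrix.vecMul_transpose]
  rfl

section limits

variable {X : Type*} {K N : ℕ} {x : Fin N → X} {f₀ : X → Simplex K}
  {A : Matrix (Fin K) (Fin K) ℝ} {hA : A ∈ Matrix.colStochastic ℝ (Fin K)}
  {F : ℕ → Set (X → Simplex K)} {M : ℕ → ℕ} {S : ℕ → Annotation N}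

/-- The law of an annotation is `N⁻²` times the prediction of the truth. For each pair the
probabilities of the two labels add up to one, so every prediction has total mass `N²` and the
Hellinger bound applies to all `g` and `C` at once. -/
theorem excess_loss [NeZero N] (hM : Tendsto M atTop atTop)
    (hS : ∀ a, Tendsto (fun m => freq S m a) atTop (𝓝 ((annotationLaw fun i j =>
      sim (confuse A hA (f₀ (x i))) (confuse A hA (f₀ (x j)))).real {a})))
    (hS0 : ∀ m, (annotationLaw fun i j =>
      sim (confuse A hA (f₀ (x i))) (confuse A hA (f₀ (x j)))).real {S m} ≠ 0)
    {η : ℝ} (hη : 0 < η) :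
    ∀ᶠ t in atTop, loss x S (M t) f₀ (Aᵀ * A) ≠ ⊤ ∧ ∀ (g : X → Simplex K), ∀ C ∈ box K,
      loss x S (M t) f₀ (Aᵀ * A)
        + ENNReal.ofReal (((N : ℝ) ^ 2)⁻¹ *
          ∑ a, (√(pred x f₀ (Aᵀ * A) a) - √(pred x g C a)) ^ 2)
        ≤ loss x S (M t) g C + ENNReal.ofReal η := by
  have hbox := transpose_mul_self_mem_box hA
  have hlaw : ∀ a : Annotation N, (annotationLaw fun i j =>
      sim (confuse A hA (f₀ (x i))) (confuse A hA (f₀ (x j)))).real {a}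
      = ((N : ℝ) ^ 2)⁻¹ * pred x f₀ (Aᵀ * A) a := fun a => by
    rw [annotationLaw_real_singleton, sim_confuse]; rfl
  simp only [hlaw] at hS hS0
  have h := logLoss_add_hellinger_le
    (fun a => (labelProb_mem_Icc (bilin_mem_Icc _ _ hbox) _).1)
    (fun a => (labelProb_mem_Icc (bilin_mem_Icc _ _ hbox) _).2) (by positivity) hS
    (fun m => right_ne_zero_of_mul (hS0 m)) hη
  filter_upwards [hM.eventually h] with t ht
  refine ⟨by rw [loss_eq_logLoss]; exact ht.1, fun g C hC => ?_⟩
  rw [loss_eq_logLoss, loss_eq_logLoss]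
  refine ht.2 (pred x g C) (fun a => (labelProb_mem_Icc (bilin_mem_Icc _ _ hC) _).1)
    (fun a => (labelProb_mem_Icc (bilin_mem_Icc _ _ hC) _).2) ?_
  unfold pred
  rw [sum_labelProb fun i j => (g (x i) : Fin K → ℝ) ⬝ᵥ (C *ᵥ (g (x j) : Fin K → ℝ)),
    sum_labelProb fun i j => (f₀ (x i) : Fin K → ℝ) ⬝ᵥ ((Aᵀ * A) *ᵥ (f₀ (x j) : Fin K → ℝ))]

/-- The truth minimizes the loss in the limit. -/
theorem isLimitMinimizer_truth [NeZero N] (hF : ∀ t, f₀ ∈ F t) (hM : Tendsto M atTop atTop)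
    (hS : ∀ a, Tendsto (fun m => freq S m a) atTop (𝓝 ((annotationLaw fun i j =>
      sim (confuse A hA (f₀ (x i))) (confuse A hA (f₀ (x j)))).real {a})))
    (hS0 : ∀ m, (annotationLaw fun i j =>
      sim (confuse A hA (f₀ (x i))) (confuse A hA (f₀ (x j)))).real {S m} ≠ 0) :
    IsLimitMinimizer F M x S (fun _ => f₀) (fun _ => Aᵀ * A) := by
  refine ⟨fun t => ⟨hF t, transpose_mul_self_mem_box hA⟩, fun η hη => ?_⟩
  filter_upwards [excess_loss hM hS hS0 hη] with t ht g _ C hC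
  exact le_trans le_self_add (ht.2 g C hC)

/-- Along approximate minimizers, the predicted similarities converge to the true ones. -/
theorem IsLimitMinimizer.tendsto_pred [NeZero N] (hF : ∀ t, f₀ ∈ F t) (hM : Tendsto M atTop atTop)
    (hS : ∀ a, Tendsto (fun m => freq S m a) atTop (𝓝 ((annotationLaw fun i j =>
      sim (confuse A hA (f₀ (x i))) (confuse A hA (f₀ (x j)))).real {a})))
    (hS0 : ∀ m, (annotationLaw fun i j =>
      sim (confuse A hA (f₀ (x i))) (confuse A hA (f₀ (x j)))).real {S m} ≠ 0)
    {f : ℕ → X → Simplex K} {B : ℕ → Matrix (Fin K) (Fin K) ℝ}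
    (hf : IsLimitMinimizer F M x S f B) (a : Annotation N) :
    Tendsto (fun t => pred x (f t) (B t) a) atTop (𝓝 (pred x f₀ (Aᵀ * A) a)) := by
  have hbox := transpose_mul_self_mem_box hA
  have hN : (0 : ℝ) < ((N : ℝ) ^ 2)⁻¹ := by
    have : (N : ℝ) ≠ 0 := by exact_mod_cast NeZero.ne N
    positivity
  have hsq : Tendsto (fun t => (√(pred x f₀ (Aᵀ * A) a) - √(pred x (f t) (B t) a)) ^ 2) atTop
      (𝓝 0) := by
    rw [Metric.tendsto_nhds]
    intro ε hε
    -- One such error comes from the excess-loss bound and one from the optimality gap; together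
    -- they leave a Hellinger sum of at most `ε / 2`.
    have hη : 0 < ((N : ℝ) ^ 2)⁻¹ * ε / 4 := by positivity
    filter_upwards [excess_loss hM hS hS0 hη, hf.2 _ hη] with t ht hft
    obtain ⟨hfin, ht⟩ := ht
    have h1 := (ht (f t) (B t) (hf.1 t).2).trans
      (add_le_add_left (hft f₀ (hF t) _ hbox) _)
    rw [add_assoc, ← ENNReal.ofReal_add hη.le hη.le] at h1
    have h2 := (ENNReal.ofReal_le_ofReal_iff (by positivity)).1
      ((ENNReal.add_le_add_iff_left hfin).1 h1)
    have h3 : ∑ a, (√(pred x f₀ (Aᵀ * A) a) - √(pred x (f t) (B t) a)) ^ 2 ≤ ε / 2 := by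
      refine le_of_mul_le_mul_left (h2.trans (le_of_eq ?_)) hN
      ring
    have h4 := (Finset.single_le_sum (f := fun a => (√(pred x f₀ (Aᵀ * A) a)
      - √(pred x (f t) (B t) a)) ^ 2) (fun _ _ => sq_nonneg _) (Finset.mem_univ a)).trans h3
    rw [Real.dist_eq, sub_zero, abs_of_nonneg (sq_nonneg _)]
    exact lt_of_le_of_lt h4 (by linarith)
  have h5 : Tendsto (fun t => √(pred x (f t) (B t) a)) atTop (𝓝 √(pred x f₀ (Aᵀ * A) a)) := by
    have := hsq.sqrt
    simp only [Real.sqrt_sq_eq_abs, Real.sqrt_zero] at this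
    have := (tendsto_zero_iff_abs_tendsto_zero _).2 this
    simpa using (tendsto_const_nhds (x := √(pred x f₀ (Aᵀ * A) a))).sub this
  have h6 := h5.pow 2
  unfold pred at h6 ⊢
  rw [Real.sq_sqrt (labelProb_mem_Icc (bilin_mem_Icc _ _ hbox) _).1] at h6
  refine h6.congr fun t => ?_
  rw [Real.sq_sqrt (labelProb_mem_Icc (bilin_mem_Icc _ _ (hf.1 t).2) _).1]

theorem isCompact_box (K : ℕ) : IsCompact (box K) := by
  have : (box K : Set (Fin K → Fin K → ℝ))
      = Set.Icc (fun _ _ => (0 : ℝ)) (fun _ _ => (1 : ℝ)) := by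
    ext B
    exact ⟨fun h => ⟨fun k l => (h k l).1, fun k l => (h k l).2⟩,
      fun h k l => ⟨h.1 k l, h.2 k l⟩⟩
  change @IsCompact (Fin K → Fin K → ℝ) _ (box K)
  rw [this]
  exact isCompact_Icc

theorem membership_bilin (f : X → Simplex K) (B : Matrix (Fin K) (Fin K) ℝ) (i j : Fin N) :
    ((membership f x)ᵀ * B * membership f x) i j
      = (f (x i) : Fin K → ℝ) ⬝ᵥ (B *ᵥ (f (x j) : Fin K → ℝ)) := by
  rw [Matrix.mul_assoc]
  simp [Matrix.mul_apply, dotProduct, Matrix.mulVec, membership]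

/-- A finite lower bound on the log-volume excludes singular `Y t`, so the inequality can be
exponentiated; let first `t` and then `η` tend to their limits. Hence the volume constraint survives
passage to cluster points. -/
theorem det_le_of_logVol_le {Y : ℕ → Matrix (Fin K) (Fin N) ℝ} {Y₀ X₀ : Matrix (Fin K) (Fin N) ℝ}
    {l : Filter ℕ} [l.NeBot] (hY : Tendsto Y l (𝓝 Y₀)) (hX₀ : 0 < (X₀ * X₀ᵀ).det)
    (h : ∀ η : ℝ, 0 < η → ∀ᶠ t in l, logVol X₀ ≤ logVol (Y t) + (η : EReal)) :
    (X₀ * X₀ᵀ).det ≤ (Y₀ * Y₀ᵀ).det := by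
  have hdet : Tendsto (fun t => (Y t * (Y t)ᵀ).det) l (𝓝 (Y₀ * Y₀ᵀ).det) := by
    have hc : Continuous fun Z : Matrix (Fin K) (Fin N) ℝ => (Z * Zᵀ).det := by fun_prop
    exact (hc.tendsto Y₀).comp hY
  have hkey : ∀ η : ℝ, 0 < η → (X₀ * X₀ᵀ).det ≤ (Y₀ * Y₀ᵀ).det * Real.exp η := by
    intro η hη
    refine ge_of_tendsto (hdet.mul_const _) ?_
    filter_upwards [h η hη] with t ht
    have hlogX : logVol X₀ = ((Real.log (X₀ * X₀ᵀ).det : ℝ) : EReal) := by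
      rw [logVol, ENNReal.log_ofReal_of_pos hX₀]
    rw [hlogX] at ht
    have hpos : 0 < (Y t * (Y t)ᵀ).det := by
      by_contra hcon
      rw [logVol, ENNReal.ofReal_of_nonpos (not_lt.1 hcon), ENNReal.log_zero,
        EReal.bot_add] at ht
      exact EReal.coe_ne_bot _ (le_bot_iff.1 ht)
    rw [logVol, ENNReal.log_ofReal_of_pos hpos] at ht
    have ht' : Real.log (X₀ * X₀ᵀ).det ≤ Real.log (Y t * (Y t)ᵀ).det + η := by exact_mod_cast ht
    have := Real.exp_le_exp.2 ht'
    rwa [Real.exp_add, Real.exp_log hX₀, Real.exp_log hpos] at this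
  have hlim : Tendsto (fun η : ℝ => (Y₀ * Y₀ᵀ).det * Real.exp η) (𝓝[>] 0)
      (𝓝 ((Y₀ * Y₀ᵀ).det * Real.exp 0)) :=
    ((continuous_const.mul Real.continuous_exp).tendsto 0).mono_left nhdsWithin_le_nhds
  rw [Real.exp_zero, mul_one] at hlim
  exact ge_of_tendsto hlim (eventually_mem_nhdsWithin.mono fun η hη => hkey η hη)

/-- The rank of a product is at most that of each factor, so both have rank `K`; and `Y Yᵀ` has the
rank of `Y` and is positive semidefinite. -/
theorem isUnit_of_rank_mul {C : Matrix (Fin K) (Fin K) ℝ} {Y : Matrix (Fin K) (Fin N) ℝ}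
    (h : (C * Y).rank = K) : IsUnit C.det ∧ 0 < (Y * Yᵀ).det := by
  have unit_of_rank : ∀ D : Matrix (Fin K) (Fin K) ℝ, K ≤ D.rank → IsUnit D.det := by
    intro D hD
    rw [← Matrix.isUnit_iff_isUnit_det, ← Matrix.linearIndependent_cols_iff_isUnit,
      linearIndependent_iff_card_eq_finrank_span]
    change _ = Module.finrank ℝ _
    rw [← Matrix.rank_eq_finrank_span_cols]
    exact le_antisymm (by simpa using hD) (D.rank_le_card_width)
  refine ⟨unit_of_rank C (h.ge.trans (Matrix.rank_mul_le_left C Y)), ?_⟩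
  have hY : IsUnit (Y * Yᵀ).det := unit_of_rank _ (by
    rw [Matrix.rank_self_mul_transpose]
    exact h.ge.trans (Matrix.rank_mul_le_right C Y))
  have hpsd : (Y * Yᵀ).PosSemidef := by
    simpa [Matrix.conjTranspose_eq_transpose_of_trivial]
      using Matrix.posSemidef_self_mul_conjTranspose Y
  exact lt_of_le_of_ne hpsd.det_nonneg hY.ne_zero.symm

theorem tendsto_bilin {l : Filter ℕ} {Y : ℕ → Matrix (Fin K) (Fin N) ℝ}
    {Y₀ : Matrix (Fin K) (Fin N) ℝ} {B : ℕ → Matrix (Fin K) (Fin K) ℝ}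
    {B₀ : Matrix (Fin K) (Fin K) ℝ} (hY : Tendsto Y l (𝓝 Y₀)) (hB : Tendsto B l (𝓝 B₀))
    (i j : Fin N) :
    Tendsto (fun t => ((Y t)ᵀ * B t * Y t) i j) l (𝓝 ((Y₀ᵀ * B₀ * Y₀) i j)) := by
  have hc : Continuous fun Z : Matrix (Fin K) (Fin N) ℝ × Matrix (Fin K) (Fin K) ℝ =>
      (Z.1ᵀ * Z.2 * Z.1) i j := Continuous.matrix_elem (by fun_prop) i j
  have hp := hY.prodMk_nhds hB
  have h := (hc.tendsto (Y₀, B₀)).comp hp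
  simpa only [Function.comp_def] using h

/-- Every cluster point of a maximum-volume solution is a relabelling of the truth. -/
theorem IsMaxVolumeSolution.exists_perm_of_mapClusterPt [NeZero N] (hF : ∀ t, f₀ ∈ F t)
    (hM : Tendsto M atTop atTop)
    (hS : ∀ a, Tendsto (fun m => freq S m a) atTop (𝓝 ((annotationLaw fun i j =>
      sim (confuse A hA (f₀ (x i))) (confuse A hA (f₀ (x j)))).real {a})))
    (hS0 : ∀ m, (annotationLaw fun i j =>
      sim (confuse A hA (f₀ (x i))) (confuse A hA (f₀ (x j)))).real {S m} ≠ 0)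
    (hSSC : SSC (membership f₀ x)) (hrank : (Aᵀ * A * membership f₀ x).rank = K)
    {f : ℕ → X → Simplex K} {B : ℕ → Matrix (Fin K) (Fin K) ℝ}
    (hf : IsMaxVolumeSolution F M x S f B) {Mstar : Matrix (Fin K) (Fin N) ℝ}
    (hstar : MapClusterPt Mstar atTop (fun t => membership (f t) x)) :
    ∃ π : Equiv.Perm (Fin K), π.permMatrix ℝ * Mstar = membership f₀ x := by
  obtain ⟨hC, hX⟩ := isUnit_of_rank_mul hrank
  -- An ultrafilter takes the place of a subsequence: along it the matrices `B t` converge too, by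
  -- compactness of the box.
  obtain ⟨U, hU, hUlim⟩ := mapClusterPt_iff_ultrafilter.1 hstar
  obtain ⟨Bstar, -, hBstar⟩ := (isCompact_box K).ultrafilter_le_nhds
    (U.map B) (by
      rw [le_principal_iff]
      change B ⁻¹' box K ∈ (U : Filter ℕ)
      exact Filter.univ_mem' fun t => (hf.1.1 t).2)
  have hBlim : Tendsto B (U : Filter ℕ) (𝓝 Bstar) := hBstar
  have hentry : ∀ k n, Tendsto (fun t => membership (f t) x k n) (U : Filter ℕ)
      (𝓝 (Mstar k n)) := fun k n =>
    ((continuous_id.matrix_elem k n).tendsto Mstar).comp hUlim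
  refine exists_perm_of_factorization (B := Bstar) hSSC hC hX ?_ (fun n => ?_) (fun n => ?_)
    (fun k n => ?_) ?_
  -- The constant sequence at the truth is a limit minimizer, so a maximum-volume solution must have
  -- at least its volume in the limit.
  · exact det_le_of_logVol_le hUlim hX fun η hη =>
      (hf.2 _ _ (isLimitMinimizer_truth hF hM hS hS0) η hη).filter_mono hU
  · exact (f₀ (x n)).2.2
  · refine tendsto_nhds_unique (tendsto_finsetSum _ fun k _ => hentry k n) ?_
    exact tendsto_const_nhds.congr fun t => ((f t (x n)).2.2).symm
  · exact ge_of_tendsto' (hentry k n) fun t => (f t (x n)).2.1 k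
  · ext i j
    have h1 := tendsto_bilin hUlim hBlim i j
    simp only [membership_bilin] at h1
    have h2 := (IsLimitMinimizer.tendsto_pred hF hM hS hS0 hf.1 (i, j, true)).mono_left hU
    simp only [pred, labelProb, if_true] at h2
    rw [membership_bilin]
    exact tendsto_nhds_unique h1 h2

/-- Maximum-volume solutions converge to the truth after relabelling. -/
theorem exists_perm_tendsto {Y : ℕ → X → Simplex K} {X₀ : Matrix (Fin K) (Fin N) ℝ}
    (h : ∀ Mstar, MapClusterPt Mstar atTop (fun t => membership (Y t) x) →
      ∃ π : Equiv.Perm (Fin K), π.permMatrix ℝ * Mstar = X₀) :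
    ∃ π : ℕ → Equiv.Perm (Fin K),
      Tendsto (fun t => (π t).permMatrix ℝ * membership (Y t) x) atTop (𝓝 X₀) := by
  let d : Matrix (Fin K) (Fin N) ℝ → ℝ := fun Z => ∑ k, ∑ n, |Z k n - X₀ k n|
  have hd : Continuous d := by fun_prop
  -- The relabelling nearest to `X₀` is chosen for each `t`. Along any ultrafilter some fixed
  -- relabelling has distance tending to zero, and the nearest one does at least as well.
  have hmin : ∀ t, ∃ π : Equiv.Perm (Fin K), ∀ π' : Equiv.Perm (Fin K),
      d (π.permMatrix ℝ * membership (Y t) x) ≤ d (π'.permMatrix ℝ * membership (Y t) x) :=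
    fun t => Finite.exists_min fun π : Equiv.Perm (Fin K) =>
      d (π.permMatrix ℝ * membership (Y t) x)
  choose π hπ using hmin
  refine ⟨π, ?_⟩
  have hd0 : Tendsto (fun t => d ((π t).permMatrix ℝ * membership (Y t) x)) atTop (𝓝 0) := by
    rw [tendsto_iff_ultrafilter]
    intro U hU
    have hcpt : IsCompact (Set.Icc (fun _ _ => (0 : ℝ)) (fun _ _ => (1 : ℝ)) :
        Set (Fin K → Fin N → ℝ)) := isCompact_Icc
    obtain ⟨Z, -, hZ⟩ := hcpt.ultrafilter_le_nhds
      (U.map fun t => (membership (Y t) x : Fin K → Fin N → ℝ)) (by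
        rw [le_principal_iff]
        change (fun t => (membership (Y t) x : Fin K → Fin N → ℝ)) ⁻¹' _ ∈ (U : Filter ℕ)
        refine Filter.univ_mem' fun t => ?_
        refine ⟨fun k n => (Y t (x n)).2.1 k, fun k n => ?_⟩
        change (Y t (x n)) k ≤ 1
        rw [← (Y t (x n)).2.2]
        exact Finset.single_le_sum (f := fun k => (Y t (x n)) k)
          (fun k _ => (Y t (x n)).2.1 k) (Finset.mem_univ k))
    obtain ⟨Z, rfl⟩ : ∃ Z' : Matrix (Fin K) (Fin N) ℝ, Z' = Z := ⟨Z, rfl⟩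
    have hZ' : Tendsto (fun t => membership (Y t) x) (U : Filter ℕ) (𝓝 Z) := hZ
    obtain ⟨σ, hσ⟩ := h Z (mapClusterPt_iff_ultrafilter.2 ⟨U, hU, hZ'⟩)
    have hlim : Tendsto (fun t => d (σ.permMatrix ℝ * membership (Y t) x)) (U : Filter ℕ)
        (𝓝 (d (σ.permMatrix ℝ * Z))) := by
      have hc : Continuous fun Z : Matrix (Fin K) (Fin N) ℝ => d (σ.permMatrix ℝ * Z) := by
        fun_prop
      exact (hc.tendsto Z).comp hZ'
    have hz : d (σ.permMatrix ℝ * Z) = 0 := by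
      rw [hσ]; simp [d]
    rw [hz] at hlim
    exact tendsto_of_tendsto_of_tendsto_of_le_of_le tendsto_const_nhds hlim
      (fun t => Finset.sum_nonneg fun k _ => Finset.sum_nonneg fun n _ => abs_nonneg _)
      (fun t => hπ t σ)
  refine tendsto_pi_nhds.2 fun k => tendsto_pi_nhds.2 fun n => ?_
  rw [tendsto_iff_dist_tendsto_zero]
  refine squeeze_zero (fun _ => dist_nonneg) (fun t => ?_) hd0
  rw [Real.dist_eq]
  refine le_trans ?_ (Finset.single_le_sum (f := fun k => ∑ n,
    |((π t).permMatrix ℝ * membership (Y t) x) k n - X₀ k n|)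
    (fun k _ => Finset.sum_nonneg fun n _ => abs_nonneg _) (Finset.mem_univ k))
  exact Finset.single_le_sum (f := fun n =>
    |((π t).permMatrix ℝ * membership (Y t) x) k n - X₀ k n|)
    (fun n _ => abs_nonneg _) (Finset.mem_univ n)

end limits

/-! ### Covering numbers by the empirical method -/

section Maurey

variable {E : Type*} [NormedAddCommGroup E] [InnerProductSpace ℝ E]

/-- The nearest point of a ball, in the form needed for replacing centers. -/
theorem exists_mem_ball_forall_norm_sub_le (p c : E) {R : ℝ} (hR : 0 ≤ R) :
    ∃ c', ‖c' - p‖ ≤ R ∧ ∀ a, ‖a - p‖ ≤ R → ‖a - c'‖ ≤ ‖a - c‖ := by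
  by_cases hc : ‖c - p‖ ≤ R
  · exact ⟨c, hc, fun a _ => le_rfl⟩
  push Not at hc
  set q := c - p with hq
  have hq0 : 0 < ‖q‖ := hR.trans_lt hc
  set t := R / ‖q‖ with ht
  have htq : t * ‖q‖ = R := div_mul_cancel₀ _ hq0.ne'
  have ht0 : 0 ≤ t := div_nonneg hR hq0.le
  have ht1 : t ≤ 1 := (div_le_one hq0).2 hc.le
  refine ⟨p + t • q, ?_, fun a ha => ?_⟩
  · rw [add_sub_cancel_left, norm_smul, Real.norm_of_nonneg ht0, htq]
  · rw [show a - (p + t • q) = (a - p) - t • q by abel, show a - c = (a - p) - q by rw [hq]; abel]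
    set b := a - p
    have hin : inner ℝ b q ≤ R * ‖q‖ := (real_inner_le_norm b q).trans (by gcongr)
    refine (sq_le_sq₀ (norm_nonneg _) (norm_nonneg _)).1 ?_
    rw [norm_sub_sq_real b (t • q), norm_sub_sq_real b q, inner_smul_right, norm_smul,
      Real.norm_of_nonneg ht0]
    -- For the radial projection `t • q`, the difference of the two squared distances is twice this
    -- quantity plus the next one.
    have h1 : 0 ≤ (1 - t) * (R * ‖q‖ - inner ℝ b q) :=
      mul_nonneg (by linarith) (by linarith)
    have h2 : 0 ≤ (1 - t) * (‖q‖ * (‖q‖ - R)) :=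
      mul_nonneg (by linarith) (mul_nonneg hq0.le (by linarith))
    rw [← htq] at h1 h2
    rw [← htq] at hc
    nlinarith

theorem exists_le_of_weighted_sum {ι : Type*} [Fintype ι] {w f : ι → ℝ} {B : ℝ}
    (hw : ∀ i, 0 ≤ w i) (hw1 : ∑ i, w i = 1) (h : ∑ i, w i * f i ≤ B) : ∃ i, f i ≤ B := by
  by_contra hcon
  push Not at hcon
  have h1 : ∑ i, w i * B < ∑ i, w i * f i := by
    obtain ⟨i, hi⟩ : ∃ i, 0 < w i := by
      by_contra hz
      push Not at hz
      have : ∑ i, w i ≤ 0 := Finset.sum_nonpos fun i _ => hz i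
      linarith
    exact Finset.sum_lt_sum (fun i _ => mul_le_mul_of_nonneg_left (hcon i).le (hw i))
      ⟨i, Finset.mem_univ i, mul_lt_mul_of_pos_left (hcon i) hi⟩
  rw [← Finset.sum_mul, hw1, one_mul] at h1
  linarith

/-- Greedy form of the empirical method: a point of a convex hull is approximated by short sums. -/
theorem exists_sum_near {ι : Type*} [Fintype ι] {v : ι → E} {r : ℝ} (hv : ∀ i, ‖v i‖ ≤ r)
    {w : ι → ℝ} (hw : ∀ i, 0 ≤ w i) (hw1 : ∑ i, w i = 1) {U : E} (hU : U = ∑ i, w i • v i)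
    (c : ℝ) (k : ℕ) (z : E) :
    ∃ s : Fin k → ι, ‖z - c • ∑ j, v (s j)‖ ^ 2
      ≤ ‖z - (c * k) • U‖ ^ 2 + c ^ 2 * k * (r ^ 2 - ‖U‖ ^ 2) := by
  induction k generalizing z with
  | zero => exact ⟨Fin.elim0, by simp⟩
  | succ k ih =>
    -- Some atom does no worse than the `w`-average. In that average the cross terms with `y`
    -- cancel, leaving the variance `∑ w ‖v‖² - ‖U‖² ≤ r² - ‖U‖²`.
    obtain ⟨i, hi⟩ : ∃ i, ‖(z - c • v i) - (c * k) • U‖ ^ 2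
        ≤ ‖z - (c * (k + 1)) • U‖ ^ 2 + c ^ 2 * (r ^ 2 - ‖U‖ ^ 2) := by
      refine exists_le_of_weighted_sum hw hw1 ?_
      set y := z - (c * (k + 1)) • U with hy
      have e1 : ∀ i, ‖(z - c • v i) - (c * k) • U‖ ^ 2
          = ‖y‖ ^ 2 + 2 * c * (inner ℝ y U - inner ℝ y (v i))
            + c ^ 2 * (‖U‖ ^ 2 - 2 * inner ℝ U (v i) + ‖v i‖ ^ 2) := by
        intro i
        have : (z - c • v i) - (c * k) • U = y + c • (U - v i) := by
          rw [hy]; module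
        rw [this, norm_add_sq_real, inner_smul_right, norm_smul, mul_pow, Real.norm_eq_abs,
          sq_abs, norm_sub_sq_real U (v i), inner_sub_right]
        ring
      have hyU : ∑ i, w i * inner ℝ y (v i) = inner ℝ y U := by
        rw [hU, inner_sum]; simp [inner_smul_right]
      have hUU : ∑ i, w i * inner ℝ U (v i) = ‖U‖ ^ 2 := by
        rw [← real_inner_self_eq_norm_sq]; nth_rw 3 [hU]; rw [inner_sum]; simp [inner_smul_right]
      have hvv : ∑ i, w i * ‖v i‖ ^ 2 ≤ r ^ 2 := by
        calc ∑ i, w i * ‖v i‖ ^ 2 ≤ ∑ i, w i * r ^ 2 :=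
              Finset.sum_le_sum fun i _ => mul_le_mul_of_nonneg_left
                (pow_le_pow_left₀ (norm_nonneg _) (hv i) 2) (hw i)
          _ = r ^ 2 := by rw [← Finset.sum_mul, hw1, one_mul]
      have e2 : ∑ i, w i * ‖(z - c • v i) - (c * k) • U‖ ^ 2
          = (∑ i, w i) * (‖y‖ ^ 2 + 2 * c * inner ℝ y U + c ^ 2 * ‖U‖ ^ 2)
            - 2 * c * ∑ i, w i * inner ℝ y (v i) - 2 * c ^ 2 * ∑ i, w i * inner ℝ U (v i)
            + c ^ 2 * ∑ i, w i * ‖v i‖ ^ 2 := by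
        simp only [e1, Finset.sum_mul, Finset.mul_sum, ← Finset.sum_sub_distrib,
          ← Finset.sum_add_distrib]
        exact Finset.sum_congr rfl fun i _ => by ring
      rw [e2, hw1, hyU, hUU]
      nlinarith [mul_le_mul_of_nonneg_left hvv (sq_nonneg c)]
    obtain ⟨s, hs⟩ := ih (z - c • v i)
    refine ⟨Fin.cons i s, ?_⟩
    rw [Fin.sum_univ_succ]
    simp only [Fin.cons_zero, Fin.cons_succ, smul_add, ← sub_sub]
    push_cast
    linarith

/-- Shrinking the average by the factor `√k / (1 + √k)` improves the approximation radius. -/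
theorem exists_shrunk_average_near {ι : Type*} [Fintype ι] {v : ι → E} {r : ℝ}
    (hv : ∀ i, ‖v i‖ ≤ r) {w : ι → ℝ} (hw : ∀ i, 0 ≤ w i) (hw1 : ∑ i, w i = 1) (k : ℕ) :
    ∃ s : Fin k → ι, ‖∑ i, w i • v i - (√k / (1 + √k) / k) • ∑ j, v (s j)‖ ≤ r / (1 + √k) := by
  set U := ∑ i, w i • v i with hU
  have hr : 0 ≤ r := by
    obtain ⟨i, -⟩ := exists_le_of_weighted_sum (f := fun _ => (0 : ℝ)) hw hw1 le_rfl
    exact (norm_nonneg _).trans (hv i)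
  have hUr : ‖U‖ ≤ r := by
    calc ‖U‖ ≤ ∑ i, ‖w i • v i‖ := norm_sum_le _ _
      _ ≤ ∑ i, w i * r := Finset.sum_le_sum fun i _ => by
          rw [norm_smul, Real.norm_of_nonneg (hw i)]
          exact mul_le_mul_of_nonneg_left (hv i) (hw i)
      _ = r := by rw [← Finset.sum_mul, hw1, one_mul]
  obtain ⟨s, hs⟩ := exists_sum_near hv hw hw1 hU (√k / (1 + √k) / k) k U
  refine ⟨s, ?_⟩
  rcases Nat.eq_zero_or_pos k with rfl | hk
  · simpa using hUr
  have hk0 : (0 : ℝ) < k := by exact_mod_cast hk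
  set q := √(k : ℝ) with hq
  have hq0 : 0 < q := Real.sqrt_pos.2 hk0
  have hq2 : (k : ℝ) = q ^ 2 := (Real.sq_sqrt hk0.le).symm
  refine (sq_le_sq₀ (norm_nonneg _) (by positivity)).1 (hs.trans (le_of_eq ?_))
  -- The squared bias is `‖U‖² / (1 + q)²` and the variance bound is `(r² - ‖U‖²) / (1 + q)²`; this
  -- shrinkage factor makes `‖U‖` cancel.
  have e1 : U - (q / (1 + q) / k * k) • U = (1 / (1 + q)) • U := by
    rw [div_mul_cancel₀ _ hk0.ne']
    have : 1 / (1 + q) = 1 - q / (1 + q) := by field_simp; ring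
    rw [this]; module
  rw [e1, norm_smul, Real.norm_of_nonneg (by positivity), hq2]
  field_simp
  ring

/-- A cover of the absolutely convex hull of finitely many points. -/
theorem exists_cover_absConvex {ι : Type*} [Fintype ι] {v : ι → E} (hv : ∀ i, ‖v i‖ ≤ 1)
    {r : ℝ} (hr : 0 ≤ r) {n : ℕ} (hn : 1 ≤ n) (hι : 2 * Fintype.card ι ≤ n) (k : ℕ) :
    ∃ C : Finset E, C.card ≤ n ^ k ∧ ∀ w : ι → ℝ, ∑ i, |w i| ≤ r →
      ∃ c ∈ C, ‖∑ i, w i • v i - c‖ ≤ r / (1 + √k) := by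
  classical
  rcases isEmpty_or_nonempty ι with hemp | hne
  · exact ⟨{0}, by simpa using Nat.one_le_pow _ _ hn, fun w _ => ⟨0, by simp, by
      simp; positivity⟩⟩
  rcases hr.eq_or_lt with hr0 | hr0
  · refine ⟨{0}, by simpa using Nat.one_le_pow _ _ hn, fun w hw => ⟨0, by simp, ?_⟩⟩
    rw [← hr0] at hw
    have h0 := (Finset.sum_eq_zero_iff_of_nonneg fun i _ => abs_nonneg (w i)).1
      (le_antisymm hw (Finset.sum_nonneg fun i _ => abs_nonneg _))
    have : ∀ i, w i = 0 := fun i => abs_eq_zero.1 (h0 i (Finset.mem_univ i))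
    simp [this, ← hr0]
  -- Signed atoms `± r v` turn the absolutely convex hull into a convex hull of at most `n` points.
  set a : ι × Bool → E := fun p => (if p.2 then r else -r) • v p.1 with ha
  have har : ∀ p, ‖a p‖ ≤ r := by
    rintro ⟨i, b⟩
    rw [ha]
    simp only [norm_smul]
    have : ‖(if b = true then r else -r : ℝ)‖ = r := by
      split_ifs <;> simp [abs_of_pos hr0]
    rw [this]
    nlinarith [hv i]
  refine ⟨Finset.univ.image fun s : Fin k → ι × Bool => (√k / (1 + √k) / k) • ∑ j, a (s j),
    ?_, fun w hw => ?_⟩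
  · refine Finset.card_image_le.trans ?_
    rw [Finset.card_univ, Fintype.card_fun, Fintype.card_prod, Fintype.card_bool, Fintype.card_fin,
      mul_comm]
    exact Nat.pow_le_pow_left hι k
  · have hc : (0 : ℝ) < Fintype.card ι := by exact_mod_cast Fintype.card_pos
    -- The missing mass is spread evenly over the pairs of opposite atoms, where it contributes
    -- nothing to the sum.
    set slack := (1 - ∑ i, |w i| / r) / Fintype.card ι with hsl
    have hsl0 : 0 ≤ slack := by
      refine div_nonneg ?_ hc.le
      rw [← Finset.sum_div, sub_nonneg, div_le_one hr0]; exact hw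
    set u : ι × Bool → ℝ := fun p =>
      (|w p.1| / r + (if p.2 then w p.1 / r else -(w p.1 / r)) + slack) / 2 with hu
    have hu0 : ∀ p, 0 ≤ u p := by
      rintro ⟨i, b⟩
      have h1 : w i / r ≤ |w i| / r := by gcongr; exact le_abs_self _
      have h2 : -(w i / r) ≤ |w i| / r := by
        rw [← neg_div]; gcongr; exact neg_le_abs _
      rw [hu]
      simp only
      split_ifs <;> apply div_nonneg _ zero_le_two <;> linarith
    have hu1 : ∑ p, u p = 1 := by
      rw [Fintype.sum_prod_type]
      have : ∀ i, ∑ b, u (i, b) = |w i| / r + slack := by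
        intro i; simp [hu]; ring
      simp only [this, Finset.sum_add_distrib, Finset.sum_const, Finset.card_univ, nsmul_eq_mul]
      rw [hsl]; field_simp; ring
    have hsum : ∑ p, u p • a p = ∑ i, w i • v i := by
      rw [Fintype.sum_prod_type]
      refine Finset.sum_congr rfl fun i _ => ?_
      simp only [hu, ha, Fintype.sum_bool, smul_smul, if_true, Bool.false_eq_true, if_false,
        ← add_smul]
      congr 1
      field_simp
      ring
    obtain ⟨s, hs⟩ := exists_shrunk_average_near har hu0 hu1 k
    rw [hsum] at hs
    exact ⟨_, Finset.mem_image_of_mem _ (Finset.mem_univ s), hs⟩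

/-- Covering number of the absolutely convex hull, at an arbitrary scale. -/
theorem exists_cover_absConvex_exp {ι : Type*} [Fintype ι] {v : ι → E} (hv : ∀ i, ‖v i‖ ≤ 1)
    {r : ℝ} (hr : 0 ≤ r) {n : ℕ} (hn : 1 ≤ n) (hι : 2 * Fintype.card ι ≤ n) {η T : ℝ}
    (hη : 0 ≤ η) (hT : 0 ≤ T) (h : r ^ 2 ≤ T * η ^ 2) :
    ∃ C : Finset E, (C.card : ℝ) ≤ Real.exp (T * Real.log n) ∧ ∀ w : ι → ℝ, ∑ i, |w i| ≤ r →
      ∃ c ∈ C, ‖∑ i, w i • v i - c‖ ≤ η := by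
  obtain ⟨C, hC, hcov⟩ := exists_cover_absConvex hv hr hn hι ⌊T⌋₊
  have hn0 : (0 : ℝ) < n := by exact_mod_cast hn
  refine ⟨C, ?_, fun w hw => ?_⟩
  · calc (C.card : ℝ) ≤ (n : ℝ) ^ ⌊T⌋₊ := by exact_mod_cast hC
      _ = Real.exp (⌊T⌋₊ * Real.log n) := by
          rw [Real.exp_nat_mul, Real.exp_log hn0]
      _ ≤ _ := by
          apply Real.exp_le_exp.2
          exact mul_le_mul_of_nonneg_right (Nat.floor_le hT)
            (Real.log_nonneg (by exact_mod_cast hn))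
  · obtain ⟨c, hc, hwc⟩ := hcov w hw
    refine ⟨c, hc, hwc.trans ?_⟩
    set k : ℝ := (⌊T⌋₊ : ℝ) with hk
    have hk0 : 0 ≤ k := Nat.cast_nonneg _
    -- The gain from `√k` to `1 + √k` absorbs the rounding: `T < k + 1 ≤ (1 + √k)²`. Hence the
    -- entropy is at most `T log n`, with no extra term.
    have hTk : T ≤ (1 + √k) ^ 2 := by
      have h1 := Real.sq_sqrt hk0
      nlinarith [Nat.lt_floor_add_one T, Real.sqrt_nonneg k]
    rw [div_le_iff₀ (by positivity)]
    refine (sq_le_sq₀ hr (by positivity)).1 ?_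
    nlinarith [sq_nonneg η]

end Maurey

/-! ### Covering numbers of network classes -/

/-- `N` column vectors of dimension `m`, with the Frobenius norm. -/
abbrev Cols (N m : ℕ) : Type := PiLp 2 fun _ : Fin N => EuclideanSpace ℝ (Fin m)

/-- Apply a map to all columns. -/
noncomputable def mapCols {N m n : ℕ} (g : EuclideanSpace ℝ (Fin m) → EuclideanSpace ℝ (Fin n))
    (Y : Cols N m) : Cols N n := WithLp.toLp 2 fun c => g (Y c)

theorem norm_cols_le {N m n : ℕ} {Y : Cols N m} {Z : Cols N n} {ρ : ℝ} (hρ : 0 ≤ ρ)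
    (h : ∀ c, ‖Z c‖ ≤ ρ * ‖Y c‖) : ‖Z‖ ≤ ρ * ‖Y‖ := by
  refine (sq_le_sq₀ (norm_nonneg _) (by positivity)).1 ?_
  rw [mul_pow, PiLp.norm_sq_eq_of_L2, PiLp.norm_sq_eq_of_L2, Finset.mul_sum]
  refine Finset.sum_le_sum fun c _ => ?_
  rw [← mul_pow]
  exact pow_le_pow_left₀ (norm_nonneg _) (h c) 2

theorem norm_mapCols_sub_le {N m n : ℕ} {g : EuclideanSpace ℝ (Fin m) → EuclideanSpace ℝ (Fin n)}
    {ρ : ℝ≥0} (hg : LipschitzWith ρ g) (Y Z : Cols N m) :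
    ‖mapCols g Y - mapCols g Z‖ ≤ ρ * ‖Y - Z‖ :=
  norm_cols_le ρ.2 fun c => by simpa [mapCols] using hg.norm_sub_le (Y c) (Z c)

open scoped Matrix.Norms.L2Operator in
theorem LayerSpec.lipschitz_toEuclideanLin {m n : ℕ} {ℓ : LayerSpec m n}
    {W : Matrix (Fin n) (Fin m) ℝ} (hW : W ∈ ℓ.weights) :
    LipschitzWith ⟨ℓ.s, ℓ.s_pos.le⟩ (Matrix.toEuclideanLin W) := by
  refine LipschitzWith.of_dist_le_mul fun y z => ?_
  rw [dist_eq_norm, dist_eq_norm, ← map_sub]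
  have h := Matrix.l2_opNorm_mulVec W (y - z)
  exact h.trans (mul_le_mul_of_nonneg_right hW.1 (norm_nonneg _))

/-- The row norms of a data matrix. -/
noncomputable def rowNorm {N m : ℕ} (Y : Cols N m) (i : Fin m) : ℝ := √(∑ c, (Y c i) ^ 2)

theorem sum_rowNorm_sq {N m : ℕ} (Y : Cols N m) : ∑ i, rowNorm Y i ^ 2 = ‖Y‖ ^ 2 := by
  rw [PiLp.norm_sq_eq_of_L2]
  simp only [EuclideanSpace.norm_sq_eq, Real.norm_eq_abs, sq_abs]
  rw [Finset.sum_comm]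
  exact Finset.sum_congr rfl fun i _ => Real.sq_sqrt (Finset.sum_nonneg fun _ _ => sq_nonneg _)

/-- The normalized rank-one atoms `e_j Y_i / ‖Y_i‖`. -/
noncomputable def rowAtom {N m n : ℕ} (Y : Cols N m) (p : Fin n × Fin m) : Cols N n :=
  WithLp.toLp 2 fun c => EuclideanSpace.single p.1 ((rowNorm Y p.2)⁻¹ * Y c p.2)

theorem norm_rowAtom_le {N m n : ℕ} (Y : Cols N m) (p : Fin n × Fin m) : ‖rowAtom Y p‖ ≤ 1 := by
  have h : ‖rowAtom Y p‖ ^ 2 = ((rowNorm Y p.2)⁻¹) ^ 2 * rowNorm Y p.2 ^ 2 := by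
    have hr : rowNorm Y p.2 ^ 2 = ∑ c, (Y c p.2) ^ 2 :=
      Real.sq_sqrt (Finset.sum_nonneg fun _ _ => sq_nonneg _)
    rw [PiLp.norm_sq_eq_of_L2, hr, Finset.mul_sum]
    refine Finset.sum_congr rfl fun c _ => ?_
    simp [rowAtom, mul_pow]
  refine (sq_le_sq₀ (norm_nonneg _) zero_le_one).1 ?_
  rw [h, ← mul_pow]
  by_cases h0 : rowNorm Y p.2 = 0
  · simp [h0]
  · simp [inv_mul_cancel₀ h0]

/-- Expansion of `V Y` into products of an entry of `V` with a row of `Y`. A zero row is harmless,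
since its coefficient vanishes. -/
theorem mapCols_toEuclideanLin_eq {N m n : ℕ} (V : Matrix (Fin n) (Fin m) ℝ) (Y : Cols N m) :
    mapCols (Matrix.toEuclideanLin V) Y
      = ∑ p : Fin n × Fin m, (V p.1 p.2 * rowNorm Y p.2) • rowAtom Y p := by
  ext c j
  have h0 : ∀ i, rowNorm Y i * ((rowNorm Y i)⁻¹ * Y c i) = Y c i := by
    intro i
    by_cases h : rowNorm Y i = 0
    · have h1 : ∑ c, (Y c i) ^ 2 = 0 := by
        refine (Real.sqrt_eq_zero (Finset.sum_nonneg fun _ _ => sq_nonneg _)).1 h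
      have h2 := (Finset.sum_eq_zero_iff_of_nonneg fun c _ => sq_nonneg (Y c i)).1 h1 c
        (Finset.mem_univ c)
      rw [pow_eq_zero_iff two_ne_zero] at h2
      simp [h2]
    · rw [mul_inv_cancel_left₀ h]
  have hl : (mapCols (Matrix.toEuclideanLin V) Y) c j = ∑ i, V j i * Y c i := by
    simp [mapCols, Matrix.mulVec, dotProduct]
  rw [hl]
  simp only [WithLp.ofLp_sum, Finset.sum_apply, Fintype.sum_prod_type]
  rw [Finset.sum_eq_single j]
  · refine Finset.sum_congr rfl fun i _ => ?_
    simp [rowAtom]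
    rw [mul_assoc, h0]
  · intro j' _ hj
    refine Finset.sum_eq_zero fun i _ => ?_
    simp [rowAtom, hj.symm]
  · simp

/-- Cauchy-Schwarz within each row of `V`. This is how the `(2,1)`-norm enters: it is the radius of
the absolutely convex hull to be covered. -/
theorem sum_abs_mul_rowNorm_le {N m n : ℕ} (V : Matrix (Fin n) (Fin m) ℝ) (Y : Cols N m) :
    ∑ p : Fin n × Fin m, |V p.1 p.2 * rowNorm Y p.2| ≤ norm21 Vᵀ * ‖Y‖ := by
  rw [Fintype.sum_prod_type, norm21, Finset.sum_mul]
  refine Finset.sum_le_sum fun j _ => ?_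
  have h := Real.sum_mul_le_sqrt_mul_sqrt Finset.univ (fun i => |V j i|) (fun i => rowNorm Y i)
  rw [sum_rowNorm_sq, Real.sqrt_sq (norm_nonneg _)] at h
  simpa [abs_mul, abs_of_nonneg, rowNorm, Real.sqrt_nonneg] using h

/-- A cover of the images of one data matrix under all weights of a layer. -/
theorem LayerSpec.exists_cover {N m n D : ℕ} (ℓ : LayerSpec m n) (Y : Cols N m) (hm : m ≤ D)
    (hn : n ≤ D) (hD : 1 ≤ D) {η T : ℝ} (hη : 0 ≤ η) (hT : 0 ≤ T)
    (h : ℓ.b ^ 2 * ‖Y‖ ^ 2 ≤ T * η ^ 2) :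
    ∃ C : Finset (Cols N n), (C.card : ℝ) ≤ Real.exp (T * Real.log (2 * (D : ℝ) ^ 2)) ∧
      (∀ z ∈ C, ‖z‖ ≤ ℓ.s * ‖Y‖) ∧
      ∀ W ∈ ℓ.weights, ∃ z ∈ C, ‖mapCols (Matrix.toEuclideanLin W) Y - z‖ ≤ η := by
  classical
  obtain ⟨C, hC, hcov⟩ := exists_cover_absConvex_exp (norm_rowAtom_le (n := n) Y)
    (mul_nonneg ℓ.b_nonneg (norm_nonneg Y)) (n := 2 * D ^ 2)
    (by have := Nat.one_le_pow 2 D hD; omega)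
    (by
      simp only [Fintype.card_prod, Fintype.card_fin]
      have : n * m ≤ D ^ 2 := by rw [sq]; exact Nat.mul_le_mul hn hm
      omega) hη hT (by rw [mul_pow]; exact h)
  have hR : 0 ≤ ℓ.s * ‖Y‖ := mul_nonneg ℓ.s_pos.le (norm_nonneg _)
  -- Every `W Y` lies in the ball of radius `s ‖Y‖`. Projecting the centres onto it costs no
  -- accuracy and keeps their norms under control for the next layer.
  choose P hP1 hP2 using fun c : Cols N n =>
    exists_mem_ball_forall_norm_sub_le (0 : Cols N n) c hR
  simp only [sub_zero] at hP1 hP2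
  refine ⟨C.image fun c => P (mapCols (Matrix.toEuclideanLin ℓ.ref) Y + c), ?_, ?_, ?_⟩
  · refine le_trans (by exact_mod_cast Finset.card_image_le) (hC.trans (le_of_eq ?_))
    push_cast
    rfl
  · intro z hz
    obtain ⟨c, -, rfl⟩ := Finset.mem_image.1 hz
    exact hP1 _
  · intro W hW
    obtain ⟨c, hc, hWc⟩ := hcov (fun p => (W - ℓ.ref) p.1 p.2 * rowNorm Y p.2)
      ((sum_abs_mul_rowNorm_le (W - ℓ.ref) Y).trans
        (mul_le_mul_of_nonneg_right (by rw [Matrix.transpose_sub]; exact hW.2) (norm_nonneg _)))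
    rw [← mapCols_toEuclideanLin_eq] at hWc
    refine ⟨_, Finset.mem_image_of_mem _ hc, (hP2 _ _ ?_).trans (le_trans (le_of_eq ?_) hWc)⟩
    · refine norm_cols_le ℓ.s_pos.le fun c => ?_
      have := (LayerSpec.lipschitz_toEuclideanLin hW).norm_sub_le (Y c) 0
      rw [map_zero, sub_zero, sub_zero] at this
      exact this
    · congr 1
      ext c j
      simp [mapCols]
      ring

theorem Arch.lipProd_nonneg {d : ℕ} : ∀ {n : ℕ} (a : Arch d n), 0 ≤ a.lipProd
  | _, .input => zero_le_one
  | _, .snoc a ℓ => mul_nonneg a.lipProd_nonneg (by positivity)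

theorem Arch.ratioSum_nonneg {d : ℕ} : ∀ {n : ℕ} (a : Arch d n), 0 ≤ a.ratioSum
  | _, .input => le_rfl
  | _, .snoc a ℓ => add_nonneg a.ratioSum_nonneg
      (Real.rpow_nonneg (div_nonneg ℓ.b_nonneg ℓ.s_pos.le) _)

theorem Arch.le_maxDim {d : ℕ} : ∀ {n : ℕ} (a : Arch d n), n ≤ a.maxDim
  | _, .input => le_rfl
  | _, .snoc _ _ => le_max_right _ _

/-- The covering number bound `log N(ε) ≤ log (2 D²) ∏ s² ρ² (∑ (b/s)^{2/3})³ ‖X‖² / ε²`. -/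
theorem Arch.exists_cover {d N : ℕ} {n : ℕ} (a : Arch d n) (X : Cols N d) {D : ℕ}
    (haD : a.maxDim ≤ D) (hD : 1 ≤ D) {ε T : ℝ} (hε : 0 ≤ ε) (hT : 0 ≤ T)
    (h : a.lipProd * a.ratioSum ^ 3 * ‖X‖ ^ 2 ≤ T * ε ^ 2) :
    ∃ C : Finset (Cols N n), (C.card : ℝ) ≤ Real.exp (T * Real.log (2 * (D : ℝ) ^ 2)) ∧
      (∀ z ∈ C, ‖z‖ ^ 2 ≤ a.lipProd * ‖X‖ ^ 2) ∧
      ∀ g ∈ a.nets, ∃ z ∈ C, ‖mapCols g X - z‖ ≤ ε := by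
  classical
  have hlog : 0 ≤ Real.log (2 * (D : ℝ) ^ 2) := by
    apply Real.log_nonneg
    have : (1 : ℝ) ≤ D := by exact_mod_cast hD
    nlinarith
  induction a generalizing ε T with
  | input =>
    refine ⟨{X}, ?_, ?_, ?_⟩
    · rw [Finset.card_singleton, Nat.cast_one]
      exact Real.one_le_exp (mul_nonneg hT hlog)
    · simp [Arch.lipProd]
    · rintro g rfl
      exact ⟨X, by simp, by simpa [mapCols] using hε⟩
  | @snoc m a n ℓ ih =>
    have hlp := a.lipProd_nonneg
    have ham : a.maxDim ≤ D := (le_max_left _ _).trans haD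
    have hmD : m ≤ D := a.le_maxDim.trans ham
    have hnD : n ≤ D := (le_max_right _ _).trans haD
    have hs := ℓ.s_pos
    have hb := ℓ.b_nonneg
    -- A layer with Lipschitz constant zero is identically zero; otherwise radii may be divided by
    -- the constant.
    rcases ℓ.lip.2.eq_or_lt with hρ | hρ
    · refine ⟨{0}, ?_, ?_, ?_⟩
      · rw [Finset.card_singleton, Nat.cast_one]
        exact Real.one_le_exp (mul_nonneg hT hlog)
      · intro z hz
        rw [Finset.mem_singleton.1 hz]
        simpa using mul_nonneg (Arch.lipProd_nonneg (a.snoc ℓ)) (sq_nonneg _)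
      · rintro _ ⟨g, hg, W, hW, rfl⟩
        refine ⟨0, by simp, ?_⟩
        have hz : ∀ z, ℓ.act z = 0 := by
          intro z
          have := ℓ.act_lipschitz.norm_sub_le z 0
          have hρ' : (ℓ.lip : ℝ) = 0 := hρ.symm
          rw [hρ', ℓ.act_zero, zero_mul, sub_zero] at this
          exact norm_le_zero_iff.1 this
        have : mapCols (fun x => ℓ.act (Matrix.toEuclideanLin W (g x))) X = 0 := by
          ext c j; simp [mapCols, hz]
        rw [this]; simpa using hε
    · set ρ : ℝ := (ℓ.lip : ℝ) with hρdef
      replace hρ : 0 < ρ := hρ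
      set α := a.ratioSum with hα
      set β := (ℓ.b / ℓ.s) ^ (2 / 3 : ℝ) with hβ
      have hα0 : 0 ≤ α := a.ratioSum_nonneg
      have hbs : 0 ≤ ℓ.b / ℓ.s := div_nonneg hb hs.le
      have hβ0 : 0 ≤ β := Real.rpow_nonneg hbs _
      have hβ3 : β ^ 3 = (ℓ.b / ℓ.s) ^ 2 := by
        rw [hβ, ← Real.rpow_natCast, ← Real.rpow_mul hbs, ← Real.rpow_natCast]
        norm_num
      change a.lipProd * (ℓ.s ^ 2 * ρ ^ 2) * (α + β) ^ 3 * ‖X‖ ^ 2 ≤ T * ε ^ 2 at h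
      set e₁ := ε * (α / (α + β)) with he₁
      set e₂ := ε * (β / (α + β)) with he₂
      have hαβ : 0 ≤ α + β := add_nonneg hα0 hβ0
      have he₁0 : 0 ≤ e₁ := by positivity
      have he₂0 : 0 ≤ e₂ := by positivity
      have hle : α / (α + β) + β / (α + β) ≤ 1 := by
        rw [← add_div]; exact div_self_le_one _
      -- The entropy requirement is cubic in `γ`: one power of the share `γ / (α + β)` is paid from
      -- `T` and two from the squared radius. The exponent `2/3` is what gives `β ^ 3 = (b / s) ^
      -- 2`.
      have split : ∀ γ, 0 ≤ γ → γ ≤ α + β →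
          a.lipProd * (ℓ.s ^ 2 * ρ ^ 2) * γ ^ 3 * ‖X‖ ^ 2
            ≤ T * (γ / (α + β)) * (ε * (γ / (α + β))) ^ 2 := by
        intro γ hγ hγle
        rcases hαβ.eq_or_lt with h0 | h0
        · have : γ = 0 := by linarith
          rw [this]; simp
        · set q := γ / (α + β) with hq
          have hqγ : γ = q * (α + β) := (div_mul_cancel₀ _ h0.ne').symm
          have hq0 : 0 ≤ q := div_nonneg hγ h0.le
          rw [hqγ]
          have := mul_le_mul_of_nonneg_left h (pow_nonneg hq0 3)
          calc _ = q ^ 3 * (a.lipProd * (ℓ.s ^ 2 * ρ ^ 2) * (α + β) ^ 3 * ‖X‖ ^ 2) := by ring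
            _ ≤ _ := this
            _ = _ := by ring
      -- The layer on top expands distances by at most `ρ s`, so this inner radius contributes `e₁`
      -- to the final error.
      obtain ⟨C, hC, hCn, hCcov⟩ := ih (ε := e₁ / (ρ * ℓ.s)) (T := T * (α / (α + β))) ham
        (by positivity) (by positivity) (by
          rw [div_pow, ← mul_div_assoc, le_div_iff₀ (by positivity)]
          calc _ = a.lipProd * (ℓ.s ^ 2 * ρ ^ 2) * α ^ 3 * ‖X‖ ^ 2 := by ring
            _ ≤ _ := split α hα0 (by linarith))
      have hlayer : ∀ z ∈ C, ∃ C' : Finset (Cols N n),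
          (C'.card : ℝ) ≤ Real.exp (T * (β / (α + β)) * Real.log (2 * (D : ℝ) ^ 2)) ∧
          (∀ y ∈ C', ‖y‖ ≤ ℓ.s * ‖z‖) ∧
          ∀ W ∈ ℓ.weights, ∃ y ∈ C', ‖mapCols (Matrix.toEuclideanLin W) z - y‖ ≤ e₂ / ρ := by
        intro z hz
        refine ℓ.exists_cover z hmD hnD hD (by positivity) (by positivity) ?_
        rw [div_pow, ← mul_div_assoc, le_div_iff₀ (by positivity)]
        calc ℓ.b ^ 2 * ‖z‖ ^ 2 * ρ ^ 2 ≤ ℓ.b ^ 2 * (a.lipProd * ‖X‖ ^ 2) * ρ ^ 2 := by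
              gcongr; exact hCn z hz
          _ = a.lipProd * (ℓ.s ^ 2 * ρ ^ 2) * β ^ 3 * ‖X‖ ^ 2 := by
              rw [hβ3]; field_simp
          _ ≤ _ := split β hβ0 (by linarith)
      choose! L hL1 hL2 hL3 using hlayer
      refine ⟨C.biUnion fun z => (L z).image (mapCols ℓ.act), ?_, ?_, ?_⟩
      · have h1 : ((C.biUnion fun z => (L z).image (mapCols ℓ.act)).card : ℝ)
            ≤ ∑ z ∈ C, ((L z).card : ℝ) := by
          exact_mod_cast Finset.card_biUnion_le.trans
            (Finset.sum_le_sum fun z _ => Finset.card_image_le)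
        refine h1.trans ((Finset.sum_le_sum hL1).trans ?_)
        rw [Finset.sum_const, nsmul_eq_mul]
        refine (mul_le_mul_of_nonneg_right hC (Real.exp_pos _).le).trans ?_
        rw [← Real.exp_add]
        apply Real.exp_le_exp.2
        calc _ = (α / (α + β) + β / (α + β)) * (T * Real.log (2 * (D : ℝ) ^ 2)) := by ring
          _ ≤ 1 * (T * Real.log (2 * (D : ℝ) ^ 2)) :=
              mul_le_mul_of_nonneg_right hle (mul_nonneg hT hlog)
          _ = _ := one_mul _
      · intro y hy
        obtain ⟨z, hz, hy⟩ := Finset.mem_biUnion.1 hy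
        obtain ⟨u, hu, rfl⟩ := Finset.mem_image.1 hy
        have h1 : ‖mapCols ℓ.act u‖ ≤ ρ * ‖u‖ := norm_cols_le hρ.le fun c => by
          have := ℓ.act_lipschitz.norm_sub_le (u c) 0
          simpa [mapCols, ℓ.act_zero] using this
        have h2 : ‖mapCols ℓ.act u‖ ≤ ρ * (ℓ.s * ‖z‖) :=
          h1.trans (mul_le_mul_of_nonneg_left (hL2 z hz u hu) hρ.le)
        calc ‖mapCols ℓ.act u‖ ^ 2 ≤ (ρ * (ℓ.s * ‖z‖)) ^ 2 :=
              pow_le_pow_left₀ (norm_nonneg _) h2 2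
          _ = (ℓ.s ^ 2 * ρ ^ 2) * ‖z‖ ^ 2 := by ring
          _ ≤ (ℓ.s ^ 2 * ρ ^ 2) * (a.lipProd * ‖X‖ ^ 2) :=
              mul_le_mul_of_nonneg_left (hCn z hz) (by positivity)
          _ = a.lipProd * (ℓ.s ^ 2 * ρ ^ 2) * ‖X‖ ^ 2 := by ring
      · rintro _ ⟨g, hg, W, hW, rfl⟩
        obtain ⟨z, hz, hgz⟩ := hCcov g hg
        obtain ⟨u, hu, hzu⟩ := hL3 z hz W hW
        refine ⟨mapCols ℓ.act u, Finset.mem_biUnion.2 ⟨z, hz, Finset.mem_image_of_mem _ hu⟩, ?_⟩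
        have h1 : mapCols (fun x => ℓ.act (Matrix.toEuclideanLin W (g x))) X
            = mapCols ℓ.act (mapCols (Matrix.toEuclideanLin W) (mapCols g X)) := rfl
        rw [h1]
        refine (norm_mapCols_sub_le ℓ.act_lipschitz _ _).trans ?_
        have h2 : ‖mapCols (Matrix.toEuclideanLin W) (mapCols g X) - u‖
            ≤ ℓ.s * (e₁ / (ρ * ℓ.s)) + e₂ / ρ := by
          refine (norm_sub_le_norm_sub_add_norm_sub _
            (mapCols (Matrix.toEuclideanLin W) z) _).trans (add_le_add ?_ hzu)
          refine (norm_mapCols_sub_le (LayerSpec.lipschitz_toEuclideanLin hW) _ _).trans ?_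
          exact mul_le_mul_of_nonneg_left hgz hs.le
        calc ρ * _ ≤ ρ * (ℓ.s * (e₁ / (ρ * ℓ.s)) + e₂ / ρ) :=
              mul_le_mul_of_nonneg_left h2 hρ.le
          _ = ε * (α / (α + β) + β / (α + β)) := by
              rw [he₁, he₂]; field_simp
          _ ≤ ε * 1 := mul_le_mul_of_nonneg_left hle hε
          _ = ε := mul_one ε

/-! ### Rademacher averages and chaining -/

/-- The sign `±1`. -/
def sgn (b : Bool) : ℝ := if b then 1 else -1

/-- The average over all sign vectors. -/
noncomputable def signAvg {N : ℕ} (f : (Fin N → Bool) → ℝ) : ℝ := (∑ σ, f σ) / 2 ^ N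

/-- `∑ σ_i v_i`. -/
noncomputable def signSum {N : ℕ} (σ : Fin N → Bool) (v : Fin N → ℝ) : ℝ := ∑ i, sgn (σ i) * v i

/-- The (unnormalized) Rademacher average of a finite family of vectors. -/
noncomputable def rad {ι : Type*} [Fintype ι] [Nonempty ι] {N : ℕ} (h : ι → Fin N → ℝ) : ℝ :=
  signAvg fun σ => Finset.univ.sup' Finset.univ_nonempty fun i => signSum σ (h i)

section signs

variable {N : ℕ}

theorem abs_sgn (b : Bool) : |sgn b| = 1 := by cases b <;> simp [sgn]

theorem signAvg_mono {f g : (Fin N → Bool) → ℝ} (h : ∀ σ, f σ ≤ g σ) : signAvg f ≤ signAvg g :=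
  div_le_div_of_nonneg_right (Finset.sum_le_sum fun σ _ => h σ) (by positivity)

theorem signAvg_add (f g : (Fin N → Bool) → ℝ) :
    signAvg (fun σ => f σ + g σ) = signAvg f + signAvg g := by
  simp [signAvg, Finset.sum_add_distrib, add_div]

theorem signAvg_const_mul (c : ℝ) (f : (Fin N → Bool) → ℝ) :
    signAvg (fun σ => c * f σ) = c * signAvg f := by
  simp [signAvg, ← Finset.mul_sum, mul_div_assoc]

theorem signAvg_const (c : ℝ) : signAvg (fun _ : Fin N → Bool => c) = c := by
  simp [signAvg]

theorem signAvg_sum {ι : Type*} (s : Finset ι) (f : ι → (Fin N → Bool) → ℝ) :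
    signAvg (fun σ => ∑ i ∈ s, f i σ) = ∑ i ∈ s, signAvg (f i) := by
  simp only [signAvg]
  rw [Finset.sum_comm, Finset.sum_div]

theorem signSum_add (σ : Fin N → Bool) (v w : Fin N → ℝ) :
    signSum σ (fun i => v i + w i) = signSum σ v + signSum σ w := by
  simp [signSum, mul_add, Finset.sum_add_distrib]

theorem signAvg_exp_signSum (v : Fin N → ℝ) :
    signAvg (fun σ => Real.exp (signSum σ v)) = ∏ i, Real.cosh (v i) := by
  have h : ∀ i, Real.cosh (v i) = (∑ b : Bool, Real.exp (sgn b * v i)) / 2 := by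
    intro i; simp [sgn, Real.cosh_eq]
  simp only [h, Finset.prod_div_distrib, Finset.prod_const, Finset.card_univ, Fintype.card_fin,
    Finset.prod_univ_sum, Fintype.piFinset_univ, signAvg, signSum, Real.exp_sum]

theorem signAvg_exp_le (v : Fin N → ℝ) :
    signAvg (fun σ => Real.exp (signSum σ v)) ≤ Real.exp ((∑ i, v i ^ 2) / 2) := by
  rw [signAvg_exp_signSum, Finset.sum_div, Real.exp_sum]
  exact Finset.prod_le_prod (fun i _ => (Real.cosh_pos _).le) fun i _ => Real.cosh_le_exp_half_sq _

/-- Jensen's inequality, by averaging the tangent line of `exp` at the mean. -/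
theorem exp_signAvg_le (f : (Fin N → Bool) → ℝ) :
    Real.exp (signAvg f) ≤ signAvg fun σ => Real.exp (f σ) := by
  have h : ∀ σ, Real.exp (signAvg f) * (1 + (f σ - signAvg f)) ≤ Real.exp (f σ) := by
    intro σ
    have := Real.add_one_le_exp (f σ - signAvg f)
    calc _ ≤ Real.exp (signAvg f) * Real.exp (f σ - signAvg f) :=
          mul_le_mul_of_nonneg_left (by linarith) (Real.exp_pos _).le
      _ = _ := by rw [← Real.exp_add]; congr 1; ring
  refine le_trans (le_of_eq ?_) (signAvg_mono h)
  rw [signAvg_const_mul]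
  have : (fun σ => 1 + (f σ - signAvg f)) = fun σ => (1 - signAvg f) + f σ := by
    funext σ; ring
  rw [this, signAvg_add, signAvg_const]; ring

theorem signAvg_signSum (v : Fin N → ℝ) : signAvg (fun σ => signSum σ v) = 0 := by
  have hflip : ∑ σ : Fin N → Bool, signSum σ v = ∑ σ : Fin N → Bool, -signSum σ v := by
    refine Fintype.sum_equiv (Equiv.piCongrRight fun _ => Equiv.boolNot) _ _ fun σ => ?_
    simp only [signSum, ← Finset.sum_neg_distrib]
    refine Finset.sum_congr rfl fun i _ => ?_
    cases h : σ i <;> simp [sgn, h]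
  rw [Finset.sum_neg_distrib] at hflip
  have : ∑ σ : Fin N → Bool, signSum σ v = 0 := by linarith
  simp [signAvg, this]

end signs

section rad

variable {ι : Type*} [Fintype ι] [Nonempty ι] {N : ℕ}

theorem rad_add_le (g h : ι → Fin N → ℝ) : rad (fun i n => g i n + h i n) ≤ rad g + rad h := by
  unfold rad
  rw [← signAvg_add]
  refine signAvg_mono fun σ => Finset.sup'_le _ _ fun i _ => ?_
  rw [signSum_add]
  exact add_le_add (Finset.le_sup' (fun i => signSum σ (g i)) (Finset.mem_univ i))
    (Finset.le_sup' (fun i => signSum σ (h i)) (Finset.mem_univ i))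

theorem rad_const (v : Fin N → ℝ) : rad (fun _ : ι => v) = 0 := by
  simp [rad, signAvg_signSum]

theorem rad_le_sqrt_mul {h : ι → Fin N → ℝ} {ε : ℝ}
    (hh : ∀ i, √(∑ n, h i n ^ 2) ≤ ε) : rad h ≤ √N * ε := by
  refine (signAvg_mono fun σ => Finset.sup'_le _ _ fun i _ => ?_).trans_eq (signAvg_const _)
  have h1 := Real.sum_mul_le_sqrt_mul_sqrt Finset.univ (fun n => sgn (σ n)) (h i)
  have h2 : ∀ b, sgn b ^ 2 = 1 := fun b => by rw [← sq_abs, abs_sgn]; norm_num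
  simp only [h2, Finset.sum_const, Finset.card_univ, Fintype.card_fin, nsmul_eq_mul,
    mul_one] at h1
  exact h1.trans (mul_le_mul_of_nonneg_left (hh i) (Real.sqrt_nonneg _))

/-- The finite class lemma. -/
theorem rad_le_of_card {h : ι → Fin N → ℝ} {r L : ℝ} (hr : 0 ≤ r) (hL : 0 ≤ L)
    (hh : ∀ i, ∑ n, h i n ^ 2 ≤ r ^ 2) {s : Finset (Fin N → ℝ)} (hs : ∀ i, h i ∈ s)
    (hcard : (s.card : ℝ) ≤ Real.exp L) : rad h ≤ r * √(2 * L) := by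
  classical
  -- By Jensen, exponentiation under the average is allowed; the exponential of the maximum is
  -- bounded by a sum over the class, and each summand is subgaussian.
  have key : ∀ l : ℝ, 0 ≤ l → l * rad h ≤ L + l ^ 2 * r ^ 2 / 2 := by
    intro l hl
    refine Real.exp_le_exp.1 ?_
    -- The set `s` may also contain long vectors, for which the moment bound fails; they are never
    -- attained by `h`.
    set s' := s.filter fun v => ∑ n, v n ^ 2 ≤ r ^ 2 with hs'
    have hmem : ∀ i, h i ∈ s' := fun i => Finset.mem_filter.2 ⟨hs i, hh i⟩
    have e1 : l * rad h = signAvg fun σ =>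
        l * Finset.univ.sup' Finset.univ_nonempty fun i => signSum σ (h i) := by
      rw [signAvg_const_mul]; rfl
    rw [e1]
    refine (exp_signAvg_le _).trans ?_
    have h1 : ∀ σ : Fin N → Bool,
        Real.exp (l * Finset.univ.sup' Finset.univ_nonempty fun i => signSum σ (h i))
          ≤ ∑ v ∈ s', Real.exp (signSum σ fun n => l * v n) := by
      intro σ
      obtain ⟨i, -, hi⟩ := Finset.exists_mem_eq_sup' Finset.univ_nonempty
        fun i => signSum σ (h i)
      rw [hi]
      have : l * signSum σ (h i) = signSum σ fun n => l * h i n := by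
        simp only [signSum, Finset.mul_sum]
        exact Finset.sum_congr rfl fun n _ => by ring
      rw [this]
      exact Finset.single_le_sum (f := fun v => Real.exp (signSum σ fun n => l * v n))
        (fun v _ => (Real.exp_pos _).le) (hmem i)
    refine (signAvg_mono h1).trans ?_
    rw [signAvg_sum]
    have h2 : ∀ v ∈ s', signAvg (fun σ => Real.exp (signSum σ fun n => l * v n))
        ≤ Real.exp (l ^ 2 * r ^ 2 / 2) := by
      intro v hv
      refine (signAvg_exp_le _).trans (Real.exp_le_exp.2 ?_)
      simp only [mul_pow, ← Finset.mul_sum]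
      have := (Finset.mem_filter.1 hv).2
      have := mul_le_mul_of_nonneg_left this (sq_nonneg l)
      linarith
    refine (Finset.sum_le_sum h2).trans ?_
    rw [Finset.sum_const, nsmul_eq_mul, Real.exp_add]
    refine mul_le_mul_of_nonneg_right (le_trans ?_ hcard) (Real.exp_pos _).le
    exact_mod_cast Finset.card_filter_le _ _
  rcases le_or_gt (rad h) 0 with h0 | h0
  · exact h0.trans (by positivity)
  rcases hr.eq_or_lt with hr0 | hr0
  -- With `r = 0` this multiplier would give `L + 1 ≤ L`.
  · have := key ((L + 1) / rad h) (by positivity)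
    rw [div_mul_cancel₀ _ h0.ne', ← hr0] at this
    norm_num at this
  -- This multiplier optimizes the inequality and yields `rad h ^ 2 ≤ 2 L r ^ 2`.
  · have h1 := key (rad h / r ^ 2) (by positivity)
    have h2 : rad h ^ 2 ≤ (r * √(2 * L)) ^ 2 := by
      rw [mul_pow, Real.sq_sqrt (by positivity)]
      have e1 : rad h / r ^ 2 * rad h = rad h ^ 2 / r ^ 2 := by ring
      have e2 : (rad h / r ^ 2) ^ 2 * r ^ 2 / 2 = rad h ^ 2 / r ^ 2 / 2 := by
        field_simp
      rw [e1, e2] at h1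
      have h3 : rad h ^ 2 / r ^ 2 ≤ 2 * L := by linarith
      rw [div_le_iff₀ (by positivity)] at h3
      linarith
    exact (sq_le_sq₀ h0.le (by positivity)).1 h2

/-- Chaining with ratio `3` and recentered nets, under the entropy bound `κ² / ε²`. -/
theorem rad_le_chaining (h : ι → EuclideanSpace ℝ (Fin N)) (c : EuclideanSpace ℝ (Fin N))
    {ε₀ κ : ℝ} (hε₀ : 0 < ε₀) (hκ : 0 ≤ κ) (hc : ∀ i, ‖h i - c‖ ≤ ε₀)
    (hcov : ∀ ε : ℝ, 0 < ε → ∃ C : Finset (EuclideanSpace ℝ (Fin N)),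
      (C.card : ℝ) ≤ Real.exp (κ ^ 2 / ε ^ 2) ∧ ∀ i, ∃ z ∈ C, ‖h i - z‖ ≤ ε) (n : ℕ) :
    rad (fun i => (h i : Fin N → ℝ)) ≤ √N * (ε₀ / 3 ^ n) + n * (9 / 2 * κ) := by
  classical
  -- The factor `9/8` is reproduced by the recursion: `9/8 * 9 ^ j + 9 ^ (j + 1) = 9/8 * 9 ^ (j +
  -- 1)`, the entropies of the old net and of the new cover.
  have hchain : ∀ j : ℕ, ∃ (P : Finset (EuclideanSpace ℝ (Fin N)))
      (p : ι → EuclideanSpace ℝ (Fin N)), (∀ i, p i ∈ P) ∧ (∀ i, ‖h i - p i‖ ≤ ε₀ / 3 ^ j) ∧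
      (P.card : ℝ) ≤ Real.exp (9 / 8 * 9 ^ j * (κ / ε₀) ^ 2) ∧
      rad (fun i => (p i : Fin N → ℝ)) ≤ j * (9 / 2 * κ) := by
    intro j
    induction j with
    | zero =>
      refine ⟨{c}, fun _ => c, by simp, by simpa using hc, ?_, ?_⟩
      · rw [Finset.card_singleton, Nat.cast_one]
        exact Real.one_le_exp (by positivity)
      · rw [rad_const]; simp
    | succ j ih =>
      obtain ⟨P, p, hpP, hhp, hPc, hrad⟩ := ih
      obtain ⟨C, hC, hCh⟩ := hcov (ε₀ / 3 ^ (j + 1)) (by positivity)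
      choose z hzC hz using hCh
      -- New centres are projected onto the ball about the old one, which contains `h i`. Increments
      -- are then at most `ε₀ / 3 ^ j`, without a triangle-inequality loss, and each scale costs
      -- `9/2 * κ`.
      choose Q hQ1 hQ2 using fun u v : EuclideanSpace ℝ (Fin N) =>
        exists_mem_ball_forall_norm_sub_le u v (show 0 ≤ ε₀ / 3 ^ j by positivity)
      have hcard : ((P ×ˢ C).card : ℝ) ≤ Real.exp (9 / 8 * 9 ^ (j + 1) * (κ / ε₀) ^ 2) := by
        rw [Finset.card_product]
        push_cast
        refine (mul_le_mul hPc hC (Nat.cast_nonneg _) (Real.exp_pos _).le).trans (le_of_eq ?_)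
        rw [← Real.exp_add]
        congr 1
        have h9 : ((3 : ℝ) ^ (j + 1)) ^ 2 = 9 ^ (j + 1) := by
          rw [← pow_mul, mul_comm, pow_mul]; norm_num
        rw [div_pow ε₀, h9]
        field_simp
        ring
      refine ⟨(P ×ˢ C).image fun q => Q q.1 q.2, fun i => Q (p i) (z i), fun i => ?_, fun i => ?_,
        ?_, ?_⟩
      · exact Finset.mem_image.2 ⟨(p i, z i), Finset.mem_product.2 ⟨hpP i, hzC i⟩, rfl⟩
      · exact (hQ2 _ _ _ (hhp i)).trans (hz i)
      · exact le_trans (by exact_mod_cast Finset.card_image_le) hcard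
      · have hdec : (fun i => (Q (p i) (z i) : Fin N → ℝ))
            = fun i n => p i n + (Q (p i) (z i) - p i) n := by
          funext i n; simp
        rw [hdec]
        refine (rad_add_le _ _).trans ?_
        have hinc := rad_le_of_card (h := fun i n => (Q (p i) (z i) - p i) n)
          (r := ε₀ / 3 ^ j) (L := 9 / 8 * 9 ^ (j + 1) * (κ / ε₀) ^ 2)
          (by positivity) (by positivity) (fun i => by
            have := pow_le_pow_left₀ (norm_nonneg _) (hQ1 (p i) (z i)) 2
            rw [EuclideanSpace.norm_sq_eq] at this
            simpa using this)
          (s := (P ×ˢ C).image fun q n => (Q q.1 q.2 - q.1) n)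
          (fun i => Finset.mem_image.2 ⟨(p i, z i), Finset.mem_product.2 ⟨hpP i, hzC i⟩, rfl⟩)
          (le_trans (by exact_mod_cast Finset.card_image_le) hcard)
        have hsq : √(2 * (9 / 8 * 9 ^ (j + 1) * (κ / ε₀) ^ 2))
            = 3 / 2 * 3 ^ (j + 1) * (κ / ε₀) := by
          rw [show 2 * (9 / 8 * 9 ^ (j + 1) * (κ / ε₀) ^ 2)
              = (3 / 2 * 3 ^ (j + 1) * (κ / ε₀)) ^ 2 by
            rw [mul_pow, mul_pow, ← pow_mul, mul_comm (j + 1) 2, pow_mul]; norm_num; ring]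
          exact Real.sqrt_sq (by positivity)
        rw [hsq] at hinc
        have e : ε₀ / 3 ^ j * (3 / 2 * 3 ^ (j + 1) * (κ / ε₀)) = 9 / 2 * κ := by
          rw [pow_succ]; field_simp; ring
        rw [e] at hinc
        push_cast
        linarith
  obtain ⟨P, p, -, hhp, -, hrad⟩ := hchain n
  have hdec : (fun i => (h i : Fin N → ℝ)) = fun i n => (h i - p i) n + p i n := by
    funext i n; simp
  rw [hdec]
  refine (rad_add_le _ _).trans (add_le_add ?_ hrad)
  refine rad_le_sqrt_mul fun i => ?_
  have := hhp i
  rw [EuclideanSpace.norm_eq] at this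
  simpa using this

end rad

/-- The least `n` with `N ≤ 4 * 3 ^ n` works: by minimality `4 * 3 ^ (n - 1) < N`, hence `3 ^ n ≤
N`. The first bound controls the discretization error, the second the number of scales. -/
theorem exists_scale (N : ℕ) (hN : 1 ≤ N) :
    ∃ n : ℕ, N ≤ 4 * 3 ^ n ∧ (n : ℝ) * Real.log 3 ≤ Real.log N := by
  have hex : ∃ n : ℕ, N ≤ 4 * 3 ^ n :=
    ⟨N, ((Nat.lt_pow_self (by norm_num : 1 < 3)).le).trans (Nat.le_mul_of_pos_left _ (by norm_num))⟩
  classical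
  refine ⟨Nat.find hex, Nat.find_spec hex, ?_⟩
  rcases Nat.eq_zero_or_pos (Nat.find hex) with h0 | h0
  · rw [h0]
    simpa using Real.log_nonneg (by exact_mod_cast hN)
  · obtain ⟨m, hm⟩ := Nat.exists_eq_succ_of_ne_zero h0.ne'
    have hlt := Nat.find_min hex (m := m) (by omega)
    rw [hm, ← Real.log_pow]
    apply Real.log_le_log (by positivity)
    have : 3 ^ (m + 1) ≤ N := by
      push Not at hlt
      have : 3 ^ (m + 1) = 3 * 3 ^ m := by ring
      omega
    exact_mod_cast this

/-- Optimizing the number of scales. -/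
theorem two_div_mul_rad_le {ι : Type*} [Fintype ι] [Nonempty ι] {N : ℕ} (hN : 1 ≤ N) {K : ℝ}
    (hK : 0 < K) (h : ι → EuclideanSpace ℝ (Fin N)) {R X : ℝ} (hR : 0 ≤ R) (hX : 0 ≤ X)
    (hh : ∀ i n, 0 ≤ h i n ∧ h i n ≤ 2 / K)
    (hcov : ∀ ε : ℝ, 0 < ε → ∃ C : Finset (EuclideanSpace ℝ (Fin N)),
      (C.card : ℝ) ≤ Real.exp (8 * R * X ^ 2 / (K * ε) ^ 2) ∧ ∀ i, ∃ z ∈ C, ‖h i - z‖ ≤ ε) :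
    2 / N * rad (fun i => (h i : Fin N → ℝ))
      ≤ 8 / (N * K) + 12 * √(2 * R) * X * Real.log N / (N * K * Real.log 2) := by
  have hN0 : (0 : ℝ) < N := by exact_mod_cast hN
  obtain ⟨n, hn, hnlog⟩ := exists_scale N hN
  have hs2 : √(2 * R) ^ 2 = 2 * R := Real.sq_sqrt (by positivity)
  have hsN : √(N : ℝ) ^ 2 = N := Real.sq_sqrt hN0.le
  -- All coordinates lie in `[0, 2/K]`, so the constant vector `1/K` is within `√N / K`; the choice
  -- of `κ` matches `κ² = 8 R X² / K²`.
  have hmain := rad_le_chaining h (WithLp.toLp 2 fun _ => 1 / K) (ε₀ := √N / K)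
    (κ := 2 * √(2 * R) * X / K) (by positivity) (by positivity) (fun i => by
      refine (sq_le_sq₀ (norm_nonneg _) (by positivity)).1 ?_
      rw [EuclideanSpace.norm_sq_eq, div_pow, hsN]
      calc ∑ n, ‖(h i - WithLp.toLp 2 fun _ => 1 / K : EuclideanSpace ℝ (Fin N)) n‖ ^ 2 ≤ ∑ _n : Fin N, (1 / K) ^ 2 := by
            refine Finset.sum_le_sum fun n _ => ?_
            rw [Real.norm_eq_abs]
            refine pow_le_pow_left₀ (abs_nonneg _) (abs_le.2 ?_) 2
            have h2 : 2 / K = 1 / K + 1 / K := by ring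
            have := hh i n
            simp only [PiLp.sub_apply]
            constructor <;> linarith
        _ = N / K ^ 2 := by simp; ring) (fun ε hε => by
      obtain ⟨C, hC, hCh⟩ := hcov ε hε
      refine ⟨C, hC.trans (le_of_eq ?_), hCh⟩
      congr 1
      rw [div_pow, mul_pow, mul_pow, mul_pow, hs2]
      field_simp
      ring) n
  have h3n : (N : ℝ) ≤ 4 * 3 ^ n := by exact_mod_cast hn
  have hl2 : 0 < Real.log 2 := Real.log_pos (by norm_num)
  -- From `8 ≤ 9`: trading `log 3` for `log 2` in this way turns the chaining constant `18` into
  -- `12`.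
  have hl3 : 3 * Real.log 2 ≤ 2 * Real.log 3 := by
    have : Real.log (2 ^ 3) ≤ Real.log (3 ^ 2) := Real.log_le_log (by norm_num) (by norm_num)
    rw [Real.log_pow, Real.log_pow] at this
    exact_mod_cast this
  have hnl : 3 * (n : ℝ) * Real.log 2 ≤ 2 * Real.log N := by
    have := mul_le_mul_of_nonneg_left hl3 (Nat.cast_nonneg (α := ℝ) n)
    linarith
  have t1 : 2 / N * (√N * (√N / K / 3 ^ n)) ≤ 8 / (N * K) := by
    have : 2 / N * (√N * (√N / K / 3 ^ n)) = 2 / (K * 3 ^ n) := by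
      rw [show √N * (√N / K / 3 ^ n) = √(N : ℝ) ^ 2 / (K * 3 ^ n) by field_simp, hsN]
      field_simp
    rw [this, div_le_div_iff₀ (by positivity) (by positivity)]
    nlinarith [mul_le_mul_of_nonneg_left h3n hK.le]
  have t2 : 2 / N * (n * (9 / 2 * (2 * √(2 * R) * X / K)))
      ≤ 12 * √(2 * R) * X * Real.log N / (N * K * Real.log 2) := by
    have e1 : 2 / N * (n * (9 / 2 * (2 * √(2 * R) * X / K)))
        = 6 * √(2 * R) * X * (3 * n * Real.log 2) / (N * K * Real.log 2) := by
      field_simp; ring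
    rw [e1]
    apply div_le_div_of_nonneg_right _ (by positivity)
    have := mul_le_mul_of_nonneg_left hnl (show 0 ≤ 6 * √(2 * R) * X by positivity)
    linarith
  have := mul_le_mul_of_nonneg_left hmain (show (0 : ℝ) ≤ 2 / N by positivity)
  rw [mul_add] at this
  linarith

/-! ### The bounded differences inequality and symmetrization -/

theorem integrable_of_abs_le {Ω : Type*} [MeasurableSpace Ω] {μ : Measure Ω} [IsFiniteMeasure μ]
    {f : Ω → ℝ} (hf : Measurable f) {C : ℝ} (hC : ∀ x, |f x| ≤ C) : Integrable f μ :=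
  Integrable.of_bound hf.aestronglyMeasurable C (Eventually.of_forall hC)

section mcdiarmid

variable {X : Type*} [MeasurableSpace X] (μ : Measure X) [IsProbabilityMeasure μ]

theorem integral_pi_succ {n : ℕ} {F : (Fin (n + 1) → X) → ℝ} (hF : Measurable F) {C : ℝ}
    (hC : ∀ x, |F x| ≤ C) :
    ∫ x, F x ∂(Measure.pi fun _ => μ)
      = ∫ x, ∫ y, F (Fin.cons y x) ∂μ ∂(Measure.pi fun _ : Fin n => μ) := by
  have hmp := (measurePreserving_piFinSuccAbove (fun _ : Fin (n + 1) => μ) 0).symm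
  rw [← hmp.map_eq, integral_map_equiv]
  rw [integral_prod_symm]
  · have hc : ∀ p : X × (Fin n → X),
        (MeasurableEquiv.piFinSuccAbove (fun _ : Fin (n + 1) => X) 0).symm p
          = Fin.cons p.1 p.2 := fun p => Fin.insertNth_zero' p.1 p.2
    simp only [hc]
  · exact integrable_of_abs_le (hF.comp (MeasurableEquiv.measurable _)) fun p => hC _

/-- The exponential moment bound behind the bounded differences inequality. -/
theorem integral_exp_le_of_bounded_differences (n : ℕ) {f : (Fin n → X) → ℝ} (hf : Measurable f)
    {c : ℝ} (hc : 0 ≤ c) (hdiff : ∀ x i y, |f (Function.update x i y) - f x| ≤ c)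
    {C : ℝ} (hC : ∀ x, |f x| ≤ C) (t : ℝ) :
    ∫ x, Real.exp (t * (f x - ∫ x, f x ∂(Measure.pi fun _ => μ))) ∂(Measure.pi fun _ => μ)
      ≤ Real.exp (n * (c ^ 2 * t ^ 2 / 2)) := by
  induction n with
  | zero =>
    have h : ∀ x, f x = f Fin.elim0 := fun x => congrArg f (Subsingleton.elim _ _)
    simp [h]
  | succ n ih =>
    have hcons : Measurable fun p : (Fin n → X) × X => f (Fin.cons p.2 p.1) := by
      refine hf.comp (measurable_pi_iff.2 fun i => ?_)
      refine Fin.cases ?_ (fun j => ?_) i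
      · simpa using measurable_snd
      · simpa [Function.comp_def] using (measurable_pi_apply j).comp measurable_fst
    have hsec : ∀ x : Fin n → X, Measurable fun y => f (Fin.cons y x) := fun x =>
      hcons.comp (measurable_const.prodMk measurable_id)
    -- Integrating out the first coordinate preserves the mean and the bounded differences, so the
    -- induction hypothesis applies to `g`.
    set g : (Fin n → X) → ℝ := fun x => ∫ y, f (Fin.cons y x) ∂μ with hg
    have hgm : Measurable g := by
      have := hcons.stronglyMeasurable.integral_prod_right' (ν := μ)
      exact this.measurable
    have hint : ∀ x, Integrable (fun y => f (Fin.cons y x)) μ := fun x =>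
      integrable_of_abs_le (hsec x) fun y => hC _
    have hgC : ∀ x, |g x| ≤ C := by
      intro x
      refine (abs_integral_le_integral_abs).trans ?_
      calc ∫ y, |f (Fin.cons y x)| ∂μ ≤ ∫ _, C ∂μ :=
            integral_mono (hint x).abs (integrable_const _) fun y => hC _
        _ = C := by simp
    have hgdiff : ∀ x i y, |g (Function.update x i y) - g x| ≤ c := by
      intro x i y
      rw [hg]
      simp only
      rw [← integral_sub (hint _) (hint _)]
      refine (abs_integral_le_integral_abs).trans ?_
      calc ∫ u, |f (Fin.cons u (Function.update x i y)) - f (Fin.cons u x)| ∂μ ≤ ∫ _, c ∂μ := by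
            refine integral_mono ((hint _).sub (hint _)).abs (integrable_const _) fun u => ?_
            simp only
            rw [Fin.cons_update]
            exact hdiff _ _ _
        _ = c := by simp
    have hfg : ∫ x, f x ∂(Measure.pi fun _ => μ) = ∫ x, g x ∂(Measure.pi fun _ => μ) :=
      integral_pi_succ μ hf hC
    rw [hfg]
    set m := ∫ x, g x ∂(Measure.pi fun _ : Fin n => μ) with hm
    have hexpC : ∀ x, |Real.exp (t * (f x - m))| ≤ Real.exp (|t| * (C + |m|)) := by
      intro x
      rw [abs_of_pos (Real.exp_pos _)]
      apply Real.exp_le_exp.2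
      refine (le_abs_self _).trans ?_
      rw [abs_mul]
      refine mul_le_mul_of_nonneg_left ((abs_sub _ _).trans ?_) (abs_nonneg _)
      linarith [hC x]
    rw [integral_pi_succ μ (by fun_prop) hexpC]
    have hinner : ∀ x : Fin n → X, ∫ y, Real.exp (t * (f (Fin.cons y x) - m)) ∂μ
        ≤ Real.exp (c ^ 2 * t ^ 2 / 2) * Real.exp (t * (g x - m)) := by
      intro x
      obtain ⟨y₀⟩ : Nonempty X := nonempty_of_isProbabilityMeasure μ
      -- The section lies within `c` of its value at a reference point. The interval has length `2
      -- c`, so Hoeffding's lemma gives variance proxy `c²`.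
      have hsub := hasSubgaussianMGF_of_mem_Icc (μ := μ) (X := fun y => f (Fin.cons y x))
        (a := f (Fin.cons y₀ x) - c) (b := f (Fin.cons y₀ x) + c) (hsec x).aemeasurable
        (Eventually.of_forall fun y => by
          have := hdiff (Fin.cons y₀ x) 0 y
          rw [Fin.update_cons_zero, abs_le] at this
          constructor <;> linarith [this.1, this.2])
      have h1 := hsub.mgf_le t
      have hv : (((‖f (Fin.cons y₀ x) + c - (f (Fin.cons y₀ x) - c)‖₊ / 2) ^ 2 : ℝ≥0) : ℝ)
          = c ^ 2 := by
        rw [show f (Fin.cons y₀ x) + c - (f (Fin.cons y₀ x) - c) = 2 * c by ring]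
        push_cast
        rw [Real.norm_of_nonneg (by positivity)]
        ring
      rw [hv, mgf] at h1
      have h2 : ∀ y, Real.exp (t * (f (Fin.cons y x) - m))
          = Real.exp (t * (g x - m)) * Real.exp (t * (f (Fin.cons y x) - g x)) := fun y => by
        rw [← Real.exp_add]; congr 1; ring
      simp only [h2]
      rw [integral_const_mul, mul_comm]
      exact mul_le_mul_of_nonneg_right h1 (Real.exp_pos _).le
    have hint2 : Integrable (fun x => Real.exp (t * (g x - m))) (Measure.pi fun _ : Fin n => μ) := by
      refine integrable_of_abs_le (by fun_prop) (C := Real.exp (|t| * (C + |m|))) fun x => ?_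
      rw [abs_of_pos (Real.exp_pos _)]
      apply Real.exp_le_exp.2
      refine (le_abs_self _).trans ?_
      rw [abs_mul]
      refine mul_le_mul_of_nonneg_left ((abs_sub _ _).trans ?_) (abs_nonneg _)
      linarith [hgC x]
    calc ∫ x, ∫ y, Real.exp (t * (f (Fin.cons y x) - m)) ∂μ ∂(Measure.pi fun _ : Fin n => μ)
        ≤ ∫ x, Real.exp (c ^ 2 * t ^ 2 / 2) * Real.exp (t * (g x - m))
            ∂(Measure.pi fun _ : Fin n => μ) := by
          refine integral_mono_of_nonneg
            (Eventually.of_forall fun x => integral_nonneg fun y => (Real.exp_pos _).le)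
            (hint2.const_mul _) (Eventually.of_forall hinner)
      _ = Real.exp (c ^ 2 * t ^ 2 / 2) * ∫ x, Real.exp (t * (g x - m))
            ∂(Measure.pi fun _ : Fin n => μ) := integral_const_mul _ _
      _ ≤ Real.exp (c ^ 2 * t ^ 2 / 2) * Real.exp (n * (c ^ 2 * t ^ 2 / 2)) :=
          mul_le_mul_of_nonneg_left (ih hgm hgdiff hgC) (Real.exp_pos _).le
      _ = _ := by rw [← Real.exp_add]; congr 1; push_cast; ring

/-- The bounded differences inequality. -/
theorem measure_ge_le_of_bounded_differences (n : ℕ) {f : (Fin n → X) → ℝ} (hf : Measurable f)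
    {c : ℝ} (hc : 0 ≤ c) (hdiff : ∀ x i y, |f (Function.update x i y) - f x| ≤ c)
    {C : ℝ} (hC : ∀ x, |f x| ≤ C) (ε : ℝ) {t : ℝ} (ht : 0 ≤ t) :
    (Measure.pi fun _ => μ) {x | ε ≤ f x - ∫ x, f x ∂(Measure.pi fun _ => μ)}
      ≤ ENNReal.ofReal (Real.exp (-t * ε + n * (c ^ 2 * t ^ 2 / 2))) := by
  set m := ∫ x, f x ∂(Measure.pi fun _ => μ) with hm
  have hint : Integrable (fun x => Real.exp (t * (f x - m))) (Measure.pi fun _ : Fin n => μ) := by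
    refine integrable_of_abs_le (by fun_prop) (C := Real.exp (|t| * (C + |m|))) fun x => ?_
    rw [abs_of_pos (Real.exp_pos _)]
    apply Real.exp_le_exp.2
    refine (le_abs_self _).trans ?_
    rw [abs_mul]
    refine mul_le_mul_of_nonneg_left ((abs_sub _ _).trans ?_) (abs_nonneg _)
    linarith [hC x]
  have h1 := measure_ge_le_exp_mul_mgf (μ := Measure.pi fun _ : Fin n => μ)
    (X := fun x => f x - m) ε ht hint
  have h2 := integral_exp_le_of_bounded_differences μ n hf hc hdiff hC t
  have h3 : (Measure.pi fun _ : Fin n => μ).real {x | ε ≤ f x - m}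
      ≤ Real.exp (-t * ε + n * (c ^ 2 * t ^ 2 / 2)) := by
    refine h1.trans ?_
    rw [Real.exp_add]
    exact mul_le_mul_of_nonneg_left h2 (Real.exp_pos _).le
  rw [measureReal_def] at h3
  exact (ENNReal.le_ofReal_iff_toReal_le (measure_ne_top _ _) (Real.exp_pos _).le).2 h3

end mcdiarmid

/-! ### Stability and measurability of finite suprema and Rademacher averages -/

section suprema

variable {ι : Type*} [Fintype ι] [Nonempty ι] {N : ℕ}

theorem abs_sup'_sub_sup'_le {f g : ι → ℝ} {c : ℝ} (h : ∀ i, |f i - g i| ≤ c) :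
    |Finset.univ.sup' Finset.univ_nonempty f - Finset.univ.sup' Finset.univ_nonempty g| ≤ c := by
  have aux : ∀ f g : ι → ℝ, (∀ i, |f i - g i| ≤ c) →
      Finset.univ.sup' Finset.univ_nonempty f
        ≤ Finset.univ.sup' Finset.univ_nonempty g + c := by
    intro f g h
    refine Finset.sup'_le _ _ fun i _ => ?_
    have := Finset.le_sup' g (Finset.mem_univ i)
    linarith [(abs_le.1 (h i)).2]
  rw [abs_le]
  constructor
  · linarith [aux g f fun i => by rw [abs_sub_comm]; exact h i]
  · linarith [aux f g h]

theorem abs_sup'_le {f : ι → ℝ} {c : ℝ} (h : ∀ i, |f i| ≤ c) :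
    |Finset.univ.sup' Finset.univ_nonempty f| ≤ c := by
  have := abs_sup'_sub_sup'_le (f := f) (g := fun _ => 0) (c := c) (by simpa using h)
  simpa using this

theorem measurable_sup'_univ {Ω : Type*} [MeasurableSpace Ω] {f : ι → Ω → ℝ}
    (hf : ∀ i, Measurable (f i)) :
    Measurable fun x => Finset.univ.sup' Finset.univ_nonempty fun i => f i x := by
  have := Finset.measurable_sup' (f := f) Finset.univ_nonempty fun i _ => hf i
  convert this using 1
  ext x
  rw [Finset.sup'_apply]

theorem abs_signSum_le (σ : Fin N → Bool) {v : Fin N → ℝ} {b : ℝ} (hv : ∀ n, |v n| ≤ b) :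
    |signSum σ v| ≤ N * b := by
  refine (Finset.abs_sum_le_sum_abs _ _).trans ?_
  calc ∑ n, |sgn (σ n) * v n| ≤ ∑ _n : Fin N, b := Finset.sum_le_sum fun n _ => by
        rw [abs_mul, abs_sgn, one_mul]; exact hv n
    _ = N * b := by simp

theorem measurable_signSum {Ω : Type*} [MeasurableSpace Ω] (σ : Fin N → Bool)
    {v : Ω → Fin N → ℝ} (hv : ∀ n, Measurable fun x => v x n) :
    Measurable fun x => signSum σ (v x) :=
  Finset.measurable_sum _ fun n _ => (hv n).const_mul _

theorem measurable_rad {Ω : Type*} [MeasurableSpace Ω] {h : Ω → ι → Fin N → ℝ}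
    (hh : ∀ i n, Measurable fun x => h x i n) : Measurable fun x => rad (h x) :=
  (Finset.measurable_sum _ fun σ _ =>
    measurable_sup'_univ fun i => measurable_signSum σ fun n => hh i n).div_const _

theorem abs_rad_sub_rad_le {g h : ι → Fin N → ℝ} {c : ℝ}
    (hgh : ∀ σ i, |signSum σ (g i) - signSum σ (h i)| ≤ c) : |rad g - rad h| ≤ c := by
  have h1 : rad g - rad h = signAvg fun σ =>
      (Finset.univ.sup' Finset.univ_nonempty fun i => signSum σ (g i))
        - Finset.univ.sup' Finset.univ_nonempty fun i => signSum σ (h i) := by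
    simp [rad, signAvg, Finset.sum_sub_distrib, sub_div]
  rw [h1, abs_le]
  have h2 := fun σ => abs_le.1 (abs_sup'_sub_sup'_le (hgh σ))
  constructor
  · rw [← signAvg_const (N := N) (-c)]
    exact signAvg_mono fun σ => (h2 σ).1
  · rw [← signAvg_const (N := N) c]
    exact signAvg_mono fun σ => (h2 σ).2

theorem abs_rad_le {h : ι → Fin N → ℝ} {b : ℝ} (hh : ∀ i n, |h i n| ≤ b) : |rad h| ≤ N * b := by
  have h0 : rad (fun (_ : ι) (_ : Fin N) => (0 : ℝ)) = 0 := rad_const _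
  have := abs_rad_sub_rad_le (g := h) (h := fun _ _ => 0) (c := N * b) fun σ i => by
    have : signSum σ (fun _ : Fin N => (0 : ℝ)) = 0 := by simp [signSum]
    rw [this, sub_zero]
    exact abs_signSum_le σ (hh i)
  rwa [h0, sub_zero] at this

theorem rad_neg (h : ι → Fin N → ℝ) : rad (fun i n => -h i n) = rad h := by
  unfold rad signAvg
  congr 1
  refine Fintype.sum_equiv (Equiv.piCongrRight fun _ => Equiv.boolNot) _ _ fun σ => ?_
  congr 1
  funext i
  refine Finset.sum_congr rfl fun n _ => ?_
  cases hσ : σ n <;> simp [sgn, hσ]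

/-- The sum of the increments, with signs. -/
noncomputable def signedGap {X ι : Type*} [Fintype ι] [Nonempty ι] {N : ℕ} (h : ι → X → ℝ) (σ : Fin N → Bool) (z : Fin N → X × X) : ℝ :=
  Finset.univ.sup' Finset.univ_nonempty fun i =>
    signSum σ fun n => h i (z n).2 - h i (z n).1

theorem abs_signedGap_le {X ι : Type*} [Fintype ι] [Nonempty ι] {N : ℕ}
    {h : ι → X → ℝ} {b : ℝ} (hb : ∀ i u, 0 ≤ h i u ∧ h i u ≤ b) (σ : Fin N → Bool)
    (z : Fin N → X × X) : |signedGap h σ z| ≤ N * b :=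
  abs_sup'_le fun i => abs_signSum_le σ fun n => by
    rw [abs_le]
    constructor <;> linarith [(hb i (z n).1).1, (hb i (z n).1).2, (hb i (z n).2).1,
      (hb i (z n).2).2]

end suprema

/-! ### Symmetrization with a ghost sample -/

section symmetrization

variable {X : Type*} [MeasurableSpace X] (μ : Measure X) [IsProbabilityMeasure μ]
  {ι : Type*} [Fintype ι] [Nonempty ι] {N : ℕ}

/-- The largest deviation of an empirical mean below its expectation. -/
noncomputable def maxDev (h : ι → X → ℝ) (x : Fin N → X) : ℝ :=
  Finset.univ.sup' Finset.univ_nonempty fun i => ∫ u, h i u ∂μ - (∑ n, h i (x n)) / N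

variable {h : ι → X → ℝ} {b : ℝ}

theorem measurable_signedGap (hm : ∀ i, Measurable (h i)) (σ : Fin N → Bool) :
    Measurable (signedGap h σ) :=
  measurable_sup'_univ fun i => measurable_signSum σ fun n =>
    ((hm i).comp (measurable_snd.comp (measurable_pi_apply n))).sub
      ((hm i).comp (measurable_fst.comp (measurable_pi_apply n)))

/-- Swapping the two members of the pairs with negative sign preserves the product measure and flips
exactly those increments. -/
theorem integral_signedGap_eq (hm : ∀ i, Measurable (h i)) (σ : Fin N → Bool) :
    ∫ z, signedGap h σ z ∂(Measure.pi fun _ => μ.prod μ)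
      = ∫ z, signedGap h (fun _ : Fin N => true) z ∂(Measure.pi fun _ => μ.prod μ) := by
  have hmp : MeasurePreserving
      (fun (z : Fin N → X × X) n => if σ n then z n else (z n).swap)
      (Measure.pi fun _ => μ.prod μ) (Measure.pi fun _ => μ.prod μ) := by
    refine measurePreserving_pi (fun _ => μ.prod μ) (fun _ => μ.prod μ)
      (f := fun n p => if σ n then p else p.swap) fun n => ?_
    cases σ n
    · simpa using Measure.measurePreserving_swap
    · simp only [if_true]; exact MeasurePreserving.id _
  have := integral_map (μ := Measure.pi fun _ : Fin N => μ.prod μ) hmp.measurable.aemeasurable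
    (measurable_signedGap (N := N) hm fun _ => true).aestronglyMeasurable
  rw [hmp.map_eq] at this
  rw [this]
  congr 1
  funext z
  unfold signedGap signSum
  congr 1
  funext i
  refine Finset.sum_congr rfl fun n _ => ?_
  cases hσ : σ n <;> simp [sgn, hσ]

/-- The expectation of each function is written as a mean over a ghost sample, the second members of
the pairs; the supremum of integrals is at most the integral of the supremum. -/
theorem mul_integral_maxDev_le (hN : 0 < N) (hm : ∀ i, Measurable (h i))
    (hb : ∀ i u, 0 ≤ h i u ∧ h i u ≤ b) :
    N * ∫ x, maxDev μ h x ∂(Measure.pi fun _ : Fin N => μ)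
      ≤ ∫ z, signedGap h (fun _ : Fin N => true) z ∂(Measure.pi fun _ => μ.prod μ) := by
  have hN0 : (0 : ℝ) < N := by exact_mod_cast hN
  set e := MeasurableEquiv.arrowProdEquivProdArrow X X (Fin N) with he
  have hmp : MeasurePreserving e (Measure.pi fun _ : Fin N => μ.prod μ)
      ((Measure.pi fun _ => μ).prod (Measure.pi fun _ => μ)) :=
    measurePreserving_arrowProdEquivProdArrow X X (Fin N) (fun _ => μ) (fun _ => μ)
  have hint : Integrable (fun p : (Fin N → X) × (Fin N → X) =>
      signedGap h (fun _ => true) (e.symm p))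
      ((Measure.pi fun _ => μ).prod (Measure.pi fun _ => μ)) :=
    integrable_of_abs_le ((measurable_signedGap hm _).comp e.symm.measurable) fun p =>
      abs_signedGap_le hb _ _
  rw [← hmp.symm.map_eq, integral_map_equiv, integral_prod _ hint, ← integral_const_mul]
  refine integral_mono ?_ hint.integral_prod_left fun x => ?_
  · refine (integrable_of_abs_le (measurable_sup'_univ fun i => ?_) (C := b)
      fun x => abs_sup'_le fun i => ?_).const_mul _
    · exact measurable_const.sub ((Finset.measurable_sum _ fun n _ =>
        (hm i).comp (measurable_pi_apply n)).div_const _)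
    · have h1 : 0 ≤ ∫ u, h i u ∂μ ∧ ∫ u, h i u ∂μ ≤ b := by
        refine ⟨integral_nonneg fun u => (hb i u).1, ?_⟩
        calc ∫ u, h i u ∂μ ≤ ∫ _, b ∂μ := integral_mono_of_nonneg
              (Eventually.of_forall fun u => (hb i u).1) (integrable_const _)
              (Eventually.of_forall fun u => (hb i u).2)
          _ = b := by simp
      have h2 : 0 ≤ (∑ n, h i (x n)) / N ∧ (∑ n, h i (x n)) / N ≤ b := by
        refine ⟨div_nonneg (Finset.sum_nonneg fun n _ => (hb i _).1) hN0.le, ?_⟩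
        rw [div_le_iff₀ hN0]
        calc ∑ n, h i (x n) ≤ ∑ _n : Fin N, b := Finset.sum_le_sum fun n _ => (hb i _).2
          _ = b * N := by simp [mul_comm]
      rw [abs_le]; constructor <;> linarith [h1.1, h1.2, h2.1, h2.2]
  · simp only
    have hx : N * maxDev μ h x = Finset.univ.sup' Finset.univ_nonempty fun i =>
        N * (∫ u, h i u ∂μ - (∑ n, h i (x n)) / N) := by
      unfold maxDev
      obtain ⟨i, -, hi⟩ := Finset.exists_mem_eq_sup' Finset.univ_nonempty
        fun i => ∫ u, h i u ∂μ - (∑ n, h i (x n)) / N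
      refine le_antisymm ?_ (Finset.sup'_le _ _ fun j _ => ?_)
      · rw [hi]
        exact Finset.le_sup' (fun i => N * (∫ u, h i u ∂μ - (∑ n, h i (x n)) / N))
          (Finset.mem_univ i)
      · exact mul_le_mul_of_nonneg_left (Finset.le_sup' (fun i => ∫ u, h i u ∂μ
          - (∑ n, h i (x n)) / N) (Finset.mem_univ j)) hN0.le
    rw [hx]
    refine Finset.sup'_le _ _ fun i _ => ?_
    have hhi : Integrable (h i) μ := integrable_of_abs_le (hm i) (C := b) fun u => by
      rw [abs_of_nonneg (hb i u).1]; exact (hb i u).2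
    have hev : ∀ n, ∫ x' : Fin N → X, h i (x' n) ∂(Measure.pi fun _ => μ) = ∫ u, h i u ∂μ := by
      intro n
      have hmpn := measurePreserving_eval (fun _ : Fin N => μ) n
      have := integral_map (μ := Measure.pi fun _ : Fin N => μ) hmpn.measurable.aemeasurable
        (hm i).aestronglyMeasurable
      rw [hmpn.map_eq] at this
      exact this.symm
    have hie : ∀ n, Integrable (fun x' : Fin N → X => h i (x' n)) (Measure.pi fun _ => μ) :=
      fun n => (measurePreserving_eval (fun _ : Fin N => μ) n).integrable_comp_of_integrable hhi
    have hsum : N * (∫ u, h i u ∂μ - (∑ n, h i (x n)) / N)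
        = ∫ x' : Fin N → X, (∑ n, h i (x' n) - ∑ n, h i (x n)) ∂(Measure.pi fun _ => μ) := by
      rw [integral_sub (integrable_finsetSum _ fun n _ => hie n) (integrable_const _),
        integral_finsetSum _ fun n _ => hie n]
      simp only [hev]
      simp
      field_simp
    rw [hsum]
    refine integral_mono ((integrable_finsetSum _ fun n _ => hie n).sub (integrable_const _))
      ?_ fun x' => ?_
    · refine integrable_of_abs_le ?_ (C := N * b) fun x' => abs_signedGap_le hb _ _
      exact (measurable_signedGap hm _).comp
        (e.symm.measurable.comp (measurable_const.prodMk measurable_id))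
    · have hle := Finset.le_sup' (fun i => signSum (fun _ : Fin N => true)
        fun n => h i ((e.symm (x, x')) n).2 - h i ((e.symm (x, x')) n).1) (Finset.mem_univ i)
      refine le_trans (le_of_eq ?_) hle
      simp only [signSum, sgn, if_true, one_mul, Finset.sum_sub_distrib]
      rfl

/-- Symmetrization: the expected maximal deviation is at most twice the Rademacher average. -/
theorem integral_maxDev_le (hN : 0 < N) (hm : ∀ i, Measurable (h i))
    (hb : ∀ i u, 0 ≤ h i u ∧ h i u ≤ b) :
    ∫ x, maxDev μ h x ∂(Measure.pi fun _ : Fin N => μ)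
      ≤ ∫ x, 2 / N * rad (fun i n => h i (x n)) ∂(Measure.pi fun _ : Fin N => μ) := by
  have hN0 : (0 : ℝ) < N := by exact_mod_cast hN
  have habs : ∀ i u, |h i u| ≤ b := fun i u => by
    rw [abs_of_nonneg (hb i u).1]; exact (hb i u).2
  have hradm : Measurable fun x : Fin N → X => rad fun i n => h i (x n) :=
    measurable_rad fun i n => (hm i).comp (measurable_pi_apply n)
  have hradint : Integrable (fun x : Fin N → X => rad fun i n => h i (x n))
      (Measure.pi fun _ => μ) :=
    integrable_of_abs_le hradm fun x => abs_rad_le fun i n => habs i (x n)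
  have hproj : ∀ q : X × X → X, MeasurePreserving q (μ.prod μ) μ →
      Integrable (fun z : Fin N → X × X => rad fun i n => h i (q (z n)))
        (Measure.pi fun _ => μ.prod μ) ∧
      ∫ z : Fin N → X × X, rad (fun i n => h i (q (z n))) ∂(Measure.pi fun _ => μ.prod μ)
        = ∫ x : Fin N → X, rad (fun i n => h i (x n)) ∂(Measure.pi fun _ => μ) := by
    intro q hq
    have hmp : MeasurePreserving (fun (z : Fin N → X × X) n => q (z n))
        (Measure.pi fun _ => μ.prod μ) (Measure.pi fun _ => μ) :=
      measurePreserving_pi (fun _ => μ.prod μ) (fun _ => μ) (f := fun _ => q) fun _ => hq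
    refine ⟨hmp.integrable_comp_of_integrable hradint, ?_⟩
    have := integral_map (μ := Measure.pi fun _ : Fin N => μ.prod μ) hmp.measurable.aemeasurable
      hradm.aestronglyMeasurable
    rw [hmp.map_eq] at this
    exact this.symm
  obtain ⟨hi1, he1⟩ := hproj Prod.fst measurePreserving_fst
  obtain ⟨hi2, he2⟩ := hproj Prod.snd measurePreserving_snd
  have hgap : ∫ z, signedGap h (fun _ : Fin N => true) z ∂(Measure.pi fun _ => μ.prod μ)
      = ∫ z, signAvg (fun σ => signedGap h σ z) ∂(Measure.pi fun _ : Fin N => μ.prod μ) := by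
    unfold signAvg
    rw [integral_div, integral_finsetSum _ fun σ _ =>
      integrable_of_abs_le (measurable_signedGap hm σ) (abs_signedGap_le hb σ)]
    simp only [integral_signedGap_eq μ hm]
    simp
  have hle : ∀ z : Fin N → X × X, signAvg (fun σ => signedGap h σ z)
      ≤ rad (fun i n => h i (z n).2) + rad (fun i n => h i (z n).1) := by
    intro z
    have := rad_add_le (fun i n => h i (z n).2) (fun i n => -h i (z n).1)
    rw [rad_neg] at this
    exact this
  have hfin := (mul_integral_maxDev_le μ hN hm hb).trans (hgap.le.trans (integral_mono
    (integrable_of_abs_le ((Finset.measurable_sum _ fun σ _ => measurable_signedGap hm σ).div_const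
      _) (C := N * b) fun z => ?_) (hi2.add hi1) hle))
  · rw [integral_add' hi2 hi1, he1, he2] at hfin
    rw [integral_const_mul, div_mul_eq_mul_div, le_div_iff₀ hN0]
    linarith
  · have h2 := fun σ => abs_le.1 (abs_signedGap_le hb σ z)
    rw [abs_le]
    constructor
    · rw [← signAvg_const (N := N) (-(N * b))]
      exact signAvg_mono fun σ => (h2 σ).1
    · rw [← signAvg_const (N := N) (N * b)]
      exact signAvg_mono fun σ => (h2 σ).2

end symmetrization

/-! ### The generalization bound -/

theorem abs_signSum_update_sub_le {X ι : Type*} {N : ℕ} {h : ι → X → ℝ} {b : ℝ}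
    (hb : ∀ i u, 0 ≤ h i u ∧ h i u ≤ b) (x : Fin N → X) (k : Fin N)
    (y : X) (σ : Fin N → Bool) (i : ι) :
    |signSum σ (fun n => h i (Function.update x k y n)) - signSum σ (fun n => h i (x n))| ≤ b := by
  have h1 : signSum σ (fun n => h i (Function.update x k y n)) - signSum σ (fun n => h i (x n))
      = sgn (σ k) * (h i y - h i (x k)) := by
    unfold signSum
    rw [← Finset.sum_sub_distrib, Finset.sum_eq_single k]
    · simp [mul_sub]
    · intro n _ hn
      simp [Function.update_of_ne hn]
    · simp
  rw [h1, abs_mul, abs_sgn, one_mul, abs_le]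
  constructor <;> linarith [(hb i y).1, (hb i y).2, (hb i (x k)).1, (hb i (x k)).2]

section finiteClass

variable {X : Type*} [MeasurableSpace X] (μ : Measure X) [IsProbabilityMeasure μ]
  {ι : Type*} [Fintype ι] [Nonempty ι] {N : ℕ} {h : ι → X → ℝ} {b : ℝ}

/-- The maximal deviation exceeds a bound on the empirical Rademacher average by `ε` with
exponentially small probability. -/
theorem measure_exists_deviation_le (hN : 0 < N) (hm : ∀ i, Measurable (h i)) (hb0 : 0 ≤ b)
    (hb : ∀ i u, 0 ≤ h i u ∧ h i u ≤ b) {Bd : (Fin N → X) → ℝ}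
    (hBd : ∀ x : Fin N → X, 2 / N * rad (fun i n => h i (x n)) ≤ Bd x) (ε : ℝ) {t : ℝ}
    (ht : 0 ≤ t) :
    (Measure.pi fun _ : Fin N => μ)
        {x | ∃ i, (∑ n, h i (x n)) / N + Bd x + ε < ∫ u, h i u ∂μ}
      ≤ ENNReal.ofReal (Real.exp (-t * ε + N * ((3 * b / N) ^ 2 * t ^ 2 / 2))) := by
  have hN0 : (0 : ℝ) < N := by exact_mod_cast hN
  -- Concentrating the deviation and the empirical Rademacher average together requires one
  -- application only: a coordinate changes them by `b / N` and `2 b / N`, and symmetrization makes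
  -- the mean nonpositive.
  set f : (Fin N → X) → ℝ := fun x => maxDev μ h x - 2 / N * rad (fun i n => h i (x n)) with hf
  have hradm : Measurable fun x : Fin N → X => rad fun i n => h i (x n) :=
    measurable_rad fun i n => (hm i).comp (measurable_pi_apply n)
  have hdevm : Measurable fun x : Fin N → X => maxDev μ h x :=
    measurable_sup'_univ fun i => measurable_const.sub ((Finset.measurable_sum _ fun n _ =>
      (hm i).comp (measurable_pi_apply n)).div_const _)
  have hfm : Measurable f := hdevm.sub (hradm.const_mul _)
  have hdev : ∀ (x : Fin N → X) k y, |maxDev μ h (Function.update x k y) - maxDev μ h x| ≤ b / N := by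
    intro x k y
    refine abs_sup'_sub_sup'_le fun i => ?_
    have h1 := abs_signSum_update_sub_le hb x k y (fun _ => true) i
    simp only [signSum, sgn, if_true, one_mul] at h1
    rw [show (∫ u, h i u ∂μ - (∑ n, h i (Function.update x k y n)) / N)
        - (∫ u, h i u ∂μ - (∑ n, h i (x n)) / N)
        = -((∑ n, h i (Function.update x k y n) - ∑ n, h i (x n)) / N) by ring,
      abs_neg, abs_div, abs_of_pos hN0]
    exact div_le_div_of_nonneg_right h1 hN0.le
  have hrad : ∀ (x : Fin N → X) k y, |rad (fun i n => h i (Function.update x k y n))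
      - rad (fun i n => h i (x n))| ≤ b := fun x k y =>
    abs_rad_sub_rad_le fun σ i => abs_signSum_update_sub_le hb x k y σ i
  have hdiff : ∀ x k y, |f (Function.update x k y) - f x| ≤ 3 * b / N := by
    intro x k y
    have h1 := abs_le.1 (hdev x k y)
    have h2 := abs_le.1 (hrad x k y)
    have h3 := mul_le_mul_of_nonneg_left h2.1 (show (0 : ℝ) ≤ 2 / N by positivity)
    have h4 := mul_le_mul_of_nonneg_left h2.2 (show (0 : ℝ) ≤ 2 / N by positivity)
    have e : 3 * b / N = b / N + 2 / N * b := by ring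
    simp only [hf]
    rw [e, abs_le]
    constructor <;> linarith [h1.1, h1.2]
  have habs : ∀ i u, |h i u| ≤ b := fun i u => by
    rw [abs_of_nonneg (hb i u).1]; exact (hb i u).2
  have hradC : ∀ x : Fin N → X, |rad (fun i n => h i (x n))| ≤ N * b := fun x =>
    abs_rad_le fun i n => habs i (x n)
  have hdevC : ∀ x : Fin N → X, |maxDev μ h x| ≤ 2 * b := by
    intro x
    refine abs_sup'_le fun i => ?_
    have h1 : |∫ u, h i u ∂μ| ≤ b := by
      refine abs_integral_le_integral_abs.trans ?_
      calc ∫ u, |h i u| ∂μ ≤ ∫ _, b ∂μ := integral_mono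
            (integrable_of_abs_le (hm i) (habs i)).abs (integrable_const _) (habs i)
        _ = b := by simp
    have h2 : |(∑ n, h i (x n)) / N| ≤ b := by
      rw [abs_div, abs_of_pos hN0, div_le_iff₀ hN0]
      refine (Finset.abs_sum_le_sum_abs _ _).trans ?_
      calc ∑ n, |h i (x n)| ≤ ∑ _n : Fin N, b := Finset.sum_le_sum fun n _ => habs i _
        _ = b * N := by simp [mul_comm]
    have := abs_sub (∫ u, h i u ∂μ) ((∑ n, h i (x n)) / N)
    linarith
  have hfC : ∀ x, |f x| ≤ 2 * b + 2 / N * (N * b) := by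
    intro x
    refine (abs_sub _ _).trans (add_le_add (hdevC x) ?_)
    rw [abs_mul, abs_of_pos (show (0 : ℝ) < 2 / N by positivity)]
    exact mul_le_mul_of_nonneg_left (hradC x) (by positivity)
  have hmean : ∫ x, f x ∂(Measure.pi fun _ : Fin N => μ) ≤ 0 := by
    rw [hf, integral_sub (integrable_of_abs_le hdevm hdevC)
      ((integrable_of_abs_le hradm hradC).const_mul _)]
    linarith [integral_maxDev_le μ hN hm hb]
  refine (measure_mono ?_).trans
    (measure_ge_le_of_bounded_differences μ N hfm (by positivity) hdiff hfC ε ht)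
  rintro x ⟨i, hi⟩
  change ε ≤ f x - _
  have h1 : ∫ u, h i u ∂μ - (∑ n, h i (x n)) / N ≤ maxDev μ h x :=
    Finset.le_sup' (fun i => ∫ u, h i u ∂μ - (∑ n, h i (x n)) / N) (Finset.mem_univ i)
  have h2 := hBd x
  simp only [hf] at hmean ⊢
  linarith

end finiteClass

/-! ### The squared error on the simplex -/

section error

variable {K : ℕ}

/-- The normalized squared error of a relabelled membership vector. -/
noncomputable def sqErr (π : Equiv.Perm (Fin K)) (p q : Simplex K) : ℝ :=
  (1 / (K : ℝ)) * ∑ k, (p (π k) - q k) ^ 2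

theorem risk_eq {X : Type*} [MeasurableSpace X] (P : Measure X) (π : Equiv.Perm (Fin K))
    (f f₀ : X → Simplex K) : risk P π f f₀ = ∫ u, sqErr π (f u) (f₀ u) ∂P := by
  simp only [risk, sqErr, Matrix.permMatrix_mulVec, Function.comp]

theorem sum_sq_sub_le_two {p q : Fin K → ℝ} (hp : p ∈ stdSimplex ℝ (Fin K))
    (hq : q ∈ stdSimplex ℝ (Fin K)) : ∑ k, (p k - q k) ^ 2 ≤ 2 := by
  have h1 : ∀ {p : Fin K → ℝ}, p ∈ stdSimplex ℝ (Fin K) → ∀ k, p k ≤ 1 := fun {p} hp k => by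
    rw [← hp.2]
    exact Finset.single_le_sum (f := p) (fun k _ => hp.1 k) (Finset.mem_univ k)
  calc ∑ k, (p k - q k) ^ 2 ≤ ∑ k, (p k + q k) := by
        refine Finset.sum_le_sum fun k _ => ?_
        have := hp.1 k; have := hq.1 k; have := h1 hp k; have := h1 hq k
        nlinarith [mul_nonneg (hp.1 k) (hq.1 k)]
    _ = 2 := by rw [Finset.sum_add_distrib, hp.2, hq.2]; norm_num

theorem comp_perm_mem_stdSimplex (π : Equiv.Perm (Fin K)) (p : Simplex K) :
    (fun k => p (π k)) ∈ stdSimplex ℝ (Fin K) :=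
  ⟨fun k => p.2.1 (π k), by rw [← p.2.2]; exact Equiv.sum_comp π fun k => p k⟩

theorem sqErr_mem_Icc (π : Equiv.Perm (Fin K)) (p q : Simplex K) :
    0 ≤ sqErr π p q ∧ sqErr π p q ≤ 2 / K := by
  refine ⟨mul_nonneg (by positivity) (Finset.sum_nonneg fun _ _ => sq_nonneg _), ?_⟩
  have := sum_sq_sub_le_two (comp_perm_mem_stdSimplex π p) q.2
  calc sqErr π p q ≤ 1 / (K : ℝ) * 2 := mul_le_mul_of_nonneg_left this (by positivity)
    _ = 2 / K := by ring

/-- Factor the difference of squares and apply Cauchy-Schwarz. The second factor is `(p - q) + (p' -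
q)`, of squared norm at most `2 * 2 + 2 * 2 = 8`, whence `2 √2`. -/
theorem abs_sqErr_sub_le (π : Equiv.Perm (Fin K)) (p p' q : Simplex K) :
    |sqErr π p q - sqErr π p' q| ≤ 2 * √2 / K * √(∑ k, (p k - p' k) ^ 2) := by
  have h1 : sqErr π p q - sqErr π p' q
      = 1 / (K : ℝ) * ∑ k, (p (π k) - p' (π k)) * (p (π k) + p' (π k) - 2 * q k) := by
    unfold sqErr
    rw [← mul_sub, ← Finset.sum_sub_distrib]
    congr 1
    exact Finset.sum_congr rfl fun k _ => by ring
  have h2 : ∑ k, (p (π k) + p' (π k) - 2 * q k) ^ 2 ≤ 8 := by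
    have ha := sum_sq_sub_le_two (comp_perm_mem_stdSimplex π p) q.2
    have hb := sum_sq_sub_le_two (comp_perm_mem_stdSimplex π p') q.2
    calc ∑ k, (p (π k) + p' (π k) - 2 * q k) ^ 2
        ≤ ∑ k, (2 * (p (π k) - q k) ^ 2 + 2 * (p' (π k) - q k) ^ 2) :=
          Finset.sum_le_sum fun k _ => by nlinarith [sq_nonneg (p (π k) - p' (π k))]
      _ = 2 * ∑ k, (p (π k) - q k) ^ 2 + 2 * ∑ k, (p' (π k) - q k) ^ 2 := by
          rw [Finset.sum_add_distrib, Finset.mul_sum, Finset.mul_sum]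
      _ ≤ 8 := by
          change ∑ k, (p (π k) - q k) ^ 2 ≤ 2 at ha
          change ∑ k, (p' (π k) - q k) ^ 2 ≤ 2 at hb
          linarith
  have h3 : ∑ k, (p (π k) - p' (π k)) ^ 2 = ∑ k, (p k - p' k) ^ 2 :=
    Equiv.sum_comp π fun k => (p k - p' k) ^ 2
  have h4 : |∑ k, (p (π k) - p' (π k)) * (p (π k) + p' (π k) - 2 * q k)|
      ≤ √(∑ k, (p k - p' k) ^ 2) * (2 * √2) := by
    have hcs := Finset.sum_mul_sq_le_sq_mul_sq Finset.univ (fun k => p (π k) - p' (π k))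
      (fun k => p (π k) + p' (π k) - 2 * q k)
    rw [h3] at hcs
    refine Real.abs_le_sqrt (hcs.trans (mul_le_mul_of_nonneg_left h2
      (Finset.sum_nonneg fun _ _ => sq_nonneg _))) |>.trans (le_of_eq ?_)
    rw [Real.sqrt_mul (Finset.sum_nonneg fun _ _ => sq_nonneg _)]
    congr 1
    rw [show (8 : ℝ) = 2 ^ 2 * 2 by norm_num, Real.sqrt_mul (by norm_num),
      Real.sqrt_sq (by norm_num)]
  rw [h1, abs_mul, abs_of_nonneg (show 0 ≤ 1 / (K : ℝ) by positivity)]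
  calc _ ≤ 1 / (K : ℝ) * (√(∑ k, (p k - p' k) ^ 2) * (2 * √2)) :=
        mul_le_mul_of_nonneg_left h4 (by positivity)
    _ = _ := by ring

end error

/-! ### Uniform deviation bounds for network classes -/

section classes

variable {d K N : ℕ} {𝒳 : Set (EuclideanSpace ℝ (Fin d))}

theorem Arch.continuous_of_mem_nets {n : ℕ} (a : Arch d n) :
    ∀ g ∈ a.nets, Continuous g := by
  induction a with
  | input => rintro g rfl; exact continuous_id
  | snoc a ℓ ih =>
    rintro _ ⟨g, hg, W, hW, rfl⟩
    exact ℓ.act_lipschitz.continuous.comp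
      ((LayerSpec.lipschitz_toEuclideanLin hW).continuous.comp (ih g hg))

theorem OutputLayer.continuous_apply (o : OutputLayer K) (k : Fin K) :
    Continuous fun z => o.out z k := by
  refine LipschitzWith.continuous (K := 1) (LipschitzWith.of_dist_le_mul fun z w => ?_)
  rw [NNReal.coe_one, one_mul, dist_eq_norm z w, Real.dist_eq]
  refine le_trans ?_ (o.out_lipschitz z w)
  refine Real.abs_le_sqrt ?_
  exact Finset.single_le_sum (f := fun k => (o.out z k - o.out w k) ^ 2)
    (fun _ _ => sq_nonneg _) (Finset.mem_univ k)

theorem NetClass.measurable_apply {c : NetClass d K} {f : 𝒳 → Simplex K} (hf : f ∈ c.funs 𝒳)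
    (k : Fin K) : Measurable fun u => f u k := by
  obtain ⟨g, hg, rfl⟩ := hf
  exact ((c.output.continuous_apply k).comp
    ((c.arch.continuous_of_mem_nets g hg).comp continuous_subtype_val)).measurable

theorem NetClass.measurable_sqErr {c : NetClass d K} {f f₀ : 𝒳 → Simplex K} (hf : f ∈ c.funs 𝒳)
    (hf₀ : f₀ ∈ c.funs 𝒳) (π : Equiv.Perm (Fin K)) :
    Measurable fun u => sqErr π (f u) (f₀ u) :=
  (Finset.measurable_sum _ fun k _ =>
    ((measurable_apply hf (π k)).sub (measurable_apply hf₀ k)).pow_const 2).const_mul _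

theorem exists_countable_seq_dense {Y : Type*} [TopologicalSpace Y]
    [TopologicalSpace.PseudoMetrizableSpace Y] [TopologicalSpace.SeparableSpace Y] (s : Set Y) :
    ∃ t ⊆ s, t.Countable ∧ ∀ y ∈ s, ∃ w : ℕ → Y, (∀ m, w m ∈ t) ∧ Tendsto w atTop (𝓝 y) := by
  obtain ⟨t, hts, htc, ht⟩ :=
    (TopologicalSpace.IsSeparable.of_separableSpace s).exists_countable_dense_subset
  exact ⟨t, hts, htc, fun y hy => mem_closure_iff_seq_limit.1 (ht hy)⟩

/-- Every network is a pointwise limit of networks from a fixed countable family. -/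
theorem Arch.exists_countable_dense {n : ℕ} (a : Arch d n) :
    ∃ D ⊆ a.nets, D.Countable ∧ ∀ g ∈ a.nets, ∃ s : ℕ → _, (∀ m, s m ∈ D) ∧
      ∀ u, Tendsto (fun m => s m u) atTop (𝓝 (g u)) := by
  induction a with
  | input => exact ⟨{id}, le_rfl, Set.countable_singleton _, fun g hg => ⟨fun _ => g, fun _ => hg,
      fun u => tendsto_const_nhds⟩⟩
  | @snoc m a n ℓ ih =>
    obtain ⟨D, hDa, hDc, hD⟩ := ih
    obtain ⟨E, hEW, hEc, hE⟩ :=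
      exists_countable_seq_dense (Y := Fin n → Fin m → ℝ) ℓ.weights
    refine ⟨Set.image2 (fun g (W : Matrix (Fin n) (Fin m) ℝ) x =>
      ℓ.act (Matrix.toEuclideanLin W (g x))) D E, ?_, hDc.image2 hEc _, ?_⟩
    · rintro _ ⟨g, hg, W, hW, rfl⟩
      exact ⟨g, hDa hg, W, hEW hW, rfl⟩
    · rintro _ ⟨g, hg, W, hW, rfl⟩
      obtain ⟨s, hsD, hs⟩ := hD g hg
      obtain ⟨w, hwE, hw⟩ := hE W hW
      refine ⟨fun j x => ℓ.act (Matrix.toEuclideanLin (w j : Matrix (Fin n) (Fin m) ℝ) (s j x)),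
        fun j => ⟨s j, hsD j, w j, hwE j, rfl⟩, fun u => ?_⟩
      have hc : Continuous fun p : Matrix (Fin n) (Fin m) ℝ × EuclideanSpace ℝ (Fin m) =>
          ℓ.act (Matrix.toEuclideanLin p.1 p.2) := by
        refine ℓ.act_lipschitz.continuous.comp ?_
        have : Continuous fun p : Matrix (Fin n) (Fin m) ℝ × EuclideanSpace ℝ (Fin m) =>
            (WithLp.toLp 2 (p.1 *ᵥ p.2.ofLp) : EuclideanSpace ℝ (Fin n)) := by fun_prop
        exact this
      have hw' : Tendsto (fun j => (w j : Matrix (Fin n) (Fin m) ℝ)) atTop (𝓝 W) := hw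
      have hp := hw'.prodMk_nhds (hs u)
      have := (hc.tendsto (W, g u)).comp hp
      exact this

theorem NetClass.exists_countable_dense (c : NetClass d K) (𝒳 : Set (EuclideanSpace ℝ (Fin d))) :
    ∃ D ⊆ c.funs 𝒳, D.Countable ∧ ∀ f ∈ c.funs 𝒳, ∃ s : ℕ → 𝒳 → Simplex K, (∀ m, s m ∈ D) ∧
      ∀ u k, Tendsto (fun m => s m u k) atTop (𝓝 (f u k)) := by
  obtain ⟨D, hDa, hDc, hD⟩ := c.arch.exists_countable_dense
  refine ⟨(fun g (u : 𝒳) => c.output.out (g u)) '' D, ?_, hDc.image _, ?_⟩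
  · rintro _ ⟨g, hg, rfl⟩
    exact ⟨g, hDa hg, rfl⟩
  · rintro _ ⟨g, hg, rfl⟩
    obtain ⟨s, hsD, hs⟩ := hD g hg
    exact ⟨fun m u => c.output.out (s m u), fun m => ⟨s m, hsD m, rfl⟩, fun u k =>
      ((c.output.continuous_apply k).tendsto _).comp (hs u)⟩

/-- The entropy of the error vectors of a network class on a sample. -/
theorem NetClass.exists_cover_sqErr (hK : 0 < K) (c : NetClass d K) (f₀ : 𝒳 → Simplex K)
    (π : Equiv.Perm (Fin K)) (x : Fin N → 𝒳) {ε : ℝ} (hε : 0 < ε) :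
    ∃ C : Finset (EuclideanSpace ℝ (Fin N)),
      (C.card : ℝ) ≤ Real.exp (8 * c.arch.complexity *
        √(∑ n, ‖(x n : EuclideanSpace ℝ (Fin d))‖ ^ 2) ^ 2 / (K * ε) ^ 2) ∧
      ∀ f ∈ c.funs 𝒳, ∃ z ∈ C,
        ‖(WithLp.toLp 2 fun n => sqErr π (f (x n)) (f₀ (x n)) : EuclideanSpace ℝ (Fin N)) - z‖
          ≤ ε := by
  classical
  have hK0 : (0 : ℝ) < K := by exact_mod_cast hK
  have hlp := c.arch.lipProd_nonneg
  have hrs := c.arch.ratioSum_nonneg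
  set X : Cols N d := WithLp.toLp 2 fun n => (x n : EuclideanSpace ℝ (Fin d)) with hX
  have hXn : ‖X‖ ^ 2 = √(∑ n, ‖(x n : EuclideanSpace ℝ (Fin d))‖ ^ 2) ^ 2 := by
    rw [PiLp.norm_sq_eq_of_L2, Real.sq_sqrt (Finset.sum_nonneg fun _ _ => sq_nonneg _)]
  have h2 : √(2 : ℝ) ^ 2 = 2 := Real.sq_sqrt (by norm_num)
  have h20 : 0 < √(2 : ℝ) := Real.sqrt_pos.2 (by norm_num)
  -- The radius in output space that the Lipschitz constant `2 √2 / K` of the error turns into `ε`;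
  -- its square is the source of the factor `8` in the entropy.
  set ε' := K * ε / (2 * √2) with hε'
  have hε'0 : 0 < ε' := by positivity
  have hε'2 : ε' ^ 2 = (K * ε) ^ 2 / 8 := by
    rw [hε', div_pow, mul_pow 2, h2]; norm_num
  set T := c.arch.lipProd * c.arch.ratioSum ^ 3 * ‖X‖ ^ 2 / ε' ^ 2 with hT
  obtain ⟨C, hC, -, hcov⟩ := c.arch.exists_cover X le_rfl (hK.trans_le c.arch.le_maxDim)
    hε'0.le (T := T) (by positivity) (by rw [hT, div_mul_cancel₀ _ (by positivity)])
  set Φ : Cols N K → EuclideanSpace ℝ (Fin N) := fun Z =>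
    WithLp.toLp 2 fun n => sqErr π (c.output.out (Z n)) (f₀ (x n)) with hΦ
  refine ⟨C.image Φ, ?_, ?_⟩
  · refine le_trans (by exact_mod_cast Finset.card_image_le) (hC.trans (le_of_eq ?_))
    congr 1
    rw [hT, hε'2, hXn, Arch.complexity]
    field_simp
  · rintro _ ⟨g, hg, rfl⟩
    obtain ⟨z, hz, hgz⟩ := hcov g hg
    refine ⟨Φ z, Finset.mem_image_of_mem _ hz, ?_⟩
    have hkey : ‖(WithLp.toLp 2 fun n => sqErr π (c.output.out (g (x n))) (f₀ (x n)) :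
        EuclideanSpace ℝ (Fin N)) - Φ z‖ ≤ 2 * √2 / K * ‖mapCols g X - z‖ := by
      refine (sq_le_sq₀ (norm_nonneg _) (by positivity)).1 ?_
      rw [EuclideanSpace.norm_sq_eq, mul_pow, PiLp.norm_sq_eq_of_L2, Finset.mul_sum]
      refine Finset.sum_le_sum fun n _ => ?_
      rw [← mul_pow]
      refine pow_le_pow_left₀ (norm_nonneg _) ?_ 2
      refine (abs_sqErr_sub_le π (c.output.out (g (x n))) (c.output.out (z n)) (f₀ (x n))).trans ?_
      exact mul_le_mul_of_nonneg_left (c.output.out_lipschitz _ _) (by positivity)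
    refine hkey.trans ((mul_le_mul_of_nonneg_left hgz (by positivity)).trans (le_of_eq ?_))
    rw [hε']; field_simp

theorem NetClass.complexity_nonneg (hK : 0 < K) (c : NetClass d K) : 0 ≤ c.arch.complexity := by
  refine mul_nonneg (mul_nonneg (Real.log_nonneg ?_) c.arch.lipProd_nonneg)
    (pow_nonneg c.arch.ratioSum_nonneg 3)
  have : (1 : ℝ) ≤ c.arch.maxDim := by exact_mod_cast (hK.trans_le c.arch.le_maxDim)
  nlinarith

/-- The data sets on which the generalization bound holds for all functions of the class. -/
def goodData (PX : Measure 𝒳) (f₀ : 𝒳 → Simplex K) (N : ℕ) (c : NetClass d K)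
    (π : Equiv.Perm (Fin K)) (δ : ℝ) : Set (Fin N → 𝒳) :=
  {x | ∀ f ∈ c.funs 𝒳, risk PX π f f₀
    ≤ (∑ n, sqErr π (f (x n)) (f₀ (x n))) / N + genBound (K := K) c.arch.complexity x δ}

/-- The data sets on which the generalization bound fails for a given function. -/
def badData (PX : Measure 𝒳) (f₀ : 𝒳 → Simplex K) (N : ℕ) (c : NetClass d K)
    (π : Equiv.Perm (Fin K)) (δ : ℝ) (f : 𝒳 → Simplex K) : Set (Fin N → 𝒳) :=
  {x | (∑ n, sqErr π (f (x n)) (f₀ (x n))) / N + genBound (K := K) c.arch.complexity x δ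
    < risk PX π f f₀}

variable {PX : Measure 𝒳} {f₀ : 𝒳 → Simplex K} {c : NetClass d K}
  {π : Equiv.Perm (Fin K)} {δ : ℝ}

/-- The error of `f` under `π'` is the error under `π` of the relabelling of `f` by `π' * π⁻¹`,
which also belongs to the class. -/
theorem goodData_subset_of_closed (hc : ClosedUnderRelabelling (c.funs 𝒳))
    (π π' : Equiv.Perm (Fin K)) : goodData PX f₀ N c π δ ⊆ goodData PX f₀ N c π' δ := by
  intro x hx f hf
  obtain ⟨g, hg, hgf⟩ := hc f hf (π' * π⁻¹)
  have he : ∀ u, sqErr π (g u) (f₀ u) = sqErr π' (f u) (f₀ u) := fun u => by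
    simp [sqErr, hgf]
  have := hx g hg
  simpa only [risk_eq, he] using this

variable [IsProbabilityMeasure PX]

theorem measure_badData_finite_le (hN : 0 < N) (hK : 0 < K) (hf₀ : f₀ ∈ c.funs 𝒳)
    (hδ : δ ∈ Set.Ioo (0 : ℝ) 1) {ι : Type*} [Fintype ι] [Nonempty ι] {f : ι → 𝒳 → Simplex K}
    (hf : ∀ i, f i ∈ c.funs 𝒳) :
    (Measure.pi fun _ : Fin N => PX) {x | ∃ i, x ∈ badData PX f₀ N c π δ (f i)}
      ≤ ENNReal.ofReal δ := by
  have hN0 : (0 : ℝ) < N := by exact_mod_cast hN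
  have hK0 : (0 : ℝ) < K := by exact_mod_cast hK
  set L := Real.log (4 / δ) with hL
  have hL0 : 0 ≤ L := Real.log_nonneg (by rw [le_div_iff₀ hδ.1]; linarith [hδ.2])
  set ε := 8 * √(2 * L / (N * K ^ 2)) with hε
  have hε2 : ε ^ 2 = 128 * L / (N * K ^ 2) := by
    rw [hε, mul_pow, Real.sq_sqrt (by positivity)]; ring
  have hmain := measure_exists_deviation_le PX (N := N) (h := fun i u => sqErr π (f i u) (f₀ u))
    (b := 2 / K) hN (fun i => NetClass.measurable_sqErr (hf i) hf₀ π) (by positivity)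
    (fun i u => sqErr_mem_Icc π _ _)
    (Bd := fun x => 8 / (N * K) + 12 * √(2 * c.arch.complexity)
      * √(∑ n, ‖(x n : EuclideanSpace ℝ (Fin d))‖ ^ 2) * Real.log N / (N * K * Real.log 2))
    (fun x => two_div_mul_rad_le hN hK0
      (fun i => WithLp.toLp 2 fun n => sqErr π (f i (x n)) (f₀ (x n)))
      (NetClass.complexity_nonneg hK c) (Real.sqrt_nonneg _) (fun i n => sqErr_mem_Icc π _ _)
      fun ε hε => by
        obtain ⟨C, hC, hcov⟩ := c.exists_cover_sqErr hK f₀ π x hε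
        exact ⟨C, hC, fun i => hcov _ (hf i)⟩)
    ε (t := ε * N * K ^ 2 / 36) (by positivity)
  refine le_trans (measure_mono ?_) (hmain.trans (ENNReal.ofReal_le_ofReal ?_))
  · rintro x ⟨i, hi⟩
    refine ⟨i, ?_⟩
    rw [← risk_eq]
    refine lt_of_le_of_lt (le_of_eq ?_) hi
    rw [genBound]
    ring
  -- With differences `3 * (2 / K) / N` this `t` minimizes the exponent, at `-ε² N K² / 72 = -(16/9)
  -- L`. That is more than enough, since `exp (-L) = δ / 4`.
  · have he : -(ε * N * K ^ 2 / 36) * ε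
        + N * ((3 * (2 / K) / N) ^ 2 * (ε * N * K ^ 2 / 36) ^ 2 / 2) = -(16 / 9) * L := by
      have e1 : -(ε * N * K ^ 2 / 36) * ε
        + N * ((3 * (2 / K) / N) ^ 2 * (ε * N * K ^ 2 / 36) ^ 2 / 2)
          = - ε ^ 2 * (N * K ^ 2) / 72 := by
        field_simp; ring
      rw [e1, hε2]
      field_simp; ring
    rw [he]
    calc Real.exp (-(16 / 9) * L) ≤ Real.exp (-L) := Real.exp_le_exp.2 (by linarith)
      _ = δ / 4 := by
          rw [Real.exp_neg, hL, Real.exp_log (div_pos (by norm_num) hδ.1), inv_div]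
      _ ≤ δ := by linarith [hδ.1]

/-- The bound fails for some function of the class with probability at most `δ`. -/
theorem measure_compl_goodData_le (hN : 0 < N) (hK : 0 < K) (hf₀ : f₀ ∈ c.funs 𝒳)
    (hδ : δ ∈ Set.Ioo (0 : ℝ) 1) :
    (Measure.pi fun _ : Fin N => PX) (goodData PX f₀ N c π δ)ᶜ ≤ ENNReal.ofReal δ := by
  obtain ⟨D, hDF, hDc, hD⟩ := c.exists_countable_dense 𝒳
  have hDne : D.Nonempty := by
    obtain ⟨s, hs, -⟩ := hD f₀ hf₀
    exact ⟨s 0, hs 0⟩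
  obtain ⟨e, rfl⟩ := hDc.exists_eq_range hDne
  -- Failure of the bound is a strict inequality between quantities continuous under pointwise
  -- limits, by dominated convergence for the risk; so it already occurs for a member of the
  -- countable family.
  have hsub : (goodData PX f₀ N c π δ)ᶜ
      ⊆ ⋃ m : ℕ, {x | ∃ i : Fin (m + 1), x ∈ badData PX f₀ N c π δ (e i)} := by
    intro x hx
    obtain ⟨f, hfF, hf⟩ : ∃ f ∈ c.funs 𝒳, x ∈ badData PX f₀ N c π δ f := by
      by_contra hcon
      push Not at hcon
      exact hx fun f hf => not_lt.1 (hcon f hf)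
    obtain ⟨s, hsD, hs⟩ := hD f hfF
    have hpt : ∀ u, Tendsto (fun m => sqErr π (s m u) (f₀ u)) atTop (𝓝 (sqErr π (f u) (f₀ u))) :=
      fun u => (tendsto_finsetSum _ fun k _ => ((hs u (π k)).sub_const _).pow 2).const_mul _
    have hrisk : Tendsto (fun m => risk PX π (s m) f₀) atTop (𝓝 (risk PX π f f₀)) := by
      simp only [risk_eq]
      refine tendsto_integral_of_dominated_convergence (fun _ => 2 / (K : ℝ))
        (fun m => (NetClass.measurable_sqErr (hDF (hsD m)) hf₀ π).aestronglyMeasurable)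
        (integrable_const _) (fun m => Eventually.of_forall fun u => ?_)
        (Eventually.of_forall hpt)
      rw [Real.norm_of_nonneg (sqErr_mem_Icc π _ _).1]
      exact (sqErr_mem_Icc π _ _).2
    have hemp : Tendsto (fun m => (∑ n, sqErr π (s m (x n)) (f₀ (x n))) / N
        + genBound (K := K) c.arch.complexity x δ) atTop
        (𝓝 ((∑ n, sqErr π (f (x n)) (f₀ (x n))) / N
          + genBound (K := K) c.arch.complexity x δ)) :=
      ((tendsto_finsetSum _ fun n _ => hpt (x n)).div_const _).add_const _
    obtain ⟨m, hm⟩ := (hemp.eventually_lt hrisk hf).exists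
    obtain ⟨j, hj⟩ := hsD m
    refine Set.mem_iUnion.2 ⟨j, ⟨⟨j, Nat.lt_succ_self j⟩, ?_⟩⟩
    rw [hj]
    exact hm
  refine (measure_mono hsub).trans ?_
  -- Continuity along increasing unions transfers the finite-family bound with the same `δ`, and
  -- avoids asking for measurability of the good set.
  have hmono : Monotone fun m : ℕ =>
      {x | ∃ i : Fin (m + 1), x ∈ badData PX f₀ N c π δ (e i)} := by
    rintro m m' hmm x ⟨i, hi⟩
    exact ⟨⟨i, by omega⟩, hi⟩
  rw [hmono.measure_iUnion]
  exact iSup_le fun m => measure_badData_finite_le hN hK hf₀ hδ fun i => hDF ⟨i, rfl⟩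

end classes

/-! ### Identifiability -/

/-- In the limit regime, the sample sizes tend to infinity. -/
theorem tendsto_sampleSize {M : ℕ → ℕ} {α r : ℕ → ℝ} (hM : ∀ t, 0 < M t)
    (hα : ∀ t, 0 < α t ∧ α t ≤ 1 / 2)
    (h : Tendsto (fun t => max (Real.log (1 / α t)) (r t) / √(M t)) atTop (𝓝 0)) :
    Tendsto M atTop atTop := by
  have hl2 : 0 < Real.log 2 := Real.log_pos (by norm_num)
  rw [tendsto_atTop]
  intro B
  have hB : 0 < Real.log 2 / (√B + 1) := by positivity
  filter_upwards [h.eventually (gt_mem_nhds hB)] with t ht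
  -- As `α t ≤ 1/2`, the numerator stays above `log 2`; the quotient can vanish only if `M t` grows.
  have h1 : Real.log 2 ≤ max (Real.log (1 / α t)) (r t) := by
    refine le_max_of_le_left (Real.log_le_log (by norm_num) ?_)
    rw [le_div_iff₀ (hα t).1]
    linarith [(hα t).2]
  by_contra hcon
  push Not at hcon
  have hMB : √(M t : ℝ) ≤ √B := Real.sqrt_le_sqrt (by exact_mod_cast hcon.le)
  have hM0 : 0 < √(M t : ℝ) := Real.sqrt_pos.2 (by exact_mod_cast hM t)
  rw [div_lt_div_iff₀ hM0 (by positivity)] at ht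
  nlinarith [mul_le_mul_of_nonneg_left hMB hl2.le,
    mul_le_mul_of_nonneg_right h1 (show 0 ≤ √(B : ℝ) + 1 by positivity)]

end DCC

theorem theorem4 {d K N : ℕ} [NeZero N] (𝒳 : Set (EuclideanSpace ℝ (Fin d)))
    (PX : Measure 𝒳) [IsProbabilityMeasure PX]
    (fnat : 𝒳 → DCC.Simplex K)
    (A : Matrix (Fin K) (Fin K) ℝ) (hA : A ∈ Matrix.colStochastic ℝ (Fin K)) :
    ∃ G : DCC.NetClass d K → Equiv.Perm (Fin K) → ℝ → Set (Fin N → 𝒳),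
      (∀ c, fnat ∈ c.funs 𝒳 → ∀ π, ∀ δ ∈ Set.Ioo (0 : ℝ) 1,
        (Measure.pi fun _ : Fin N => PX) (G c π δ)ᶜ ≤ ENNReal.ofReal δ) ∧
      (∀ c, DCC.ClosedUnderRelabelling (c.funs 𝒳) → ∀ π π' δ, G c π δ = G c π' δ) ∧
      ∀ (c : ℕ → DCC.NetClass d K) (M : ℕ → ℕ) (α : ℕ → ℝ),
        (∀ t, fnat ∈ (c t).funs 𝒳) →
        (∀ t, 0 < M t) →
        (∀ t, 0 < α t ∧ α t < 1) →
        (∀ t, ∀ f ∈ (c t).funs 𝒳, ∀ u v : 𝒳,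
          α t < (f u : Fin K → ℝ) ⬝ᵥ (f v : Fin K → ℝ) ∧
            (f u : Fin K → ℝ) ⬝ᵥ (f v : Fin K → ℝ) < 1 - α t) →
        Tendsto (fun t => max (Real.log (1 / α t))
          (Real.log (M t) * √((c t).arch.complexity) / α t) / √(M t)) atTop (𝓝 0) →
        ∀ x : Fin N → 𝒳,
          DCC.SSC (DCC.membership fnat x) →
          (Aᵀ * A * DCC.membership fnat x).rank = K →
          ∀ᵐ S ∂(DCC.annotationStream fun i j =>
              DCC.sim (DCC.confuse A hA (fnat (x i))) (DCC.confuse A hA (fnat (x j)))),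
            ∀ (f : ℕ → 𝒳 → DCC.Simplex K) (B : ℕ → Matrix (Fin K) (Fin K) ℝ),
              DCC.IsMaxVolumeSolution (fun t => (c t).funs 𝒳) M x S f B →
              (∀ Mstar, MapClusterPt Mstar atTop (fun t => DCC.membership (f t) x) →
                ∃ π : Equiv.Perm (Fin K), π.permMatrix ℝ * Mstar = DCC.membership fnat x) ∧
              ∃ π : ℕ → Equiv.Perm (Fin K),
                Tendsto (fun t => (π t).permMatrix ℝ * DCC.membership (f t) x) atTop
                  (𝓝 (DCC.membership fnat x)) ∧
                ∀ δ ∈ Set.Ioo (0 : ℝ) 1, ∀ η : ℝ, 0 < η → ∀ᶠ t in atTop,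
                  x ∈ G (c t) (π t) δ →
                    DCC.risk PX (π t) (f t) fnat
                      ≤ DCC.genBound (K := K) (c t).arch.complexity x δ + η := by
  have hK : 0 < K := by
    obtain ⟨u⟩ : Nonempty 𝒳 := nonempty_of_isProbabilityMeasure PX
    rcases Nat.eq_zero_or_pos K with rfl | h
    · have := (fnat u).2.2
      simp at this
    · exact h
  have hN : 0 < N := Nat.pos_of_ne_zero (NeZero.ne N)
  refine ⟨fun c π δ => DCC.goodData PX fnat N c π δ,
    fun c hc π δ hδ => DCC.measure_compl_goodData_le hN hK hc hδ,
    fun c hc π π' δ => (DCC.goodData_subset_of_closed hc π π').antisymm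
      (DCC.goodData_subset_of_closed hc π' π), ?_⟩
  intro c M α hfnat hM hα hsep hlim x hSSC hrank
  have hMinf : Tendsto M atTop atTop := by
    refine DCC.tendsto_sampleSize hM (fun t => ⟨(hα t).1, ?_⟩) hlim
    -- The separation interval is nonempty, so `α t < 1 - α t`.
    have := hsep t fnat (hfnat t) (x 0) (x 0)
    linarith [this.1, this.2]
  filter_upwards [DCC.ae_tendsto_freq _, DCC.ae_stream_ne_zero _] with S hS hS0
  intro f B hf
  have hclust : ∀ Mstar, MapClusterPt Mstar atTop (fun t => DCC.membership (f t) x) →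
      ∃ π : Equiv.Perm (Fin K), π.permMatrix ℝ * Mstar = DCC.membership fnat x := fun Mstar hstar =>
    DCC.IsMaxVolumeSolution.exists_perm_of_mapClusterPt hfnat hMinf hS hS0 hSSC hrank hf hstar
  refine ⟨hclust, ?_⟩
  obtain ⟨π, hπ⟩ := DCC.exists_perm_tendsto hclust
  refine ⟨π, hπ, fun δ hδ η hη => ?_⟩
  have hentry : ∀ k n, Tendsto (fun t => f t (x n) (π t k)) atTop (𝓝 (fnat (x n) k)) := by
    intro k n
    have hc : Continuous fun Z : Matrix (Fin K) (Fin N) ℝ => Z k n :=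
      continuous_id.matrix_elem k n
    have := (hc.tendsto (DCC.membership fnat x)).comp hπ
    refine this.congr fun t => ?_
    change ((π t).permMatrix ℝ *ᵥ fun k => f t (x n) k) k = _
    rw [Matrix.permMatrix_mulVec]
    rfl
  have hemp : Tendsto (fun t => (∑ n, DCC.sqErr (π t) (f t (x n)) (fnat (x n))) / N) atTop
      (𝓝 0) := by
    have : Tendsto (fun t => (∑ n, DCC.sqErr (π t) (f t (x n)) (fnat (x n))) / N) atTop
        (𝓝 ((∑ n : Fin N, (1 / (K : ℝ)) * ∑ k, (fnat (x n) k - fnat (x n) k) ^ 2) / N)) :=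
      (tendsto_finsetSum _ fun n _ => (tendsto_finsetSum _ fun k _ =>
        ((hentry k n).sub_const _).pow 2).const_mul _).div_const _
    simpa using this
  -- The bound on the good data holds uniformly over the class, so it applies to the
  -- annotation-dependent `f t`; the empirical error is eventually below `η`.
  filter_upwards [hemp.eventually (gt_mem_nhds hη)] with t ht hx
  have := hx (f t) (hf.1.1 t).1
  linarith
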